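/- Let $\mathbb{C}((x^{1/a}))((y^{1/a}))$ denote the field of formal Laurent series in $y^{1/a}$ with coefficients in the field of formal Laurent series in $x^{1/a}$ over $\mathbb{C}$, with the usual inclusions for $a\mid b$ (for instance, all inside the field of iterated generalized power series in $x$ and $y$ with exponents in $\mathbb{Q}$), and let $$K=\bigcup_{a\in\mathbb{N}\setminus 3\mathbb{N}}\mathbb{C}((x^{1/a}))((y^{1/a})).$$ Then the following hold: 1. Every finite Galois extension $L/K$ has degree $3^n$ for some integer $n\geqslant 0$. 2. There is a non-trivial Severi-Brauer surface $S$ over $K$ that has no point of degree $6$. Here a Severi-Brauer surface over $K$ is a projective variety $S$ over $K$ with $S\times_K\overline{K}\simeq\mathbb{P}^2_{\overline{K}}$, where $\overline{K}$ is an algebraic closure of $K$; it is non-trivial if $S(K)=\varnothing$; and a point of degree $d$ is a closed point $p$ of $S$ whose residue field satisfies $[\kappa(p):K]=d$. -/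

import Mathlib

open CategoryTheory CategoryTheory.Limits AlgebraicGeometry

noncomputable section

/-! ### The field `⋃_{a ∉ 3ℕ} k((x^{1/a}))((y^{1/a}))` -/

/-- Applying a ring homomorphism to all coefficients of a Hahn series, as a ring homomorphism. -/
def hahnMapRingHom {Γ R S : Type*} [AddCommMonoid Γ] [PartialOrder Γ] [IsOrderedCancelAddMonoid Γ]
    [Semiring R] [Semiring S] (φ : R →+* S) : HahnSeries Γ R →+* HahnSeries Γ S where
  toFun f := f.map φ
  map_one' := HahnSeries.map_one φ.toMonoidWithZeroHom
  map_mul' _ _ := HahnSeries.map_mul φ.toNonUnitalRingHom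
  map_zero' := by ext; simp
  map_add' _ _ := by ext; simp

/-- The order embedding `n ↦ n / a` of `ℤ` into `ℚ`. -/
def divEmb (a : ℕ+) : ℤ ↪o ℚ :=
  OrderEmbedding.ofMapLEIff (fun n => (n : ℚ) / (a : ℚ)) fun m n => by
    have ha : (0 : ℚ) < (a : ℚ) := by positivity
    rw [div_le_div_iff_of_pos_right ha]
    exact Int.cast_le

/-- The substitution `t ↦ t^{1/a}`: the ring homomorphism `R((t)) → R[[t^ℚ]]` sending
`∑ rₙ tⁿ` to `∑ rₙ t^{n/a}`. Its image is `R((t^{1/a}))`. -/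
def rootSubst (R : Type*) [Semiring R] (a : ℕ+) : LaurentSeries R →+* HahnSeries ℚ R where
  toFun := HahnSeries.embDomain (divEmb a)
  map_one' := HahnSeries.embDomain_one _ (by simp [divEmb])
  map_mul' := HahnSeries.embDomain_mul _ (fun m n => by simp [divEmb, add_div])
  map_zero' := HahnSeries.embDomain_zero
  map_add' := HahnSeries.embDomain_add _

/-- The ring homomorphism `k((x))((y)) → k[[x^ℚ]][[y^ℚ]]` with `x ↦ x^{1/a}`, `y ↦ y^{1/a}`.
Its image is `k((x^{1/a}))((y^{1/a}))`. -/
def rootSubst₂ (k : Type*) [Field k] (a : ℕ+) :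
    LaurentSeries (LaurentSeries k) →+* HahnSeries ℚ (HahnSeries ℚ k) :=
  (rootSubst (HahnSeries ℚ k) a).comp (hahnMapRingHom (rootSubst k a))

/-- A Hahn series lies in `R((t^{1/a}))` iff its exponents lie in `(1/a)ℤ`. -/
theorem mem_range_rootSubst {R : Type*} [Semiring R] {a : ℕ+} {f : HahnSeries ℚ R} :
    f ∈ Set.range (rootSubst R a) ↔ ∀ q, f.coeff q ≠ 0 → ∃ n : ℤ, divEmb a n = q := by
  constructor
  · rintro ⟨g, rfl⟩ q hq
    by_contra h
    exact hq (HahnSeries.embDomain_of_notMem_range h)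
  · intro h
    have hs : (Function.support fun n : ℤ => f.coeff (divEmb a n)).IsPWO := by
      intro u
      obtain ⟨i, j, hij, hle⟩ := f.isPWO_support fun k => ⟨divEmb a (u k), (u k).2⟩
      exact ⟨i, j, hij, (divEmb a).le_iff_le.1 hle⟩
    refine ⟨⟨fun n => f.coeff (divEmb a n), hs⟩, ?_⟩
    ext q
    by_cases hq : ∃ n, divEmb a n = q
    · obtain ⟨n, rfl⟩ := hq
      exact HahnSeries.embDomain_coeff
    · refine (HahnSeries.embDomain_of_notMem_range hq).trans ?_
      by_contra h'
      exact hq (h q (Ne.symm h'))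

/-- An element of `k[[x^ℚ]][[y^ℚ]]` lies in `k((x^{1/a}))((y^{1/a}))` iff all its exponents, in
`x` and in `y`, lie in `(1/a)ℤ`. -/
theorem mem_range_rootSubst₂ {k : Type*} [Field k] {a : ℕ+} {f : HahnSeries ℚ (HahnSeries ℚ k)} :
    f ∈ Set.range (rootSubst₂ k a) ↔ ∀ q r, (f.coeff q).coeff r ≠ 0 →
      (∃ n : ℤ, divEmb a n = q) ∧ ∃ m : ℤ, divEmb a m = r := by
  constructor
  · rintro ⟨g, rfl⟩ q r hqr
    have hq : ∃ n : ℤ, divEmb a n = q :=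
      mem_range_rootSubst.1 ⟨_, rfl⟩ q fun h => hqr (by
        exact (congrArg (fun c => HahnSeries.coeff c r) h).trans rfl)
    refine ⟨hq, ?_⟩
    obtain ⟨n, rfl⟩ := hq
    refine mem_range_rootSubst.1 ⟨g.coeff n, ?_⟩ r hqr
    exact (HahnSeries.embDomain_coeff (f := divEmb a) (x := hahnMapRingHom (rootSubst k a) g)).symm
  · intro h
    obtain ⟨g, rfl⟩ := (mem_range_rootSubst (a := a) (f := f)).2 fun q hq => by
      obtain ⟨r, hr⟩ : ∃ r, (f.coeff q).coeff r ≠ 0 := by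
        by_contra! h'
        exact hq (HahnSeries.ext (funext h'))
      exact (h q r hr).1
    have hg (n : ℤ) : g.coeff n ∈ Set.range (rootSubst k a) := by
      refine mem_range_rootSubst.2 fun r hr => (h (divEmb a n) r ?_).2
      change ((HahnSeries.embDomain (divEmb a) g).coeff (divEmb a n)).coeff r ≠ 0
      rwa [HahnSeries.embDomain_coeff]
    choose c hc using hg
    have hc0 (n : ℤ) (hn : g.coeff n = 0) : c n = 0 := by
      refine HahnSeries.embDomain_injective (f := divEmb a) ?_
      rw [HahnSeries.embDomain_zero]
      exact (hc n).trans hn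
    refine ⟨⟨c, g.isPWO_support.mono fun n hn h0 => hn (hc0 n h0)⟩, ?_⟩
    refine congrArg (rootSubst (HahnSeries ℚ k) a) (HahnSeries.ext (funext hc))

theorem range_rootSubst₂_mono (k : Type*) [Field k] (a b : ℕ+) :
    Set.range (rootSubst₂ k a) ⊆ Set.range (rootSubst₂ k (a * b)) := by
  have key (n : ℤ) : divEmb (a * b) (n * b) = divEmb a n := by
    have ha0 : (a : ℚ) ≠ 0 := by positivity
    have hb0 : (b : ℚ) ≠ 0 := by positivity
    simp only [divEmb, OrderEmbedding.coe_ofMapLEIff]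
    push_cast
    field_simp
  intro f hf
  rw [mem_range_rootSubst₂] at hf ⊢
  intro q r hqr
  obtain ⟨⟨n, rfl⟩, m, rfl⟩ := hf q r hqr
  exact ⟨⟨_, key n⟩, _, key m⟩

/-- The field `⋃_{a ∈ ℕ ∖ 3ℕ} k((x^{1/a}))((y^{1/a}))`, as a subfield of `k[[x^ℚ]][[y^ℚ]]`. -/
def unionField (k : Type*) [Field k] : Subfield (HahnSeries ℚ (HahnSeries ℚ k)) where
  carrier := ⋃ (a : ℕ+) (_ : ¬ 3 ∣ (a : ℕ)), Set.range (rootSubst₂ k a)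
  zero_mem' := Set.mem_iUnion₂.2 ⟨1, by simp, 0, map_zero _⟩
  one_mem' := Set.mem_iUnion₂.2 ⟨1, by simp, 1, map_one _⟩
  add_mem' := by
    intro f g hf hg
    obtain ⟨a, ha, hf⟩ := Set.mem_iUnion₂.1 hf
    obtain ⟨b, hb, hg⟩ := Set.mem_iUnion₂.1 hg
    obtain ⟨f, rfl⟩ := range_rootSubst₂_mono k a b hf
    obtain ⟨g, rfl⟩ := range_rootSubst₂_mono k b a hg
    rw [mul_comm b a]
    exact Set.mem_iUnion₂.2 ⟨a * b, by simp [Nat.prime_three.dvd_mul, ha, hb], f + g, map_add _ _ _⟩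
  mul_mem' := by
    intro f g hf hg
    obtain ⟨a, ha, hf⟩ := Set.mem_iUnion₂.1 hf
    obtain ⟨b, hb, hg⟩ := Set.mem_iUnion₂.1 hg
    obtain ⟨f, rfl⟩ := range_rootSubst₂_mono k a b hf
    obtain ⟨g, rfl⟩ := range_rootSubst₂_mono k b a hg
    rw [mul_comm b a]
    exact Set.mem_iUnion₂.2 ⟨a * b, by simp [Nat.prime_three.dvd_mul, ha, hb], f * g, map_mul _ _ _⟩
  neg_mem' := by
    intro f hf
    obtain ⟨a, ha, f, rfl⟩ := Set.mem_iUnion₂.1 hf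
    refine Set.mem_iUnion₂.2 ⟨a, ha, -f, eq_neg_of_add_eq_zero_left ?_⟩
    exact ((rootSubst₂ k a).map_add _ _).symm.trans
      ((congrArg (rootSubst₂ k a) (neg_add_cancel f)).trans (rootSubst₂ k a).map_zero)
  inv_mem' := by
    intro f hf
    obtain ⟨a, ha, f, rfl⟩ := Set.mem_iUnion₂.1 hf
    refine Set.mem_iUnion₂.2 ⟨a, ha, f⁻¹, ?_⟩
    exact map_inv₀ (rootSubst₂ k a) f

/-! ### Severi-Brauer varieties -/

attribute [local instance] MvPolynomial.gradedAlgebra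

universe u

/-- Projective `n`-space over `K`: `Proj K[x₀, …, xₙ]` with the standard grading. -/
def projSpace (n : ℕ) (K : Type u) [Field K] : Scheme.{u} :=
  Proj (MvPolynomial.homogeneousSubmodule (Fin (n + 1)) K)

/-- The structure morphism `ℙⁿ_K ⟶ Spec K`. -/
def projSpaceHom (n : ℕ) (K : Type u) [Field K] : projSpace n K ⟶ Spec (.of K) :=
  Proj.toSpecZero (MvPolynomial.homogeneousSubmodule (Fin (n + 1)) K) ≫
    Spec.map (CommRingCat.ofHom
      (algebraMap K (MvPolynomial.homogeneousSubmodule (Fin (n + 1)) K 0)))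

/-- A `K`-scheme `f : X ⟶ Spec K` is a projective variety over `K`: it is integral and admits a
closed immersion over `K` into some `ℙᴺ_K`. -/
structure IsProjectiveVariety {K : Type u} [Field K] {X : Scheme.{u}}
    (f : X ⟶ Spec (.of K)) : Prop where
  isIntegral : IsIntegral X
  projective : ∃ (N : ℕ) (i : X ⟶ projSpace N K), IsClosedImmersion i ∧ i ≫ projSpaceHom N K = f

/-- A Severi-Brauer variety of dimension `n` over `K`: a projective variety `X` over `K` such that
`X ×_K K̄` is isomorphic to `ℙⁿ` over the algebraic closure `K̄` of `K`. -/
structure IsSeveriBrauer (n : ℕ) {K : Type u} [Field K] {X : Scheme.{u}}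
    (f : X ⟶ Spec (.of K)) : Prop extends IsProjectiveVariety f where
  geometric : ∃ e : pullback f
        (Spec.map (CommRingCat.ofHom (algebraMap K (AlgebraicClosure K)))) ≅
      projSpace n (AlgebraicClosure K),
    e.hom ≫ projSpaceHom n (AlgebraicClosure K) = pullback.snd _ _

/-- `X(K) ≠ ∅`: the `K`-scheme `X` has a `K`-rational point, i.e. a section of `X ⟶ Spec K`. -/
def HasRationalPoint {K : Type u} [Field K] {X : Scheme.{u}} (f : X ⟶ Spec (.of K)) : Prop :=
  ∃ s : Spec (.of K) ⟶ X, s ≫ f = 𝟙 _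

/-- The ring homomorphism from `K` to the residue field of a point of a `K`-scheme. -/
def toResidueField {K : Type u} [Field K] {X : Scheme.{u}} (f : X ⟶ Spec (.of K)) (p : X) :
    K →+* X.residueField p :=
  (Spec.preimage (X.fromSpecResidueField p ≫ f)).hom

/-- The degree `[κ(p) : K]` of a point of a `K`-scheme (with value `0` if this is infinite). -/
def pointDegree {K : Type u} [Field K] {X : Scheme.{u}} (f : X ⟶ Spec (.of K)) (p : X) : ℕ :=
  letI : Algebra K (X.residueField p) := (toResidueField f p).toAlgebra
  Module.finrank K (X.residueField p)

/-- The `K`-scheme `X` has a point of degree `d`, i.e. a closed point `p` with `[κ(p) : K] = d`. -/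
def HasPointOfDegree {K : Type u} [Field K] {X : Scheme.{u}} (f : X ⟶ Spec (.of K)) (d : ℕ) :
    Prop :=
  ∃ p : X, IsClosed {p} ∧ pointDegree f p = d

end

/-! Let `K` be the union field and `Ω = ℂ[[x^ℚ]][[y^ℚ]]`. The first claim is Galois theory inside
`Ω`. A Hahn series field with exponents in `ℚ` over an algebraically closed field of characteristic
zero is again algebraically closed (`HahnSeries.isAlgClosed_rat`), so two applications show that `Ω`
is, and every finite extension of `K` embeds in it. Pairs of characters of `ℚ` that are trivial on
the fractions with denominator prime to 3 act on `Ω` over `K` by multiplying coefficients. An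
algebraic element fixed by all of them lies in `K` (`mem_unionField_of_forall_twist`), so the group
of these pairs surjects onto the Galois group of any finite Galois `L/K`. In that group of
characters every element is a `p`-th power for each prime `p ≠ 3`. A finite quotient of it is
therefore a 3-group, which is `finrank_eq_three_pow`.

For the second claim, the degree of a finite extension divides the degree of its normal closure, a
power of 3. Hence no extension of `K` has degree 6 (`finrank_ne_six`), and no `K`-scheme has a point
of degree 6. It remains to find a Severi-Brauer surface without rational point.

The surface is the one attached to the symbol algebra `(x, y)`, realised by cubics. With `α³ = x⁻¹`,
`β³ = y` and a primitive cube root of unity `ω`, the ten forms `TwistedCubic.form` are a basis of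
the ternary cubics over `K̄`, and each semilinear automorphism fixes them after a monomial
substitution of the variables. They define a morphism `ℙ²` over `K̄` to `ℙ⁹` over `K`. By Galois
descent its scheme-theoretic image becomes `ℙ²` over `K̄` (`ProjForms.isSeveriBrauer_image`).

A rational point of the image gives `t ≠ 0` in `K̄³` at which the ten forms take values in `K` up to
a common factor. Fourier inversion modulo 3 turns these values into an equation saying that the norm
form of `K(x^{1/3})` represents `y` times a cube. Comparing leading exponents modulo 3 shows that
this has only the zero solution (`unionField.norm_form_ne`), and then `t = 0`
(`TwistedCubic.eq_zero_of_eval_form`). -/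

noncomputable section

/-! ### Hahn series fields with rational exponents are algebraically closed -/

/-- Congruence modulo `tⁿM` is congruence modulo `tⁿR` in each coordinate, so limits can be taken
coordinatewise. The case needed is `M = R[X]/(f)` with `f` monic. -/
theorem isAdicComplete_span_singleton_of_basis {R M ι : Type*} [CommRing R] [AddCommGroup M]
    [Module R M] [Finite ι] (b : Module.Basis ι R M) (t : R)
    [hR : IsAdicComplete (Ideal.span {t}) R] : IsAdicComplete (Ideal.span {t}) M := by
  classical
  have key (n : ℕ) (x y : M) : x ≡ y [SMOD (Ideal.span {t} ^ n • ⊤ : Submodule R M)] ↔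
      ∀ i, b.repr x i ≡ b.repr y i [SMOD (Ideal.span {t} ^ n • ⊤ : Submodule R R)] := by
    have := Fintype.ofFinite ι
    simp only [SModEq.sub_mem, Ideal.span_singleton_pow, Submodule.ideal_span_singleton_smul,
      Submodule.mem_smul_pointwise_iff_exists]
    constructor
    · rintro ⟨z, -, hz⟩ i
      refine ⟨b.repr z i, trivial, ?_⟩
      have := congrArg (fun w => b.repr w i) hz
      simpa using this
    · intro h
      choose z hz hz' using h
      refine ⟨∑ i, z i • b i, trivial, b.repr.injective ?_⟩
      ext i
      have := hz' i
      rw [map_smul, Finsupp.smul_apply, b.repr_sum_self, map_sub]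
      simpa using this
  refine { haus' := fun x hx => ?_, prec' := fun f hf => ?_ }
  · refine b.repr.injective (Finsupp.ext fun i => ?_)
    rw [map_zero, Finsupp.zero_apply]
    refine IsHausdorff.haus hR.toIsHausdorff _ fun n => ?_
    simpa using (key n x 0).1 (hx n) i
  · have := Fintype.ofFinite ι
    choose L hL using fun i => hR.toIsPrecomplete.prec' (fun n => b.repr (f n) i)
      fun {m n} hmn => (key m _ _).1 (hf hmn) i
    refine ⟨∑ i, L i • b i, fun n => (key n _ _).2 fun i => ?_⟩
    rw [b.repr_sum_self]
    exact hL i n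

open Polynomial in
/-- Over a ring complete at `t`, a monic polynomial with connected quotient ring has no
factorization into coprime non-units in the residue field. -/
theorem isUnit_or_isUnit_of_isCoprime_of_map_eq {R k : Type*} [CommRing R] [Field k]
    (res : R →+* k) (c : k →+* R) (hc : ∀ a, res (c a) = a) (f : R[X]) (hf : f.Monic)
    [IsDomain (AdjoinRoot f)] (g h : k[X]) (hfg : f.map res = g * h) (hgh : IsCoprime g h)
    (t : R) (ht : res t = 0) [IsAdicComplete (Ideal.span {t}) R]
    (htf : C t ∣ (g * h).map c - f) : IsUnit g ∨ IsUnit h := by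
  obtain ⟨u, v, huv⟩ := hgh
  have : IsAdicComplete (Ideal.span {t}) (AdjoinRoot f) :=
    isAdicComplete_span_singleton_of_basis (AdjoinRoot.powerBasisAux' hf) t
  have hcomp : IsAdicComplete ((Ideal.span {t}).map (algebraMap R (AdjoinRoot f)))
      (AdjoinRoot f) := (IsAdicComplete.map_algebraMap_iff _ _).2 this
  rw [Ideal.map_span, Set.image_singleton] at hcomp
  set τ := algebraMap R (AdjoinRoot f) t
  have hens : HenselianRing (AdjoinRoot f) (Ideal.span {τ}) := inferInstance
  -- Since `vh - (vh)² = vh · ug` is a multiple of `gh`, and `gh` agrees with `f` modulo `t`, this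
  -- lift of `vh` is idempotent modulo `τ`.
  set a := AdjoinRoot.mk f ((v * h).map c)
  have hτ : AdjoinRoot.mk f (C t) = τ := by
    rw [AdjoinRoot.mk_C]; rfl
  have ha : a ^ 2 - a ∈ Ideal.span {τ} := by
    rw [Ideal.mem_span_singleton]
    have e : a ^ 2 - a = - AdjoinRoot.mk f ((u * v).map c * ((g * h).map c - f)) := by
      rw [mul_sub, map_sub, map_mul _ _ f, AdjoinRoot.mk_self, mul_zero, sub_zero, ← Polynomial.map_mul]
      have e1 : v * h = 1 - u * g := by rw [← huv]; ring
      have e2 : u * v * (g * h) = (v * h) - (v * h) ^ 2 := by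
        rw [sq]; nth_rw 3 [e1]; ring
      rw [e2, Polynomial.map_sub, Polynomial.map_pow, map_sub, map_pow]
      ring
    rw [e, dvd_neg, ← hτ]
    exact map_dvd _ (htf.mul_left _)
  have hresmk (P : R[X]) (hP : AdjoinRoot.mk f P ∈ Ideal.span {τ}) :
      g * h ∣ P.map res := by
    rw [Ideal.mem_span_singleton, ← hτ] at hP
    obtain ⟨Q, hQ⟩ := hP
    obtain ⟨Q, rfl⟩ := AdjoinRoot.mk_surjective Q
    rw [← map_mul, AdjoinRoot.mk_eq_mk] at hQ
    obtain ⟨S, hS⟩ := hQ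
    have := congrArg (Polynomial.map res) hS
    rw [Polynomial.map_sub, Polynomial.map_mul, Polynomial.map_mul, map_C, ht, hfg] at this
    simp only [map_zero, zero_mul, sub_zero] at this
    exact ⟨_, this⟩
  have hcr (P : k[X]) : (P.map c).map res = P := by
    have e : res.comp c = RingHom.id k := RingHom.ext hc
    rw [Polynomial.map_map, e, Polynomial.map_id]
  obtain ⟨e, he, hea⟩ := hens.is_henselian (X ^ 2 - X)
    (monic_X_pow_sub (lt_of_le_of_lt degree_X_le (by norm_num))) a (by simpa using ha) (by
      rw [derivative_sub, derivative_X_pow, derivative_X]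
      -- The derivative at `a` is `2a - 1`. Its square is `1 + 4(a² - a)`, so it is its own inverse
      -- modulo `τ`.
      refine IsUnit.of_mul_eq_one (Ideal.Quotient.mk _ (2 * a - 1)) ?_
      rw [← map_mul, ← (Ideal.Quotient.mk (Ideal.span {τ})).map_one, Ideal.Quotient.eq]
      have : eval a (C ((2 : ℕ) : AdjoinRoot f) * X ^ (2 - 1) - 1) * (2 * a - 1) - 1
        = 4 * (a ^ 2 - a) := by simp; ring
      rw [this]
      exact Ideal.mul_mem_left _ _ ha)
  have he' : e * (e - 1) = 0 := by
    have : e ^ 2 - e = 0 := by simpa using he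
    linear_combination this
  -- The quotient ring is a domain, so the lifted idempotent is 0 or 1. If it is 0, then `a`
  -- vanishes modulo `τ`, so `gh` divides `vh` and `g` divides `vh + ug = 1`. The other case is
  -- symmetric.
  rcases mul_eq_zero.1 he' with h0 | h1
  · left
    rw [h0, zero_sub, neg_mem_iff] at hea
    have := hresmk _ hea
    rw [hcr] at this
    have h2 : g ∣ v * h := (dvd_mul_right _ _).trans this
    refine isUnit_of_dvd_one ?_
    rw [← huv]
    exact (dvd_mul_left _ _).add h2
  · right
    rw [sub_eq_zero.1 h1] at hea
    have e1 : 1 - a = AdjoinRoot.mk f ((u * g).map c) := by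
      have : u * g = 1 - v * h := by rw [← huv]; ring
      rw [this, Polynomial.map_sub, Polynomial.map_one, map_sub, map_one]
    rw [e1] at hea
    have := hresmk _ hea
    rw [hcr] at this
    have h2 : h ∣ u * g := (dvd_mul_left _ _).trans this
    refine isUnit_of_dvd_one ?_
    rw [← huv]
    exact h2.add (dvd_mul_left _ _)

/-! ### Hahn series with non-negative exponents: completeness and Hensel's lemma. -/

section

open HahnSeries

/-- The ring of Hahn series with non-negative exponents. -/
def hahnIntegers (k : Type*) [Field k] : Subring (HahnSeries ℚ k) where
  carrier := {x | 0 ≤ x.orderTop}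
  zero_mem' := by simp
  one_mem' := by simp
  add_mem' {x y} hx hy := Set.mem_ofPred.2 (le_trans (le_min hx hy) min_orderTop_le_orderTop_add)
  mul_mem' {x y} hx hy := Set.mem_ofPred.2 (le_trans (add_nonneg hx hy) orderTop_add_le_mul)
  neg_mem' {x} hx := by simpa using hx

section

variable {k : Type*} [Field k]

theorem mem_hahnIntegers_iff_orderTop {x : HahnSeries ℚ k} :
    x ∈ hahnIntegers k ↔ 0 ≤ x.orderTop := Iff.rfl

theorem mem_hahnIntegers {x : HahnSeries ℚ k} :
    x ∈ hahnIntegers k ↔ ∀ q < 0, x.coeff q = 0 := by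
  rw [mem_hahnIntegers_iff_orderTop, le_orderTop_iff_forall]
  exact ⟨fun h q hq => h q (WithTop.coe_lt_coe.2 hq), fun h q hq => h q (WithTop.coe_lt_coe.1 hq)⟩

/-- The inclusion of the constants. -/
def hahnIntegers.const (k : Type*) [Field k] : k →+* hahnIntegers k :=
  (HahnSeries.C : k →+* HahnSeries ℚ k).codRestrict _ fun _ =>
    mem_hahnIntegers_iff_orderTop.2 orderTop_single_le

/-- The constant coefficient of a Hahn series with non-negative exponents. -/
def hahnIntegers.residue (k : Type*) [Field k] : hahnIntegers k →+* k where
  toFun x := x.1.coeff 0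
  map_one' := by simp
  map_zero' := by simp
  map_add' x y := by simp
  map_mul' x y := by
    have h (z w : HahnSeries ℚ k) (hz : z ∈ hahnIntegers k) (hw : w ∈ hahnIntegers k)
        (hw0 : w.coeff 0 = 0) : (z * w).coeff 0 = 0 := by
      refine coeff_eq_zero_of_lt_orderTop (lt_of_lt_of_le ?_ orderTop_add_le_mul)
      have : 0 < w.orderTop := by
        exact lt_of_le_of_ne (mem_hahnIntegers_iff_orderTop.1 hw) fun h => coeff_orderTop_ne h.symm hw0
      exact this.trans_le (le_add_of_nonneg_left (mem_hahnIntegers_iff_orderTop.1 hz))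
    have e : x.1 * y.1 = (x.1 - HahnSeries.C (x.1.coeff 0)) * HahnSeries.C (y.1.coeff 0) +
        x.1 * (y.1 - HahnSeries.C (y.1.coeff 0)) +
        HahnSeries.C (x.1.coeff 0 * y.1.coeff 0) := by rw [map_mul]; ring
    have hC (a : k) : HahnSeries.C a ∈ hahnIntegers k :=
      mem_hahnIntegers_iff_orderTop.2 orderTop_single_le
    change (x.1 * y.1).coeff 0 = _
    rw [e, coeff_add, coeff_add, mul_comm, h _ _ (hC _) (sub_mem x.2 (hC _)) (by simp),
      h _ _ x.2 (sub_mem y.2 (hC _)) (by simp)]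
    simp

theorem hahnIntegers.residue_const (a : k) : hahnIntegers.residue k (hahnIntegers.const k a) = a := by
  simp [hahnIntegers.residue, hahnIntegers.const]

/-- The power `t ^ ε` of the variable. -/
def hahnIntegers.tpow (k : Type*) [Field k] (ε : ℚ) (hε : 0 ≤ ε) : hahnIntegers k :=
  ⟨single ε 1, mem_hahnIntegers_iff_orderTop.2
    (le_trans (WithTop.coe_le_coe.2 hε) orderTop_single_le)⟩

theorem hahnIntegers.tpow_pow (ε : ℚ) (hε : 0 ≤ ε) (n : ℕ) :
    (hahnIntegers.tpow k ε hε) ^ n = hahnIntegers.tpow k (n * ε) (by positivity) := by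
  refine Subtype.ext ?_
  simp [hahnIntegers.tpow]

theorem hahnIntegers.tpow_dvd_iff (ε : ℚ) (hε : 0 ≤ ε) (x : hahnIntegers k) :
    hahnIntegers.tpow k ε hε ∣ x ↔ ∀ q < ε, x.1.coeff q = 0 := by
  constructor
  · rintro ⟨y, rfl⟩ q hq
    change (single ε 1 * y.1).coeff q = 0
    rw [coeff_single_mul, mem_hahnIntegers.1 y.2 _ (by linarith), mul_zero]
  · intro h
    refine ⟨⟨single (-ε) 1 * x.1, ?_⟩, Subtype.ext ?_⟩
    · rw [mem_hahnIntegers]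
      intro q hq
      rw [coeff_single_mul, h _ (by linarith), mul_zero]
    · change x.1 = single ε 1 * (single (-ε) 1 * x.1)
      rw [← mul_assoc, single_mul_single]
      simp

theorem hahnIntegers.smodEq_iff (ε : ℚ) (hε : 0 ≤ ε) (n : ℕ) (x y : hahnIntegers k) :
    x ≡ y [SMOD (Ideal.span {hahnIntegers.tpow k ε hε} ^ n • ⊤ :
      Submodule (hahnIntegers k) (hahnIntegers k))] ↔
    ∀ q < n * ε, x.1.coeff q = y.1.coeff q := by
  rw [SModEq.sub_mem, smul_eq_mul, Ideal.mul_top, Ideal.span_singleton_pow,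
    Ideal.mem_span_singleton, hahnIntegers.tpow_pow, hahnIntegers.tpow_dvd_iff]
  simp [sub_eq_zero]

/-- The coefficient at `q` is constant along a Cauchy sequence once `q < nε`. The limit has
well-ordered support because a descending sequence in it starting at `u 0` would already lie in the
support of the single term with index `N (u 0)`. -/
theorem hahnIntegers.isAdicComplete (ε : ℚ) (hε : 0 < ε) :
    IsAdicComplete (Ideal.span {hahnIntegers.tpow k ε hε.le}) (hahnIntegers k) := by
  have hlt (q : ℚ) : ∃ n : ℕ, q < n * ε := by
    obtain ⟨n, hn⟩ := exists_nat_gt (q / ε)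
    exact ⟨n, by rwa [div_lt_iff₀ hε] at hn⟩
  refine { haus' := fun x hx => Subtype.ext (HahnSeries.ext (funext fun q => ?_)),
           prec' := fun f hf => ?_ }
  · obtain ⟨n, hn⟩ := hlt q
    exact (hahnIntegers.smodEq_iff ε hε.le n x 0).1 (hx n) q hn
  · simp only [hahnIntegers.smodEq_iff] at hf ⊢
    choose N hN using hlt
    have hval (q : ℚ) (n : ℕ) (hn : q < n * ε) :
        (f n).1.coeff q = (f (N q)).1.coeff q := by
      rcases le_total n (N q) with h | h
      · exact hf h q hn
      · exact (hf h q (hN q)).symm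
    have hpwo : (Function.support fun q => (f (N q)).1.coeff q).IsPWO := by
      rw [Set.isPWO_iff_isWF, Set.isWF_iff_no_descending_seq]
      intro u hu hmem
      have hwf : ((f (N (u 0))).1.support).IsWF := (f (N (u 0))).1.isWF_support
      rw [Set.isWF_iff_no_descending_seq] at hwf
      refine hwf u hu fun n => ?_
      have h1 := hmem n
      rw [Function.mem_support, ← hval (u n) (N (u 0))
        (lt_of_le_of_lt (hu.antitone (Nat.zero_le n)) (hN _))] at h1
      exact h1
    refine ⟨⟨⟨fun q => (f (N q)).1.coeff q, hpwo⟩, ?_⟩, fun n q hq => hval q n hq⟩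
    rw [mem_hahnIntegers]
    exact fun q hq => mem_hahnIntegers.1 (f (N q)).2 q hq

theorem hahnIntegers.residue_tpow (ε : ℚ) (hε : 0 < ε) :
    hahnIntegers.residue k (hahnIntegers.tpow k ε hε.le) = 0 :=
  coeff_single_of_ne hε.ne

/-- The maximal ideal is not finitely generated, so it cannot serve for completion. Each of its
elements is nevertheless divisible by some positive power of the variable, and finitely many
elements by a common one, which suffices for a polynomial. -/
theorem hahnIntegers.exists_tpow_dvd (x : hahnIntegers k) (hx : hahnIntegers.residue k x = 0) :
    ∃ ε : ℚ, 0 < ε ∧ ∀ δ, ∀ hδ : 0 < δ, δ ≤ ε → hahnIntegers.tpow k δ hδ.le ∣ x := by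
  by_cases h0 : x.1 = 0
  · exact ⟨1, one_pos, fun δ hδ _ => by
      rw [hahnIntegers.tpow_dvd_iff]; simp [h0]⟩
  · have h1 : (0 : WithTop ℚ) < x.1.orderTop :=
      lt_of_le_of_ne (mem_hahnIntegers_iff_orderTop.1 x.2) fun h => coeff_orderTop_ne h.symm hx
    have h2 : 0 < x.1.order := by
      rw [← order_eq_orderTop_of_ne_zero h0] at h1
      exact_mod_cast h1
    refine ⟨x.1.order, h2, fun δ hδ hle => ?_⟩
    rw [hahnIntegers.tpow_dvd_iff]
    exact fun q hq => coeff_eq_zero_of_lt_order (hq.trans_le hle)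

open Polynomial

theorem hahnIntegers.exists_tpow_dvd_polynomial (P : (hahnIntegers k)[X])
    (hP : P.map (hahnIntegers.residue k) = 0) :
    ∃ ε : ℚ, ∃ hε : 0 < ε, C (hahnIntegers.tpow k ε hε.le) ∣ P := by
  have h (i : ℕ) := hahnIntegers.exists_tpow_dvd (P.coeff i) (by
    rw [← coeff_map, hP, Polynomial.coeff_zero])
  choose ε hε hd using h
  obtain ⟨δ, hδ, hle⟩ : ∃ δ > 0, ∀ i ∈ P.support, δ ≤ ε i := by
    induction P.support using Finset.induction_on with
    | empty => exact ⟨1, one_pos, by simp⟩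
    | insert a s ha ih =>
      obtain ⟨δ, hδ, h⟩ := ih
      refine ⟨min δ (ε a), lt_min hδ (hε a), fun i hi => ?_⟩
      rcases Finset.mem_insert.1 hi with rfl | hi
      · exact min_le_right _ _
      · exact (min_le_left _ _).trans (h i hi)
  refine ⟨δ, hδ, C_dvd_iff_dvd_coeff _ _ |>.2 fun i => ?_⟩
  by_cases hi : i ∈ P.support
  · exact hd i δ hδ (hle i hi)
  · rw [notMem_support_iff.1 hi]
    exact dvd_zero _

/-- The quotient by `f` is a domain: as `f` is monic, it embeds in the quotient over the Hahn series
field, which is a field. The power of the variable used for completion is chosen to divide the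
difference between `f` and the constant lift of `gh`. -/
theorem hahnIntegers.isUnit_or_isUnit_of_isCoprime (f : (hahnIntegers k)[X]) (hf : f.Monic)
    (hirr : Irreducible (f.map (hahnIntegers k).subtype)) (g h : k[X])
    (hfg : f.map (hahnIntegers.residue k) = g * h) (hgh : IsCoprime g h) :
    IsUnit g ∨ IsUnit h := by
  have : Fact (Irreducible (f.map (hahnIntegers k).subtype)) := ⟨hirr⟩
  have hker (P : (hahnIntegers k)[X])
      (hP : AdjoinRoot.mk (f.map (hahnIntegers k).subtype) (P.map (hahnIntegers k).subtype) = 0) :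
      AdjoinRoot.mk f P = 0 := by
    rw [AdjoinRoot.mk_eq_zero] at hP ⊢
    exact (Polynomial.map_dvd_map _ Subtype.val_injective hf).1 hP
  have hdom : IsDomain (AdjoinRoot f) := by
    have hinj : Function.Injective (AdjoinRoot.lift
        ((AdjoinRoot.of (f.map (hahnIntegers k).subtype)).comp (hahnIntegers k).subtype)
        (AdjoinRoot.root (f.map (hahnIntegers k).subtype)) (by
          rw [← Polynomial.eval₂_map, AdjoinRoot.eval₂_root]) :
        AdjoinRoot f →+* AdjoinRoot (f.map (hahnIntegers k).subtype)) := by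
      rw [injective_iff_map_eq_zero]
      intro x hx
      obtain ⟨P, rfl⟩ := AdjoinRoot.mk_surjective x
      refine hker P ?_
      rw [AdjoinRoot.lift_mk, ← Polynomial.eval₂_map] at hx
      rw [← AdjoinRoot.aeval_eq]
      exact hx
    exact hinj.isDomain
  obtain ⟨ε, hε, hdvd⟩ := hahnIntegers.exists_tpow_dvd_polynomial
    ((g * h).map (hahnIntegers.const k) - f) (by
      rw [Polynomial.map_sub, hfg, sub_eq_zero, Polynomial.map_map]
      have e : (hahnIntegers.residue k).comp (hahnIntegers.const k) = RingHom.id k :=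
        RingHom.ext fun x => hahnIntegers.residue_const x
      rw [e, Polynomial.map_id])
  have := hahnIntegers.isAdicComplete (k := k) ε hε
  exact isUnit_or_isUnit_of_isCoprime_of_map_eq (hahnIntegers.residue k) (hahnIntegers.const k)
    hahnIntegers.residue_const f hf g h hfg hgh _ (hahnIntegers.residue_tpow ε hε) hdvd

end

end

/-! ### Algebraic closedness by the Newton polygon. -/

section

open Polynomial

variable {k : Type*} [Field k]

/-- In characteristic zero a suitable translation makes this coefficient vanish, which is the
Tschirnhaus reduction to depressed polynomials. -/
theorem coeff_taylor_natDegree_sub_one {K : Type*} [Field K] (p : K[X]) (hp : p.Monic)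
    (hd : 1 ≤ p.natDegree) (b : K) :
    (taylor b p).coeff (p.natDegree - 1) = p.coeff (p.natDegree - 1) + p.natDegree * b := by
  rw [taylor_coeff, eval_eq_sum_range' (n := 2)]
  · have h2 : 1 + (p.natDegree - 1) = p.natDegree := by omega
    simp only [Finset.sum_range_succ, Finset.sum_range_zero, hasseDeriv_coeff, h2,
      hp.coeff_natDegree]
    have : p.natDegree.choose (p.natDegree - 1) = p.natDegree := by
      rw [Nat.choose_symm hd, Nat.choose_one_right]
    simp [this]
  · refine lt_of_le_of_lt (natDegree_hasseDeriv_le _ _) (by omega)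

/-- A depressed irreducible polynomial over the integers whose reduction is not a power of the
variable cannot exist over an algebraically closed residue field of characteristic zero. -/
theorem hahnIntegers.map_residue_eq_X_pow [IsAlgClosed k] [CharZero k] (f : (hahnIntegers k)[X])
    (hf : f.Monic) (hirr : Irreducible (f.map (hahnIntegers k).subtype)) (hd : 1 ≤ f.natDegree)
    (h0 : f.coeff (f.natDegree - 1) = 0) :
    f.map (hahnIntegers.residue k) = X ^ f.natDegree := by
  set F := f.map (hahnIntegers.residue k) with hF
  have hFm : F.Monic := hf.map _
  have hFd : F.natDegree = f.natDegree := hf.natDegree_map _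
  obtain ⟨c, hc⟩ := IsAlgClosed.exists_root F (by
    rw [degree_eq_natDegree hFm.ne_zero, hFd]; exact_mod_cast (by omega))
  obtain ⟨h, hh, hnd⟩ := exists_eq_pow_rootMultiplicity_mul_and_not_dvd F hFm.ne_zero c
  have hm : 0 < F.rootMultiplicity c := (rootMultiplicity_pos hFm.ne_zero).2 hc
  set m := F.rootMultiplicity c
  have hcop : IsCoprime ((X - C c) ^ m) h :=
    (((irreducible_X_sub_C c).coprime_iff_not_dvd).2 hnd).pow_left
  have hh1 : h.Monic := Monic.of_mul_monic_left ((monic_X_sub_C c).pow m) (hh ▸ hFm)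
  rcases hahnIntegers.isUnit_or_isUnit_of_isCoprime f hf hirr _ h hh hcop with h1 | h1
  · exact absurd (isUnit_pow_iff hm.ne' |>.1 h1) (not_isUnit_X_sub_C c)
  -- The reduction is `(X - c)^d`. Its subleading coefficient `-dc` is zero and `d ≠ 0` in `k`, so
  -- `c = 0`.
  · rw [hh1.isUnit_iff.1 h1, mul_one] at hh
    have hmd : m = f.natDegree := by
      rw [← hFd, hh, natDegree_pow, natDegree_X_sub_C, mul_one]
    have h2 : F.coeff (f.natDegree - 1) = 0 := by rw [hF, coeff_map, h0, map_zero]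
    rw [hh, sub_eq_add_neg, ← C_neg, coeff_X_add_C_pow, hmd, show f.natDegree - (f.natDegree - 1) = 1 by omega,
      Nat.choose_symm hd, Nat.choose_one_right] at h2
    have hc0 : c = 0 := by
      have : (f.natDegree : k) ≠ 0 := by exact_mod_cast (by omega : f.natDegree ≠ 0)
      simpa [this] using h2
    rw [hh, hmd, hc0, C_0, sub_zero]

/-- With `v` the orders of the coefficients and `w` the distances to the top degree, `r` is a slope
of the Newton polygon. -/
theorem exists_min_slope {ι : Type*} (s : Finset ι) (hs : s.Nonempty) (v : ι → ℚ) (w : ι → ℚ)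
    (hw : ∀ i ∈ s, 0 < w i) : ∃ r, (∀ i ∈ s, r * w i ≤ v i) ∧ ∃ i ∈ s, r * w i = v i := by
  obtain ⟨i, hi, hmin⟩ := s.exists_min_image (fun i => v i / w i) hs
  refine ⟨v i / w i, fun j hj => ?_, i, hi, div_mul_cancel₀ _ (hw i hi).ne'⟩
  rw [← le_div_iff₀ (hw j hj)]
  exact hmin j hj

-- Rescaling the variable by `t^r`, with `r` the Newton slope, makes the polynomial monic and
-- integral with some lower coefficient of order exactly 0. Its reduction is then not a power of
-- `X`, contrary to `hahnIntegers.map_residue_eq_X_pow`.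
open Classical in
theorem not_irreducible_of_depressed [IsAlgClosed k] [CharZero k] (p : (HahnSeries ℚ k)[X])
    (hp : p.Monic) (hd : 2 ≤ p.natDegree) (h0 : p.coeff (p.natDegree - 1) = 0) :
    ¬ Irreducible p := by
  intro hirr
  set d := p.natDegree with hdd
  set s := (Finset.range d).filter fun i => p.coeff i ≠ 0
  have hs : s.Nonempty := by
    by_contra hs
    rw [Finset.not_nonempty_iff_eq_empty, Finset.filter_eq_empty_iff] at hs
    have : p = X ^ d := by
      refine ext fun i => ?_
      rw [coeff_X_pow]
      rcases lt_trichotomy i d with h | h | h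
      · rw [if_neg h.ne]; simpa using hs (Finset.mem_range.2 h)
      · rw [if_pos h, h]; exact hp.coeff_natDegree
      · rw [if_neg h.ne']; exact coeff_eq_zero_of_natDegree_lt h
    rw [this] at hirr
    exact (not_irreducible_pow (by omega)) hirr
  obtain ⟨r, hr, i₀, hi₀, hri₀⟩ := exists_min_slope s hs (fun i => (p.coeff i).order)
    (fun i => (d : ℚ) - i) (fun i hi => by
      have : i < d := Finset.mem_range.1 (Finset.mem_filter.1 hi).1
      have : (i : ℚ) < d := by exact_mod_cast this
      linarith)
  set τ : HahnSeries ℚ k := HahnSeries.single r 1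
  set τ' : HahnSeries ℚ k := HahnSeries.single (-r) 1
  have hττ' : τ * τ' = 1 := by simp [τ, τ', HahnSeries.single_mul_single]
  have hτ'0 : τ' ≠ 0 := right_ne_zero_of_mul_eq_one hττ'
  -- This is `t^{-rd} p(t^r X)`: the coefficient of index `i` is multiplied by `t^{(i-d)r}`.
  set q := C (τ' ^ d) * p.comp (C τ * X) with hq
  have hqc (i : ℕ) : q.coeff i = HahnSeries.single ((i - d) * r : ℚ) 1 * p.coeff i := by
    rw [hq, coeff_C_mul, comp_C_mul_X_coeff, mul_comm (p.coeff i), ← mul_assoc]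
    congr 1
    have e : d • (-r) + i • r = ((i : ℚ) - d) * r := by simp; ring
    simp only [τ, τ', HahnSeries.single_pow, HahnSeries.single_mul_single, one_pow, mul_one, e]
  have hqd : q.coeff d = 1 := by
    rw [hqc, hdd, hp.coeff_natDegree]; simp
  have hqdeg : q.natDegree ≤ d := natDegree_le_iff_coeff_eq_zero.2 fun i hi => by
    rw [hqc, coeff_eq_zero_of_natDegree_lt hi, mul_zero]
  have hqnd : q.natDegree = d := le_antisymm hqdeg (le_natDegree_of_ne_zero (by rw [hqd]; simp))
  have hqm : q.Monic := by rw [Monic, leadingCoeff, hqnd, hqd]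
  have hqirr : Irreducible q := by
    let inv : Invertible τ := ⟨τ', by rw [mul_comm]; exact hττ', hττ'⟩
    have e : algEquivCMulXAddC τ 0 p = p.comp (C τ * X) := by
      rw [algEquivCMulXAddC_apply]
      simp [comp, aeval_def, eval₂_eq_eval_map, algebraMap_eq]
    have h1 : Irreducible (p.comp (C τ * X)) := by
      rw [← e]
      exact (MulEquiv.irreducible_iff (algEquivCMulXAddC τ 0)).2 hirr
    have hu : IsUnit (C (τ' ^ d)) := isUnit_C.2 (pow_ne_zero _ hτ'0).isUnit
    exact (irreducible_isUnit_mul hu).2 h1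
  have hqint (i : ℕ) : q.coeff i ∈ hahnIntegers k := by
    rcases lt_trichotomy i d with h | h | h
    · by_cases hi : p.coeff i = 0
      · rw [hqc, hi, mul_zero]; exact zero_mem _
      · rw [mem_hahnIntegers]
        intro x hx
        rw [hqc, HahnSeries.coeff_single_mul, HahnSeries.coeff_eq_zero_of_lt_order, mul_zero]
        have := hr i (Finset.mem_filter.2 ⟨Finset.mem_range.2 h, hi⟩)
        linarith
    · rw [h, hqd]; exact one_mem _
    · rw [coeff_eq_zero_of_natDegree_lt (by omega)]; exact zero_mem _
  have hlift : q ∈ lifts (hahnIntegers k).subtype := by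
    rw [lifts_iff_coeff_lifts]
    exact fun i => ⟨⟨_, hqint i⟩, rfl⟩
  obtain ⟨f, hfq, hfd, hfm⟩ := lifts_and_natDegree_eq_and_monic hlift hqm
  have hfc (i : ℕ) : (f.coeff i).1 = q.coeff i := by
    rw [← hfq, coeff_map]; rfl
  have key := hahnIntegers.map_residue_eq_X_pow f hfm (by rw [hfq]; exact hqirr) (by omega)
    (Subtype.ext (by rw [hfc, hfd, hqnd, hqc, h0, mul_zero]; rfl))
  -- The slope is attained at `i₀`, so the constant term of this coefficient of `q` is the leading
  -- coefficient of `p.coeff i₀`, and cannot vanish.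
  have hi₀' := Finset.mem_filter.1 hi₀
  have h1 := congrArg (fun P => P.coeff i₀) key
  simp only [coeff_map, coeff_X_pow] at h1
  rw [if_neg (by rw [hfd, hqnd]; exact (Finset.mem_range.1 hi₀'.1).ne)] at h1
  have h2 : (q.coeff i₀).coeff 0 = 0 := by rw [← hfc]; exact h1
  rw [hqc, HahnSeries.coeff_single_mul, one_mul] at h2
  refine hi₀'.2 (HahnSeries.coeff_order_eq_zero.1 ?_)
  rw [← h2]
  congr 1
  linarith

instance HahnSeries.charZero_rat [CharZero k] : CharZero (HahnSeries ℚ k) :=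
  charZero_of_injective_ringHom (HahnSeries.C_injective (Γ := ℚ) (R := k))

instance HahnSeries.isAlgClosed_rat [IsAlgClosed k] [CharZero k] :
    IsAlgClosed (HahnSeries ℚ k) := by
  refine IsAlgClosed.of_exists_root _ fun p hp hirr => ?_
  rcases Nat.lt_or_ge p.natDegree 2 with h | h
  · have := hirr.natDegree_pos
    exact exists_root_of_degree_eq_one
      (by rw [degree_eq_natDegree hp.ne_zero]; exact_mod_cast (by omega))
  · exfalso
    set b : HahnSeries ℚ k := -(p.coeff (p.natDegree - 1)) / p.natDegree
    have hn : (p.natDegree : HahnSeries ℚ k) ≠ 0 := by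
      exact_mod_cast (by omega : p.natDegree ≠ 0)
    refine not_irreducible_of_depressed (taylor b p) ?_ (by rwa [natDegree_taylor]) ?_ ?_
    · rwa [Monic, leadingCoeff_taylor]
    · rw [natDegree_taylor, coeff_taylor_natDegree_sub_one p hp (by omega)]
      rw [mul_div_cancel₀ _ hn, add_neg_cancel]
    · exact (MulEquiv.irreducible_iff (taylorEquiv b)).2 hirr

end

/-! ### Characters of `ℚ` acting on Hahn series -/

theorem AddChar.apply_ne_zero_of_field {A R : Type*} [AddCommGroup A] [Field R] (χ : AddChar A R)
    (a : A) : χ a ≠ 0 := by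
  have h : χ a * χ (-a) = 1 := by rw [← χ.map_add_eq_mul, add_neg_cancel, χ.map_zero_eq_one]
  exact left_ne_zero_of_mul_eq_one h

/-- The endomorphism of a ring of Hahn series which multiplies coefficients by a character. -/
def HahnSeries.twist {R : Type*} [Field R] (χ : AddChar ℚ R) :
    HahnSeries ℚ R →+* HahnSeries ℚ R where
  toFun f := ⟨fun q => χ q * f.coeff q, f.isPWO_support.mono fun q hq h => hq (by
    simp [h])⟩
  map_one' := by
    ext q
    by_cases h : q = 0
    · simp [h, χ.map_zero_eq_one]
    · simp [HahnSeries.coeff_one, h]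
  map_zero' := by ext; simp
  map_add' f g := by ext; simp [mul_add]
  map_mul' f g := by
    ext q
    simp only [HahnSeries.coeff_mul, Finset.mul_sum]
    refine Finset.sum_congr (Finset.ext fun x => ?_) fun x hx => ?_
    · simp [AddChar.apply_ne_zero_of_field]
    · have : x.1 + x.2 = q := by simp at hx; exact hx.2.2
      rw [← this, χ.map_add_eq_mul]
      ring

@[simp]
theorem HahnSeries.coeff_twist {R : Type*} [Field R] (χ : AddChar ℚ R) (f : HahnSeries ℚ R)
    (q : ℚ) : (HahnSeries.twist χ f).coeff q = χ q * f.coeff q := rfl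

/-- The endomorphism of `k[[x^ℚ]][[y^ℚ]]` which multiplies the coefficient of `x ^ r * y ^ q` by
`ψ r * χ q`. -/
def HahnSeries.twist₂ {k : Type*} [Field k] (χ ψ : AddChar ℚ k) :
    HahnSeries ℚ (HahnSeries ℚ k) →+* HahnSeries ℚ (HahnSeries ℚ k) :=
  (HahnSeries.twist ((HahnSeries.C : k →+* HahnSeries ℚ k).toMonoidHom.compAddChar χ)).comp
    (hahnMapRingHom (HahnSeries.twist ψ))

@[simp]
theorem HahnSeries.coeff_coeff_twist₂ {k : Type*} [Field k] (χ ψ : AddChar ℚ k)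
    (f : HahnSeries ℚ (HahnSeries ℚ k)) (q r : ℚ) :
    ((HahnSeries.twist₂ χ ψ f).coeff q).coeff r = χ q * (ψ r * (f.coeff q).coeff r) := by
  change (HahnSeries.C (χ q) * (HahnSeries.twist ψ (f.coeff q))).coeff r = _
  rw [HahnSeries.C_mul_eq_smul, HahnSeries.coeff_smul, HahnSeries.coeff_twist, smul_eq_mul]

theorem HahnSeries.ext₂ {k : Type*} [Field k] {f g : HahnSeries ℚ (HahnSeries ℚ k)}
    (h : ∀ q r, (f.coeff q).coeff r = (g.coeff q).coeff r) : f = g :=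
  HahnSeries.ext (funext fun q => HahnSeries.ext (funext fun r => h q r))

/-- The rationals whose denominator is prime to `3`. -/
def primeToThree : AddSubgroup ℚ where
  carrier := {q | ∃ (a : ℕ+) (n : ℤ), ¬ 3 ∣ (a : ℕ) ∧ q = n / a}
  zero_mem' := ⟨1, 0, by simp, by simp⟩
  add_mem' := by
    rintro _ _ ⟨a, n, ha, rfl⟩ ⟨b, m, hb, rfl⟩
    refine ⟨a * b, n * b + m * a, by simp [Nat.prime_three.dvd_mul, ha, hb], ?_⟩
    have ha0 : (a : ℚ) ≠ 0 := by positivity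
    have hb0 : (b : ℚ) ≠ 0 := by positivity
    push_cast
    field_simp
  neg_mem' := by
    rintro _ ⟨a, n, ha, rfl⟩
    exact ⟨a, -n, ha, by push_cast; ring⟩

theorem div_mem_primeToThree {q : ℚ} (hq : q ∈ primeToThree) (m : ℕ) (hm : ¬ 3 ∣ m) :
    q / m ∈ primeToThree := by
  obtain ⟨a, n, ha, rfl⟩ := hq
  have hm0 : 0 < m := Nat.pos_of_ne_zero fun h => hm (h ▸ dvd_zero 3)
  refine ⟨a * Nat.toPNat m hm0, n, ?_, ?_⟩
  · rw [PNat.mul_coe, Nat.prime_three.dvd_mul]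
    exact not_or_intro ha hm
  · rw [div_div, PNat.mul_coe, Nat.cast_mul]
    rfl

/-- `N q ∈ ℤ` for a denominator prime to three gives the exact denominator. -/
theorem exists_eq_div_of_mem_primeToThree (N : ℕ) (hN : N ≠ 0) :
    ∃ a : ℕ+, ¬ 3 ∣ (a : ℕ) ∧ ∀ q ∈ primeToThree, (∃ n : ℤ, N * q = n) → ∃ n : ℤ, q = n / a := by
  -- The required denominator is the prime-to-3 part `b` of `N`. If `q = m/c` with `c` prime to 3,
  -- then `c` divides `3^e b m`, hence divides `bm`.
  obtain ⟨e, b, hb, hNb⟩ := Nat.exists_eq_pow_mul_and_not_dvd hN 3 (by norm_num)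
  have hb0 : 0 < b := Nat.pos_of_ne_zero fun h => hb (h ▸ dvd_zero 3)
  refine ⟨⟨b, hb0⟩, hb, ?_⟩
  rintro _ ⟨c, m, hc, rfl⟩ ⟨n, hn⟩
  have hc0 : (c : ℚ) ≠ 0 := by positivity
  have hbq : (b : ℚ) ≠ 0 := by positivity
  have h1 : (3 : ℤ) ^ e * (b * m) = c * n := by
    have : (N : ℚ) * m = c * n := by rw [← hn]; field_simp
    rw [hNb] at this
    have h2 : ((3 ^ e * b : ℕ) : ℤ) * m = (c : ℕ) * n := by exact_mod_cast this
    rw [← h2]; push_cast; ring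
  have hcop : IsCoprime ((c : ℕ) : ℤ) ((3 : ℤ) ^ e) := by
    have : Nat.Coprime c (3 ^ e) :=
      Nat.Coprime.pow_right e ((Nat.Prime.coprime_iff_not_dvd Nat.prime_three).2 hc).symm
    exact_mod_cast Nat.isCoprime_iff_coprime.2 this
  obtain ⟨l, hl⟩ : ((c : ℕ) : ℤ) ∣ b * m := hcop.dvd_of_dvd_mul_left ⟨n, h1⟩
  refine ⟨l, ?_⟩
  have h3 : (b : ℚ) * m = c * l := by exact_mod_cast hl
  simp only [PNat.mk_coe]
  field_simp
  linarith

/-- The complex characters of `ℚ` which are trivial on the rationals with denominator prime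
to `3`. -/
def threeChar : Subgroup (AddChar ℚ ℂ) where
  carrier := {χ | ∀ q ∈ primeToThree, χ q = 1}
  one_mem' := by simp
  mul_mem' {χ ψ} hχ hψ q hq := by simp [hχ q hq, hψ q hq]
  inv_mem' {χ} hχ q hq := by
    rw [AddChar.inv_apply]
    exact hχ _ (neg_mem hq)

/-- The character `q ↦ exp (2 π i c q)`. -/
def expChar (c : ℚ) : AddChar ℚ ℂ where
  toFun q := Complex.exp (2 * Real.pi * Complex.I * (c * q : ℚ))
  map_zero_eq_one' := by simp
  map_add_eq_mul' q r := by rw [← Complex.exp_add]; push_cast; ring_nf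

theorem expChar_eq_one_iff (c q : ℚ) : expChar c q = 1 ↔ ∃ n : ℤ, c * q = n := by
  change Complex.exp (2 * Real.pi * Complex.I * (c * q : ℚ)) = 1 ↔ _
  rw [Complex.exp_eq_one_iff]
  refine exists_congr fun n => ?_
  rw [mul_comm, mul_left_inj' (by simp [Real.pi_ne_zero])]
  exact_mod_cast Iff.rfl

/-- The group `ℚ/ℤ` is a cogenerator, so some homomorphism from `ℚ / primeToThree` to it does not
kill `q`. The exponential embeds `ℚ/ℤ` in the complex numbers of modulus one. -/
theorem exists_threeChar_ne_one (q : ℚ) (hq : q ∉ primeToThree) : ∃ χ ∈ threeChar, χ q ≠ 1 := by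
  have h0 : (QuotientAddGroup.mk q : ℚ ⧸ primeToThree) ≠ 0 := by
    rwa [Ne, QuotientAddGroup.eq_zero_iff]
  obtain ⟨c, hc⟩ := CharacterModule.exists_character_apply_ne_zero_of_ne_zero h0
  let E : AddCircle (1 : ℚ) →+ Additive ℂ :=
    QuotientAddGroup.lift _ (expChar 1).toAddMonoidHom fun x hx => by
      obtain ⟨n, rfl⟩ := AddSubgroup.mem_zmultiples_iff.1 hx
      exact (expChar_eq_one_iff 1 _).2 ⟨n, by simp⟩
  have hE (x : AddCircle (1 : ℚ)) (hx : E x = 0) : x = 0 := by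
    obtain ⟨x, rfl⟩ := QuotientAddGroup.mk_surjective x
    obtain ⟨n, hn⟩ := (expChar_eq_one_iff 1 x).1 hx
    rw [one_mul] at hn
    exact (QuotientAddGroup.eq_zero_iff _).2 (AddSubgroup.mem_zmultiples_iff.2 ⟨n, by simp [hn]⟩)
  let F : ℚ →+ Additive ℂ :=
    (E.comp (show (ℚ ⧸ primeToThree) →+ AddCircle (1 : ℚ) from c)).comp (QuotientAddGroup.mk' _)
  refine ⟨AddChar.toAddMonoidHomEquiv.symm F, fun x hx => ?_, fun h => hc (hE _ h)⟩
  have h1 : F x = 0 := by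
    have : QuotientAddGroup.mk' primeToThree x = 0 := (QuotientAddGroup.eq_zero_iff _).2 hx
    simp only [F, AddMonoidHom.comp_apply, this, map_zero]
  exact h1

/-- The root is `q ↦ χ(q/p)`. It is still trivial on `primeToThree`, which is stable under division
by integers prime to 3. -/
theorem exists_pow_eq_of_mem_threeChar (p : ℕ) (hp : ¬ 3 ∣ p) (χ : AddChar ℚ ℂ)
    (hχ : χ ∈ threeChar) : ∃ ψ ∈ threeChar, ψ ^ p = χ := by
  have hp0 : (p : ℚ) ≠ 0 := by
    rw [Nat.cast_ne_zero]
    rintro rfl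
    exact hp (dvd_zero 3)
  refine ⟨χ.compAddMonoidHom (AddMonoidHom.mulLeft (p : ℚ)⁻¹), fun q hq => ?_, ?_⟩
  · change χ ((p : ℚ)⁻¹ * q) = 1
    rw [mul_comm, ← div_eq_mul_inv]
    exact hχ _ (div_mem_primeToThree hq p hp)
  · ext q
    rw [AddChar.pow_apply]
    change χ ((p : ℚ)⁻¹ * q) ^ p = χ q
    rw [← AddChar.map_nsmul_eq_pow]
    congr 1
    rw [nsmul_eq_mul, mul_inv_cancel_left₀ hp0]

theorem mem_unionField {k : Type*} [Field k] {f : HahnSeries ℚ (HahnSeries ℚ k)} :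
    f ∈ unionField k ↔ ∃ a : ℕ+, ¬ 3 ∣ (a : ℕ) ∧ ∀ q r, (f.coeff q).coeff r ≠ 0 →
      (∃ n : ℤ, q = n / a) ∧ ∃ m : ℤ, r = m / a := by
  have h : f ∈ unionField k ↔ f ∈ ⋃ (a : ℕ+) (_ : ¬ 3 ∣ (a : ℕ)), Set.range (rootSubst₂ k a) :=
    Iff.rfl
  rw [h, Set.mem_iUnion₂]
  simp only [mem_range_rootSubst₂, divEmb, OrderEmbedding.coe_ofMapLEIff, eq_comm, exists_prop]

/-- The action of a pair of characters on `ℂ[[x^ℚ]][[y^ℚ]]` by a homomorphism over the union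
field. -/
def twistAlgHom (χ : threeChar × threeChar) :
    HahnSeries ℚ (HahnSeries ℚ ℂ) →ₐ[unionField ℂ] HahnSeries ℚ (HahnSeries ℚ ℂ) :=
  AlgHom.mk (HahnSeries.twist₂ χ.1.1 χ.2.1) fun f => by
    refine HahnSeries.ext₂ fun q r => (HahnSeries.coeff_coeff_twist₂ _ _ _ _ _).trans ?_
    obtain ⟨a, ha, h⟩ := mem_unionField.1 f.2
    change χ.1.1 q * (χ.2.1 r * (f.1.coeff q).coeff r) = (f.1.coeff q).coeff r
    by_cases h0 : (f.1.coeff q).coeff r = 0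
    · simp [h0]
    · obtain ⟨⟨n, hn⟩, m, hm⟩ := h q r h0
      rw [χ.1.2 q ⟨a, n, ha, hn⟩, χ.2.2 r ⟨a, m, ha, hm⟩, one_mul, one_mul]

theorem coeff_twistAlgHom (χ : threeChar × threeChar) (f : HahnSeries ℚ (HahnSeries ℚ ℂ))
    (q r : ℚ) :
    ((twistAlgHom χ f).coeff q).coeff r = χ.1.1 q * (χ.2.1 r * (f.coeff q).coeff r) :=
  HahnSeries.coeff_coeff_twist₂ _ _ _ _ _

/-- The action of pairs of characters on `ℂ[[x^ℚ]][[y^ℚ]]`. -/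
def twistHom : threeChar × threeChar →*
    (HahnSeries ℚ (HahnSeries ℚ ℂ) →ₐ[unionField ℂ] HahnSeries ℚ (HahnSeries ℚ ℂ)) where
  toFun := twistAlgHom
  map_one' := AlgHom.ext fun f => HahnSeries.ext₂ fun q r => by
    rw [coeff_twistAlgHom]
    simp
  map_mul' χ ψ := AlgHom.ext fun f => HahnSeries.ext₂ fun q r => by
    rw [AlgHom.mul_apply, coeff_twistAlgHom, coeff_twistAlgHom, coeff_twistAlgHom]
    simp only [Prod.fst_mul, Prod.snd_mul, Subgroup.coe_mul, AddChar.mul_apply]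
    ring

open Polynomial in
/-- The exponents of an algebraic element have bounded denominators. -/
theorem exists_bound_of_isAlgebraic (β : HahnSeries ℚ (HahnSeries ℚ ℂ))
    (hβ : IsAlgebraic (unionField ℂ) β) : ∃ N : ℕ, N ≠ 0 ∧ ∀ q r, (β.coeff q).coeff r ≠ 0 →
      (∃ n : ℤ, N * q = n) ∧ ∃ n : ℤ, N * r = n := by
  obtain ⟨p, hp0, hp⟩ := hβ
  choose a ha h using fun f : unionField ℂ => mem_unionField.1 f.2
  -- A common denominator for all exponents in the coefficients of `p`.
  set A : ℕ := ∏ i ∈ p.support, (a (p.coeff i) : ℕ) with hA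
  have hA0 : A ≠ 0 := Finset.prod_ne_zero_iff.2 fun i _ => (a _).ne_zero
  have hAint (i : ℕ) (q : ℚ) (hq : ∃ n : ℤ, q = n / a (p.coeff i)) (hi : i ∈ p.support) :
      ∃ n : ℤ, (A : ℚ) * q = n := by
    obtain ⟨n, rfl⟩ := hq
    obtain ⟨b, hb⟩ := Finset.dvd_prod_of_mem (fun i => (a (p.coeff i) : ℕ)) hi
    refine ⟨b * n, ?_⟩
    rw [hA, hb]
    have : ((a (p.coeff i) : ℕ) : ℚ) ≠ 0 := by positivity
    push_cast
    field_simp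
  set P : (HahnSeries ℚ (HahnSeries ℚ ℂ))[X] := p.map (algebraMap _ _) with hP
  have hP0 : P ≠ 0 := (Polynomial.map_ne_zero_iff Subtype.val_injective).2 hp0
  have hroot : P.eval β = 0 := by rwa [hP, eval_map_algebraMap]
  -- These characters are trivial on the exponents of the coefficients, so the twists fix `P` and
  -- send `β` to other roots of it.
  have hfix (c d : ℕ) : P.map (HahnSeries.twist₂ (expChar (c * A)) (expChar (d * A))) = P := by
    ext1 i
    rw [coeff_map, hP, coeff_map]
    refine HahnSeries.ext₂ fun q r => ?_
    rw [HahnSeries.coeff_coeff_twist₂]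
    change _ * (_ * ((p.coeff i).1.coeff q).coeff r) = ((p.coeff i).1.coeff q).coeff r
    by_cases h0 : ((p.coeff i).1.coeff q).coeff r = 0
    · simp [h0]
    · have hi : i ∈ p.support := by
        rw [mem_support_iff]
        intro h1
        rw [h1] at h0
        exact h0 (by simp)
      obtain ⟨hq, hr⟩ := h (p.coeff i) q r h0
      obtain ⟨n, hn⟩ := hAint i q hq hi
      obtain ⟨m, hm⟩ := hAint i r hr hi
      rw [(expChar_eq_one_iff _ q).2 ⟨c * n, by rw [mul_assoc, hn]; push_cast; ring⟩,
        (expChar_eq_one_iff _ r).2 ⟨d * m, by rw [mul_assoc, hm]; push_cast; ring⟩, one_mul, one_mul]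
  have hmem (c d : ℕ) : P.IsRoot (HahnSeries.twist₂ (expChar (c * A)) (expChar (d * A)) β) := by
    rw [IsRoot.def, ← hfix c d, eval_map_apply, hroot, map_zero]
  have hexp (i j : ℕ) (q : ℚ) (he : expChar (i * A) q = expChar (j * A) q) :
      ∃ n : ℤ, (((i : ℤ) - j).natAbs * A : ℕ) * q = n := by
    have h1 : expChar ((i - j : ℚ) * A) q = 1 := by
      have h2 : expChar ((i - j : ℚ) * A) q * expChar (j * A) q = expChar (i * A) q := by
        change Complex.exp _ * Complex.exp _ = Complex.exp _
        rw [← Complex.exp_add]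
        push_cast
        ring_nf
      rw [he] at h2
      exact mul_eq_right₀ (AddChar.apply_ne_zero_of_field _ _) |>.1 h2
    obtain ⟨n, hn⟩ := (expChar_eq_one_iff _ _).1 h1
    rcases Int.natAbs_eq ((i : ℤ) - j) with h3 | h3
    · refine ⟨n, ?_⟩
      have h4 : ((i : ℚ) - j) = (((i : ℤ) - j).natAbs : ℚ) := by
        simpa using congrArg (Int.cast : ℤ → ℚ) h3
      rw [← hn, h4]; push_cast; ring
    · refine ⟨-n, ?_⟩
      have h4 : ((i : ℚ) - j) = -(((i : ℤ) - j).natAbs : ℚ) := by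
        simpa using congrArg (Int.cast : ℤ → ℚ) h3
      push_cast
      rw [← hn, h4]; ring
  -- There are finitely many roots, so two distinct multiples of `A` give the same twist of `β`. The
  -- two characters then agree on every exponent of `β`, which bounds its denominator. This is done
  -- separately for `y` and for `x`.
  have hfin : Finite {f // P.IsRoot f} :=
    finite_setOfPred_isRoot (R := HahnSeries ℚ (HahnSeries ℚ ℂ)) hP0
  let F : ℕ → {f // P.IsRoot f} := fun c => ⟨_, hmem c 0⟩
  let F' : ℕ → {f // P.IsRoot f} := fun d => ⟨_, hmem 0 d⟩
  obtain ⟨i, j, hij, he⟩ := Finite.exists_ne_map_eq_of_infinite F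
  obtain ⟨i', j', hij', he'⟩ := Finite.exists_ne_map_eq_of_infinite F'
  have hne (i j : ℕ) (hij : i ≠ j) : ((i : ℤ) - j).natAbs * A ≠ 0 :=
    mul_ne_zero (by rw [Int.natAbs_ne_zero, sub_ne_zero]; exact_mod_cast hij) hA0
  refine ⟨_, mul_ne_zero (hne i j hij) (hne i' j' hij'), fun q r hqr => ?_⟩
  have e1 : expChar (i * A) q = expChar (j * A) q := by
    have := congrArg (fun f : {f // P.IsRoot f} => (f.1.coeff q).coeff r) he
    simpa [F, expChar, hqr] using this
  have e2 : expChar (i' * A) r = expChar (j' * A) r := by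
    have := congrArg (fun f : {f // P.IsRoot f} => (f.1.coeff q).coeff r) he'
    simpa [F', expChar, hqr] using this
  obtain ⟨n, hn⟩ := hexp i j q e1
  obtain ⟨m, hm⟩ := hexp i' j' r e2
  refine ⟨⟨(((i' : ℤ) - j').natAbs * A : ℕ) * n, ?_⟩, (((i : ℤ) - j).natAbs * A : ℕ) * m, ?_⟩
  · rw [Int.cast_mul, ← hn, Int.cast_natCast, Nat.cast_mul]; ring
  · rw [Int.cast_mul, ← hm, Int.cast_natCast, Nat.cast_mul]; ring

/-- An exponent outside `primeToThree` would be moved by some character. All exponents therefore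
have denominators prime to 3, and algebraicity supplies the common denominator that membership in
the union requires. -/
theorem mem_unionField_of_forall_twist (β : HahnSeries ℚ (HahnSeries ℚ ℂ))
    (hβ : IsAlgebraic (unionField ℂ) β) (h : ∀ χ, twistHom χ β = β) : β ∈ unionField ℂ := by
  obtain ⟨N, hN, hb⟩ := exists_bound_of_isAlgebraic β hβ
  obtain ⟨a, ha, hq⟩ := exists_eq_div_of_mem_primeToThree N hN
  refine mem_unionField.2 ⟨a, ha, fun q r hqr => ⟨hq q ?_ (hb q r hqr).1, hq r ?_ (hb q r hqr).2⟩⟩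
  · by_contra hq
    obtain ⟨χ, hχ, hne⟩ := exists_threeChar_ne_one q hq
    have h1 := coeff_twistAlgHom (⟨χ, hχ⟩, 1) β q r
    rw [show twistAlgHom (⟨χ, hχ⟩, 1) β = β from h _] at h1
    simp [hqr] at h1
    exact hne h1
  · by_contra hr
    obtain ⟨χ, hχ, hne⟩ := exists_threeChar_ne_one r hr
    have h1 := coeff_twistAlgHom (1, ⟨χ, hχ⟩) β q r
    rw [show twistAlgHom (1, ⟨χ, hχ⟩) β = β from h _] at h1
    simp [hqr] at h1
    exact hne h1

/-! ### Galois groups and degrees over the union field. -/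

theorem exists_pow_eq_threeChar (p : ℕ) (hp : ¬ 3 ∣ p) (χ : threeChar × threeChar) :
    ∃ ψ, ψ ^ p = χ := by
  obtain ⟨ψ₁, h₁, e₁⟩ := exists_pow_eq_of_mem_threeChar p hp _ χ.1.2
  obtain ⟨ψ₂, h₂, e₂⟩ := exists_pow_eq_of_mem_threeChar p hp _ χ.2.2
  exact ⟨(⟨ψ₁, h₁⟩, ⟨ψ₂, h₂⟩), Prod.ext (Subtype.ext e₁) (Subtype.ext e₂)⟩

/-- A finite quotient of a group which is `p`-divisible for all primes `p ≠ 3` is a `3`-group. -/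
theorem exists_card_eq_three_pow {X G : Type*} [Group X] [Group G] [Finite G] (φ : X →* G)
    (hφ : Function.Surjective φ) (hX : ∀ p : ℕ, ¬ 3 ∣ p → ∀ x : X, ∃ y, y ^ p = x) :
    ∃ n, Nat.card G = 3 ^ n := by
  have h (p : ℕ) (hp : p.Prime) (hd : p ∣ Nat.card G) : p = 3 := by
    by_contra h3
    have : Fact p.Prime := ⟨hp⟩
    obtain ⟨g, hg⟩ := exists_prime_orderOf_dvd_card' p hd
    -- On a finite group a surjective `p`-th power map is injective, but it sends the element `g` of
    -- order `p` to 1.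
    have hsurj : Function.Surjective fun x : G => x ^ p := fun x => by
      obtain ⟨x, rfl⟩ := hφ x
      obtain ⟨y, rfl⟩ := hX p (fun h => h3 ((Nat.prime_dvd_prime_iff_eq Nat.prime_three hp).1 h).symm) x
      exact ⟨φ y, (map_pow φ y p).symm⟩
    have hinj := Finite.injective_iff_surjective.2 hsurj
    have : g = 1 := hinj (by simp [← hg, pow_orderOf_eq_one])
    rw [this, orderOf_one] at hg
    exact hp.one_lt.ne hg
  exact ⟨_, Nat.eq_prime_pow_of_unique_prime_dvd Nat.card_pos.ne' fun {d} hd hdv => h d hd hdv⟩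

theorem finrank_eq_three_pow (L : Type*) [Field L] [Algebra (unionField ℂ) L]
    [FiniteDimensional (unionField ℂ) L] [IsGalois (unionField ℂ) L] :
    ∃ n : ℕ, Module.finrank (unionField ℂ) L = 3 ^ n := by
  let ι : L →ₐ[unionField ℂ] HahnSeries ℚ (HahnSeries ℚ ℂ) := IsAlgClosed.lift
  let alg : Algebra L (HahnSeries ℚ (HahnSeries ℚ ℂ)) :=
    RingHom.toAlgebra (S := HahnSeries ℚ (HahnSeries ℚ ℂ)) ι.toRingHom
  have tower : IsScalarTower (unionField ℂ) L (HahnSeries ℚ (HahnSeries ℚ ℂ)) :=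
    IsScalarTower.of_algebraMap_eq fun x => (ι.commutes x).symm
  let φ : threeChar × threeChar →* (L ≃ₐ[unionField ℂ] L) :=
    (AlgEquiv.restrictNormalHom L).comp
      ((AlgEquiv.algHomUnitsEquiv _ _).toMonoidHom.comp twistHom.toHomUnits)
  have hφ (χ : threeChar × threeChar) (l : L) : ι (φ χ l) = twistHom χ (ι l) :=
    AlgEquiv.restrictNormal_commutes _ L l
  have hsurj : Function.Surjective φ := by
    -- By the Galois correspondence it is enough that the image of the characters has fixed field
    -- `K`.
    rw [← MonoidHom.range_eq_top, ← IntermediateField.fixingSubgroup_fixedField φ.range]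
    have hbot : IntermediateField.fixedField φ.range = ⊥ := by
      rw [eq_bot_iff]
      intro l hl
      rw [IntermediateField.mem_fixedField_iff] at hl
      have h1 : ι l ∈ unionField ℂ := by
        refine mem_unionField_of_forall_twist _ ?_ fun χ => ?_
        · exact (Algebra.IsAlgebraic.isAlgebraic l).algHom ι
        · rw [← hφ, hl _ ⟨χ, rfl⟩]
      rw [IntermediateField.mem_bot]
      exact ⟨⟨_, h1⟩, ι.toRingHom.injective (ι.commutes _)⟩
    rw [hbot, IntermediateField.fixingSubgroup_bot]
  rw [← IsGalois.card_aut_eq_finrank]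
  exact exists_card_eq_three_pow φ hsurj exists_pow_eq_threeChar

/-- The normal closure is Galois in characteristic zero, so its degree is an odd number `3ⁿ` and
cannot be a multiple of 6. -/
theorem finrank_ne_six (L : Type*) [Field L] [Algebra (unionField ℂ) L] :
    Module.finrank (unionField ℂ) L ≠ 6 := by
  intro h6
  have : FiniteDimensional (unionField ℂ) L := Module.finite_of_finrank_pos (by omega)
  let N := IntermediateField.normalClosure (unionField ℂ) L (AlgebraicClosure L)
  have : CharZero (unionField ℂ) := (unionField ℂ).subtype.charZero
  obtain ⟨n, hn⟩ := finrank_eq_three_pow N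
  have h1 := Module.finrank_mul_finrank (unionField ℂ) L N
  rw [h6, hn] at h1
  have h2 : 2 ∣ 3 ^ n := ⟨3 * Module.finrank L N, by rw [← h1]; ring⟩
  have := Nat.Prime.dvd_of_dvd_pow Nat.prime_two h2
  omega

/-! ### Leading exponents of iterated Hahn series -/

/-- The pair of exponents `m` is the leading exponent of `f`, for the lexicographic order. -/
def IsLeadingExp {k : Type*} [Field k] (f : HahnSeries ℚ (HahnSeries ℚ k)) (m : ℚ ×ₗ ℚ) : Prop :=
  (f.coeff (ofLex m).1).coeff (ofLex m).2 ≠ 0 ∧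
    ∀ n < m, (f.coeff (ofLex n).1).coeff (ofLex n).2 = 0

namespace IsLeadingExp

variable {k : Type*} [Field k] {f g : HahnSeries ℚ (HahnSeries ℚ k)} {m n : ℚ ×ₗ ℚ}

theorem of_ne_zero (hf : f ≠ 0) : IsLeadingExp f (toLex (f.order, f.leadingCoeff.order)) := by
  refine ⟨?_, fun n hn => ?_⟩
  · simp only [ofLex_toLex]
    rw [← HahnSeries.leadingCoeff_eq]
    exact fun h => HahnSeries.leadingCoeff_ne_zero.2 hf (HahnSeries.coeff_order_eq_zero.1 h)
  · rcases (Prod.Lex.lt_iff).1 hn with h | ⟨h, h'⟩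
    · rw [HahnSeries.coeff_eq_zero_of_lt_order h, HahnSeries.coeff_zero]
    · rw [h]
      simp only [ofLex_toLex] at h' ⊢
      rw [← HahnSeries.leadingCoeff_eq]
      exact HahnSeries.coeff_eq_zero_of_lt_order h'

theorem ne_zero (h : IsLeadingExp f m) : f ≠ 0 := by
  rintro rfl
  exact h.1 (by simp)

theorem unique (h : IsLeadingExp f m) (h' : IsLeadingExp f n) : m = n := by
  rcases lt_trichotomy m n with hl | hl | hl
  · exact absurd (h'.2 m hl) h.1
  · exact hl
  · exact absurd (h.2 n hl) h'.1

theorem eq (h : IsLeadingExp f m) : m = toLex (f.order, f.leadingCoeff.order) :=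
  h.unique (of_ne_zero h.ne_zero)

theorem mul (hf : IsLeadingExp f m) (hg : IsLeadingExp g n) : IsLeadingExp (f * g) (m + n) := by
  have h := of_ne_zero (mul_ne_zero hf.ne_zero hg.ne_zero)
  rw [HahnSeries.order_mul hf.ne_zero hg.ne_zero, HahnSeries.leadingCoeff_mul,
    HahnSeries.order_mul (HahnSeries.leadingCoeff_ne_zero.2 hf.ne_zero)
      (HahnSeries.leadingCoeff_ne_zero.2 hg.ne_zero)] at h
  rw [hf.eq, hg.eq]
  exact h

theorem single_single {a : k} (ha : a ≠ 0) (q r : ℚ) :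
    IsLeadingExp (HahnSeries.single q (HahnSeries.single r a)) (toLex (q, r)) := by
  have h1 : HahnSeries.single r a ≠ 0 := HahnSeries.single_ne_zero ha
  have h := of_ne_zero (HahnSeries.single_ne_zero (a := q) h1)
  rwa [HahnSeries.order_single h1, HahnSeries.leadingCoeff_of_single, HahnSeries.order_single ha] at h

end IsLeadingExp

/-- The prime 3 is not inverted in `primeToThree`, so integers keep their class modulo 3 there. This
tells apart the exponents of different monomials in the norm equation. -/
theorem three_dvd_of_mem_primeToThree {q : ℚ} (hq : q ∈ primeToThree) (n : ℤ) (h : 3 * q = n) :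
    3 ∣ n := by
  obtain ⟨a, m, ha, rfl⟩ := hq
  have ha0 : (a : ℚ) ≠ 0 := by positivity
  have h1 : (3 : ℤ) * m = n * (a : ℕ) := by
    have : (3 : ℚ) * m = n * a := by rw [← h]; field_simp
    exact_mod_cast this
  have h2 : (3 : ℤ) ∣ n * (a : ℕ) := ⟨m, h1.symm⟩
  exact (Int.prime_three.dvd_or_dvd h2).resolve_right fun h => ha (by exact_mod_cast h)

/-- The exponents of an element of the union field have denominators prime to `3`. -/
theorem IsLeadingExp.mem_primeToThree {k : Type*} [Field k] {f : HahnSeries ℚ (HahnSeries ℚ k)}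
    {m : ℚ ×ₗ ℚ} (h : IsLeadingExp f m) (hf : f ∈ unionField k) :
    (ofLex m).1 ∈ primeToThree ∧ (ofLex m).2 ∈ primeToThree := by
  obtain ⟨a, ha, h'⟩ := mem_unionField.1 hf
  obtain ⟨⟨n, hn⟩, l, hl⟩ := h' _ _ h.1
  exact ⟨⟨a, n, ha, hn⟩, ⟨a, l, ha, hl⟩⟩

/-- The element `x` of the union field. -/
def unionField.x (k : Type*) [Field k] : unionField k :=
  ⟨HahnSeries.single 0 (HahnSeries.single 1 1), mem_unionField.2 ⟨1, by simp, fun q r h => by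
    by_cases hq : q = 0
    · subst hq
      rw [HahnSeries.coeff_single_same] at h
      by_cases hr : r = 1
      · exact ⟨⟨0, by simp⟩, 1, by simp [hr]⟩
      · exact absurd (HahnSeries.coeff_single_of_ne hr) h
    · rw [HahnSeries.coeff_single_of_ne hq] at h
      simp at h⟩⟩

/-- The element `y` of the union field. -/
def unionField.y (k : Type*) [Field k] : unionField k :=
  ⟨HahnSeries.single 1 (HahnSeries.single 0 1), mem_unionField.2 ⟨1, by simp, fun q r h => by
    by_cases hq : q = 1
    · subst hq
      rw [HahnSeries.coeff_single_same] at h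
      by_cases hr : r = 0
      · exact ⟨⟨1, by simp⟩, 0, by simp [hr]⟩
      · exact absurd (HahnSeries.coeff_single_of_ne hr) h
    · rw [HahnSeries.coeff_single_of_ne hq] at h
      simp at h⟩⟩

theorem unionField.isLeadingExp_x (k : Type*) [Field k] :
    IsLeadingExp (unionField.x k).1 (toLex (0, 1)) :=
  IsLeadingExp.single_single one_ne_zero 0 1

theorem unionField.isLeadingExp_y (k : Type*) [Field k] :
    IsLeadingExp (unionField.y k).1 (toLex (1, 0)) :=
  IsLeadingExp.single_single one_ne_zero 1 0

/-- `y` times a cube is not a norm from the extension generated by a cube root of `x`. -/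
theorem unionField.norm_form_ne {k : Type*} [Field k] [CharZero k] (u : Fin 3 → unionField k)
    (e : unionField k)
    (h : u 0 ^ 3 + x k * u 1 ^ 3 + x k ^ 2 * u 2 ^ 3 - 3 * x k * u 0 * u 1 * u 2 = y k * e ^ 3) :
    (∀ i, u i = 0) ∧ e = 0 := by
  classical
  -- The equation becomes `∑ zᵢ wᵢ³ = 3x u₀u₁u₂`, the sign being absorbed in the cube of `-e`.
  let w : Fin 4 → unionField k := ![u 0, u 1, u 2, -e]
  let z : Fin 4 → unionField k := ![1, x k, x k ^ 2, y k]
  let c : Fin 4 → ℚ ×ₗ ℚ := ![toLex (0, 0), toLex (0, 1), toLex (0, 2), toLex (1, 0)]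
  have hz (i : Fin 4) : IsLeadingExp (z i).1 (c i) := by
    fin_cases i
    · exact IsLeadingExp.single_single one_ne_zero 0 0
    · exact isLeadingExp_x k
    · have := (isLeadingExp_x k).mul (isLeadingExp_x k)
      have e1 : toLex ((0 : ℚ), (1 : ℚ)) + toLex (0, 1) = toLex (0, 2) := by
        rw [← toLex_add, Prod.mk_add_mk]; norm_num
      rw [e1] at this
      simpa [z, c, sq] using this
    · exact isLeadingExp_y k
  let E : Fin 4 → ℚ ×ₗ ℚ := fun i => toLex ((w i).1.order, (w i).1.leadingCoeff.order)
  have hw (i : Fin 4) (hi : w i ≠ 0) : IsLeadingExp (w i).1 (E i) :=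
    IsLeadingExp.of_ne_zero fun h => hi (Subtype.ext h)
  let m : Fin 4 → ℚ ×ₗ ℚ := fun i => c i + (E i + E i + E i)
  have hm (i : Fin 4) (hi : w i ≠ 0) : IsLeadingExp (z i * w i ^ 3).1 (m i) := by
    have := (hz i).mul (((hw i hi).mul (hw i hi)).mul (hw i hi))
    have e1 : (z i * w i ^ 3).1 = (z i).1 * ((w i).1 * (w i).1 * (w i).1) := by
      change (z i).1 * (w i).1 ^ 3 = _
      ring
    rwa [e1]
  have hcomp (i : Fin 4) : (ofLex (m i)).1 = (ofLex (c i)).1 + 3 * (ofLex (E i)).1 ∧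
      (ofLex (m i)).2 = (ofLex (c i)).2 + 3 * (ofLex (E i)).2 := by
    simp only [m, ofLex_add, Prod.fst_add, Prod.snd_add]
    constructor <;> ring
  -- Modulo 3 the exponent `m i` is `c i`, and `(0,0)`, `(0,1)`, `(0,2)`, `(1,0)` are pairwise
  -- incongruent.
  have hne (i j : Fin 4) (hij : i ≠ j) (hi : w i ≠ 0) (hj : w j ≠ 0) : m i ≠ m j := by
    intro he
    obtain ⟨h1, h2⟩ := (hw i hi).mem_primeToThree (w i).2
    obtain ⟨h3, h4⟩ := (hw j hj).mem_primeToThree (w j).2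
    have a1 := (hcomp i).1
    have a2 := (hcomp i).2
    rw [he, (hcomp j).1] at a1
    rw [he, (hcomp j).2] at a2
    have b1 (n : ℤ) (hn : (ofLex (c j)).1 - (ofLex (c i)).1 = n) : 3 ∣ n :=
      three_dvd_of_mem_primeToThree (sub_mem h1 h3) n (by rw [← hn]; linarith)
    have b2 (n : ℤ) (hn : (ofLex (c j)).2 - (ofLex (c i)).2 = n) : 3 ∣ n :=
      three_dvd_of_mem_primeToThree (sub_mem h2 h4) n (by rw [← hn]; linarith)
    have d1 : ¬ (3 : ℤ) ∣ 1 := by decide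
    have d2 : ¬ (3 : ℤ) ∣ 2 := by decide
    have d3 : ¬ (3 : ℤ) ∣ -1 := by decide
    have d4 : ¬ (3 : ℤ) ∣ -2 := by decide
    fin_cases i <;> fin_cases j
    exacts [hij rfl, d1 (b2 1 (by norm_num [c])), d2 (b2 2 (by norm_num [c])),
      d1 (b1 1 (by norm_num [c])), d3 (b2 (-1) (by norm_num [c])), hij rfl,
      d1 (b2 1 (by norm_num [c])), d1 (b1 1 (by norm_num [c])),
      d4 (b2 (-2) (by norm_num [c])), d3 (b2 (-1) (by norm_num [c])), hij rfl,
      d1 (b1 1 (by norm_num [c])), d3 (b1 (-1) (by norm_num [c])),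
      d3 (b1 (-1) (by norm_num [c])), d3 (b1 (-1) (by norm_num [c])), hij rfl]
  by_cases hall : ∀ i, w i = 0
  · refine ⟨fun i => ?_, neg_eq_zero.1 (hall 3)⟩
    fin_cases i
    exacts [hall 0, hall 1, hall 2]
  exfalso
  push Not at hall
  obtain ⟨i, hi, hmin⟩ := (Finset.univ.filter fun i => w i ≠ 0).exists_min_image m (by
    obtain ⟨i, hi⟩ := hall
    exact ⟨i, by simpa using hi⟩)
  simp only [Finset.mem_filter, Finset.mem_univ, true_and] at hi hmin
  have hlt (j : Fin 4) (hj : w j ≠ 0) (hij : j ≠ i) : m i < m j :=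
    lt_of_le_of_ne (hmin j hj) (hne i j hij.symm hi hj)
  -- The coefficient at the smallest of the exponents `m`, where exactly one of the four cube terms
  -- contributes.
  let co : HahnSeries ℚ (HahnSeries ℚ k) → k := fun f => (f.coeff (ofLex (m i)).1).coeff (ofLex (m i)).2
  have hadd (f g : HahnSeries ℚ (HahnSeries ℚ k)) : co (f + g) = co f + co g := by simp [co]
  have hj0 (j : Fin 4) (hij : j ≠ i) : co (z j * w j ^ 3).1 = 0 := by
    by_cases hj : w j = 0
    · simp [hj, co]
    · exact (hm j hj).2 _ (hlt j hj hij)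
  have hD : co (3 * x k * u 0 * u 1 * u 2 : unionField k).1 = 0 := by
    by_cases h0 : w 0 = 0
    · have h0' : u 0 = 0 := h0
      simp [h0', co]
    by_cases h1 : w 1 = 0
    · have h1' : u 1 = 0 := h1
      simp [h1', co]
    by_cases h2 : w 2 = 0
    · have h2' : u 2 = 0 := h2
      simp [h2', co]
    have h3 : IsLeadingExp (HahnSeries.single 0 (HahnSeries.single 0 3) :
      HahnSeries ℚ (HahnSeries ℚ k)) (toLex (0, 0)) :=
      IsLeadingExp.single_single three_ne_zero 0 0
    have hp := (((h3.mul (isLeadingExp_x k)).mul (hw 0 h0)).mul (hw 1 h1)).mul (hw 2 h2)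
    have e3 : (HahnSeries.single 0 (HahnSeries.single 0 3) : HahnSeries ℚ (HahnSeries ℚ k)) = 3 :=
      (congrArg _ (map_ofNat (HahnSeries.C (Γ := ℚ) (R := k)) 3)).trans
        (map_ofNat (HahnSeries.C (Γ := ℚ) (R := HahnSeries ℚ k)) 3)
    rw [e3] at hp
    refine hp.2 _ ?_
    have hle0 := hmin 0 h0
    have hle1 := hmin 1 h1
    have hle2 := hmin 2 h2
    have hsome : m i < m 0 ∨ m i < m 1 ∨ m i < m 2 := by
      by_cases hi0 : (0 : Fin 4) = i
      · exact Or.inr (Or.inl (hlt 1 h1 (by rw [← hi0]; decide)))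
      · exact Or.inl (hlt 0 h0 hi0)
    have hsum : m i + m i + m i < m 0 + m 1 + m 2 := by
      rcases hsome with h | h | h
      · exact add_lt_add_of_lt_of_le (add_lt_add_of_lt_of_le h hle1) hle2
      · exact add_lt_add_of_lt_of_le (add_lt_add_of_le_of_lt hle0 h) hle2
      · exact add_lt_add_of_le_of_lt (add_le_add hle0 hle1) h
    -- As `c 0 + c 1 + c 2 = (0, 3)`, the leading exponent of the cross term is the mean of `m 0`,
    -- `m 1`, `m 2`. These are distinct, so the mean exceeds the minimum and the cross term does not
    -- contribute.
    have hM : m 0 + m 1 + m 2 = (toLex (0, 0) + toLex (0, 1) + E 0 + E 1 + E 2) +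
        (toLex (0, 0) + toLex (0, 1) + E 0 + E 1 + E 2) +
        (toLex (0, 0) + toLex (0, 1) + E 0 + E 1 + E 2) := by
      have hc : c 0 + c 1 + c 2 = (toLex (0, 1) + toLex (0, 1) + toLex (0, 1)) := by
        change toLex ((0 : ℚ), (0 : ℚ)) + toLex (0, 1) + toLex (0, 2) = _
        simp only [← toLex_add, Prod.mk_add_mk]
        norm_num
      have h00 : (toLex ((0 : ℚ), (0 : ℚ)) : ℚ ×ₗ ℚ) = 0 := rfl
      rw [h00, zero_add]
      calc m 0 + m 1 + m 2 = (c 0 + c 1 + c 2) + (E 0 + E 1 + E 2) + (E 0 + E 1 + E 2)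
            + (E 0 + E 1 + E 2) := by simp only [m]; abel
        _ = _ := by rw [hc]; abel
    rw [hM] at hsum
    by_contra hnot
    rw [not_lt] at hnot
    exact absurd hsum (not_lt.2 (add_le_add (add_le_add hnot hnot) hnot))
  have hsum : (z 0 * w 0 ^ 3 + z 1 * w 1 ^ 3 + z 2 * w 2 ^ 3 + z 3 * w 3 ^ 3 : unionField k) =
      3 * x k * u 0 * u 1 * u 2 := by
    change 1 * u 0 ^ 3 + x k * u 1 ^ 3 + x k ^ 2 * u 2 ^ 3 + y k * (-e) ^ 3 = _
    linear_combination h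
  have hco := congrArg (fun f : unionField k => co f.1) hsum
  have hco2 : co (z 0 * w 0 ^ 3).1 + co (z 1 * w 1 ^ 3).1 + co (z 2 * w 2 ^ 3).1 +
      co (z 3 * w 3 ^ 3).1 = 0 := by
    rw [← hD, ← hadd, ← hadd, ← hadd]
    exact hco
  have hne0 : co (z i * w i ^ 3).1 ≠ 0 := (hm i hi).1
  apply hne0
  fin_cases i
  · rwa [hj0 1 (by decide), hj0 2 (by decide), hj0 3 (by decide), add_zero, add_zero, add_zero]
      at hco2
  · rwa [hj0 0 (by decide), hj0 2 (by decide), hj0 3 (by decide), zero_add, add_zero, add_zero]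
      at hco2
  · rwa [hj0 0 (by decide), hj0 1 (by decide), hj0 3 (by decide), zero_add, zero_add, add_zero]
      at hco2
  · rwa [hj0 0 (by decide), hj0 1 (by decide), hj0 2 (by decide), zero_add, zero_add, zero_add]
      at hco2

/-! ### Cubic forms twisted by a symbol algebra -/

namespace TwistedCubic

open MvPolynomial

variable {K L : Type*} [Field K] [Field L] [Algebra K L]

/-- The cubic forms `αⁱ βᵐ ∑ⱼ ωⁱʲ Tⱼ³⁻ᵐ Tⱼ₊₁ᵐ` and `T₀ T₁ T₂`. -/
def form (ω α β : L) : (Fin 3 × Fin 3) ⊕ Unit → MvPolynomial (Fin 3) L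
  | .inl (i, m) => C (α ^ (i : ℕ) * β ^ (m : ℕ)) *
      ∑ j : Fin 3, C (ω ^ ((i : ℕ) * j)) * (X j ^ (3 - (m : ℕ)) * X (j + 1) ^ (m : ℕ))
  | .inr _ => X 0 * X 1 * X 2

theorem isHomogeneous_form (ω α β : L) (n) : (form ω α β n).IsHomogeneous 3 := by
  rcases n with ⟨i, m⟩ | _
  · have hC (c : L) {P : MvPolynomial (Fin 3) L} (hP : P.IsHomogeneous 3) :
        (C c * P).IsHomogeneous 3 := by
      simpa using (isHomogeneous_C (Fin 3) c).mul hP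
    refine hC _ (IsHomogeneous.sum _ _ _ fun j _ => hC _ ?_)
    have := ((isHomogeneous_X L j).pow (3 - (m : ℕ))).mul
      ((isHomogeneous_X L (j + 1)).pow (m : ℕ))
    convert this using 1
    omega
  · exact ((isHomogeneous_X L 0).mul (isHomogeneous_X L 1)).mul (isHomogeneous_X L 2)

theorem pow_three_eq_one {ω : L} (hω : 1 + ω + ω ^ 2 = 0) : ω ^ 3 = 1 := by
  linear_combination (ω - 1) * hω

theorem pow_eq_pow_of_mod {ω : L} (hω : 1 + ω + ω ^ 2 = 0) {a b : ℕ} (h : a % 3 = b % 3) :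
    ω ^ a = ω ^ b := by
  rw [pow_eq_pow_mod a (pow_three_eq_one hω), pow_eq_pow_mod b (pow_three_eq_one hω), h]

/-- Every semilinear automorphism fixes the forms, for a suitable action on the variables. -/
theorem exists_ringHom_form_eq {ω : K} {α β : L} (hω : 1 + ω + ω ^ 2 = 0) (s : L ≃ₐ[K] L)
    (k l : Fin 3) (hα : s α = algebraMap K L ω ^ (k : ℕ) * α)
    (hβ : s β = algebraMap K L ω ^ (l : ℕ) * β) :
    ∃ Θ : MvPolynomial (Fin 3) L →+* MvPolynomial (Fin 3) L, (∀ c, Θ (C c) = C (s c)) ∧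
      ∀ n, Θ (form (algebraMap K L ω) α β n) = form (algebraMap K L ω) α β n := by
  set w := algebraMap K L ω with hw
  have hw1 : 1 + w + w ^ 2 = 0 := by
    rw [hw, ← map_one (algebraMap K L), ← map_pow, ← map_add, ← map_add, hω, map_zero]
  have hsw : s w = w := s.commutes ω
  -- A shift by `k` combined with a diagonal matrix of cube roots of unity: the generators of the
  -- symbol algebra acting on `ℙ²`.
  let Θ : MvPolynomial (Fin 3) L →+* MvPolynomial (Fin 3) L :=
    eval₂Hom (C.comp (s : L →+* L)) fun j => C (w ^ (2 * (j : ℕ) * l)) * X (j + k)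
  have hC (c : L) : Θ (C c) = C (s c) := by simp [Θ]
  have hX (j : Fin 3) : Θ (X j) = C (w ^ (2 * (j : ℕ) * l)) * X (j + k) := by simp [Θ]
  refine ⟨Θ, hC, ?_⟩
  rintro (⟨i, m⟩ | _)
  · simp only [form, map_mul, map_sum, hC, map_pow, hX, hα, hβ, hsw, Finset.mul_sum]
    refine Fintype.sum_equiv (Equiv.addRight k) _ _ fun j => ?_
    simp only [Equiv.coe_addRight, mul_pow, ← map_pow]
    -- On `Tⱼ^{3-m} Tⱼ₊₁^m` the diagonal part gives `ω^{2lm}`, which cancels the `ω^{lm}` coming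
    -- from `β^m`. The factor `ω^{ki}` from `αⁱ` accounts for the shift of the index `j`.
    have e : w ^ ((k : ℕ) * i + l * m + i * j + 2 * j * l * (3 - (m : ℕ)) +
        2 * (j + 1 : Fin 3) * l * m) = w ^ ((i : ℕ) * (j + k : Fin 3)) := by
      apply pow_eq_pow_of_mod hw1
      clear hα hβ
      clear hX hC
      clear Θ
      revert i j k l m
      decide
    rw [← e]
    have e2 : j + 1 + k = j + k + 1 := by abel
    rw [e2]
    simp only [map_pow]
    ring
  · simp only [form, map_mul, hX]
    have e : (C (w ^ (2 * ((0 : Fin 3) : ℕ) * l)) * C (w ^ (2 * ((1 : Fin 3) : ℕ) * l)) *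
        C (w ^ (2 * ((2 : Fin 3) : ℕ) * l)) : MvPolynomial (Fin 3) L) = 1 := by
      rw [← C_mul, ← C_mul, ← pow_add, ← pow_add, pow_eq_pow_of_mod hw1 (b := 0), pow_zero, C_1]
      fin_cases l <;> rfl
    have e2 : (X (0 + k) * X (1 + k) * X (2 + k) : MvPolynomial (Fin 3) L) = X 0 * X 1 * X 2 := by
      fin_cases k
      · rfl
      · change (X 1 * X 2 * X 0 : MvPolynomial (Fin 3) L) = _
        ring
      · change (X 2 * X 0 * X 1 : MvPolynomial (Fin 3) L) = _
        ring
    rw [← e2]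
    linear_combination (X (0 + k) * X (1 + k) * X (2 + k)) * e

/-- The forms span all cubic forms. -/
theorem homogeneousSubmodule_le_span_form {w α β : L} (hw : 1 + w + w ^ 2 = 0) (h3 : (3 : L) ≠ 0)
    (hα : α ≠ 0) (hβ : β ≠ 0) :
    homogeneousSubmodule (Fin 3) L 3 ≤ Submodule.span L (Set.range (form w α β)) := by
  set V := Submodule.span L (Set.range (form w α β))
  have hq (n) : form w α β n ∈ V := Submodule.subset_span ⟨n, rfl⟩
  have hM (m j : Fin 3) : (X j ^ (3 - (m : ℕ)) * X (j + 1) ^ (m : ℕ) : MvPolynomial (Fin 3) L) ∈ V := by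
    -- Inverse Fourier transform on `ℤ/3`, with `w^{2ij} = w^{-ij}`.
    have h : (X j ^ (3 - (m : ℕ)) * X (j + 1) ^ (m : ℕ) : MvPolynomial (Fin 3) L) =
        ∑ i : Fin 3, ((3 * (α ^ (i : ℕ) * β ^ (m : ℕ)))⁻¹ * w ^ (2 * (i : ℕ) * j)) •
          form w α β (.inl (i, m)) := by
      let M : Fin 3 → MvPolynomial (Fin 3) L := fun j => X j ^ (3 - (m : ℕ)) * X (j + 1) ^ (m : ℕ)
      have hi (i : Fin 3) : ((3 * (α ^ (i : ℕ) * β ^ (m : ℕ)))⁻¹ * w ^ (2 * (i : ℕ) * j)) •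
          form w α β (.inl (i, m)) =
          ∑ j' : Fin 3, (3⁻¹ * w ^ (2 * (i : ℕ) * j + i * j')) • M j' := by
        rw [form, Finset.mul_sum, Finset.smul_sum]
        refine Finset.sum_congr rfl fun j' _ => ?_
        simp only [M, smul_eq_C_mul, ← mul_assoc, ← C_mul]
        congr 3
        rw [pow_add]
        field_simp
      simp only [hi]
      rw [Finset.sum_comm]
      simp only [← Finset.sum_smul, ← Finset.mul_sum]
      have hδ (j' : Fin 3) : (3 : L)⁻¹ * ∑ i : Fin 3, w ^ (2 * (i : ℕ) * j + i * j') =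
          if j' = j then 1 else 0 := by
        have hp (a b : ℕ) (h : a % 3 = b % 3) := pow_eq_pow_of_mod (a := a) (b := b) hw h
        have hs : ∑ i : Fin 3, w ^ (2 * (i : ℕ) * j + i * j') = if j' = j then 3 else 0 := by
          simp only [Fin.sum_univ_three]
          fin_cases j <;> fin_cases j' <;> simp <;> first
            | linear_combination hw
            | linear_combination hw + hp 2 2 rfl
            | linear_combination hw + hp 4 1 rfl
            | linear_combination hp 3 0 rfl + hp 6 0 rfl
            | linear_combination hp 6 0 rfl + hp 12 0 rfl
            | linear_combination hw + hp 4 1 rfl + hp 8 2 rfl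
            | linear_combination hw + hp 5 2 rfl + hp 10 1 rfl
            | norm_num
        rw [hs]
        split_ifs <;> simp [h3]
      simp [hδ, M]
    rw [h]
    exact Submodule.sum_mem _ fun i _ => V.smul_mem _ (hq _)
  intro P hP
  rw [P.as_sum]
  refine Submodule.sum_mem _ fun d hd => ?_
  have hd3 : d 0 + d 1 + d 2 = 3 := by
    have := (mem_homogeneousSubmodule _ _).1 hP (mem_support_iff.1 hd)
    have e : d.degree = 3 := (DFunLike.congr_fun Finsupp.degree_eq_weight_one d).trans this
    rwa [Finsupp.degree_eq_sum, Fin.sum_univ_three] at e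
  have hmon : monomial d (coeff d P) = coeff d P • (X 0 ^ d 0 * X 1 ^ d 1 * X 2 ^ d 2) := by
    rw [monomial_eq, Finsupp.prod_fintype _ _ (fun i => pow_zero _), Fin.prod_univ_three,
      smul_eq_C_mul]
  rw [hmon]
  refine V.smul_mem _ ?_
  have c0 (j) : (X j ^ 3 : MvPolynomial (Fin 3) L) ∈ V := by simpa using hM 0 j
  have c1 (j) : (X j ^ 2 * X (j + 1) : MvPolynomial (Fin 3) L) ∈ V := by simpa using hM 1 j
  have c2 (j) : (X j * X (j + 1) ^ 2 : MvPolynomial (Fin 3) L) ∈ V := by simpa using hM 2 j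
  have c3 : (X 0 * X 1 * X 2 : MvPolynomial (Fin 3) L) ∈ V := hq (.inr ())
  generalize d 0 = a at hd3
  generalize d 1 = b at hd3
  generalize d 2 = c at hd3
  obtain rfl : c = 3 - a - b := by omega
  have ha : a ≤ 3 := by omega
  have hb : b ≤ 3 - a := by omega
  interval_cases a <;> interval_cases b <;> simp only [pow_zero, pow_one, one_mul, mul_one, Nat.sub_self, Nat.sub_zero, Nat.reduceSub]
  · exact c0 2
  · simpa [mul_comm] using c2 1
  · exact c1 1
  · exact c0 1
  · simpa [mul_comm] using c1 2
  · exact c3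
  · exact c2 0
  · simpa [mul_comm] using c2 2
  · exact c1 0
  · exact c0 0

/-- The forms have no common twisted rational zero, if the norm form does not represent `y`
times a cube. -/
theorem eq_zero_of_eval_form {x y ω : K} {α β : L} (hω : 1 + ω + ω ^ 2 = 0) (h3 : (3 : K) ≠ 0)
    (hx : α ^ 3 * algebraMap K L x = 1) (hy : β ^ 3 = algebraMap K L y)
    (hN : ∀ (u : Fin 3 → K) (e : K),
      u 0 ^ 3 + x * u 1 ^ 3 + x ^ 2 * u 2 ^ 3 - 3 * x * u 0 * u 1 * u 2 = y * e ^ 3 →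
        (∀ i, u i = 0) ∧ e = 0)
    (t : Fin 3 → L) {lam : L} (hl : lam ≠ 0) (c : (Fin 3 × Fin 3) ⊕ Unit → K)
    (h : ∀ n, eval t (form (algebraMap K L ω) α β n) = lam * algebraMap K L (c n)) : t = 0 := by
  set w := algebraMap K L ω with hwdef
  have hw : 1 + w + w ^ 2 = 0 := by
    rw [hwdef, ← map_one (algebraMap K L), ← map_pow, ← map_add, ← map_add, hω, map_zero]
  have hinj := (algebraMap K L).injective
  have hα : α ≠ 0 := by
    rintro rfl
    simp at hx
  have he : t 0 * t 1 * t 2 = lam * algebraMap K L (c (.inr ())) := by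
    rw [← h]; simp [form]
  -- The numbers `b i` are Fourier coefficients of `V`, scaled by `αⁱ`. Since `α³x = 1`, the norm
  -- form at `b` equals `27 V₀V₁V₂ = y(3e)³`, so `hN` is applied with `3e`.
  have key (b : Fin 3 → K) (e : K) (V : Fin 3 → L)
      (hb : ∀ i : Fin 3, α ^ (i : ℕ) * ∑ j : Fin 3, w ^ ((i : ℕ) * j) * V j = algebraMap K L (b i))
      (hV : V 0 * V 1 * V 2 = algebraMap K L (y * e ^ 3)) : (∀ i, b i = 0) ∧ e = 0 := by
    have := hN b (3 * e) (hinj ?_)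
    · exact ⟨this.1, (mul_eq_zero.1 this.2).resolve_left h3⟩
    have h0 := hb 0
    have h1 := hb 1
    have h2 := hb 2
    simp only [Fin.sum_univ_three] at h0 h1 h2
    norm_num at h0 h1 h2
    simp only [map_sub, map_add, map_mul, map_pow, map_ofNat] at hV ⊢
    rw [← h0, ← h1, ← h2]
    -- When `a`, `b`, `c` are the three Fourier sums of `V`, the factors are `3V₀`, `3V₂` and `3V₁`
    -- by inversion.
    have hprod (a b c : L) : a ^ 3 + b ^ 3 + c ^ 3 - 3 * a * b * c =
        (a + b + c) * (a + w * b + w ^ 2 * c) * (a + w ^ 2 * b + w * c) := by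
      linear_combination (-(a + b + c) * ((w - 1) * (b ^ 2 + c ^ 2) + a * b + a * c +
        (w ^ 2 - w + 1) * b * c)) * hw
    have e1 : (V 0 + V 1 + V 2) + (V 0 + w * V 1 + w ^ 2 * V 2) +
        (V 0 + w ^ 2 * V 1 + w ^ 4 * V 2) = 3 * V 0 := by
      linear_combination (V 1 + V 2 * (w ^ 2 - w + 1)) * hw
    have e2 : (V 0 + V 1 + V 2) + w * (V 0 + w * V 1 + w ^ 2 * V 2) +
        w ^ 2 * (V 0 + w ^ 2 * V 1 + w ^ 4 * V 2) = 3 * V 2 := by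
      linear_combination (V 0 + (w ^ 2 - w + 1) * V 1 + (w - 1) * (w ^ 3 + 2) * V 2) * hw
    have e3 : (V 0 + V 1 + V 2) + w ^ 2 * (V 0 + w * V 1 + w ^ 2 * V 2) +
        w * (V 0 + w ^ 2 * V 1 + w ^ 4 * V 2) = 3 * V 1 := by
      linear_combination (V 0 + 2 * (w - 1) * V 1 + (w ^ 3 - w + 1) * V 2) * hw
    have hp := hprod (V 0 + V 1 + V 2) (V 0 + w * V 1 + w ^ 2 * V 2)
      (V 0 + w ^ 2 * V 1 + w ^ 4 * V 2)
    rw [e1, e2, e3] at hp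
    generalize V 0 + w * V 1 + w ^ 2 * V 2 = B at hp ⊢
    generalize V 0 + w ^ 2 * V 1 + w ^ 4 * V 2 = D at hp ⊢
    linear_combination hp + 27 * hV + (B ^ 3 + D ^ 3 * (α ^ 3 * algebraMap K L x + 1)
      - 3 * (V 0 + V 1 + V 2) * B * D) * hx
  have hform (i m : Fin 3) : α ^ (i : ℕ) * ∑ j : Fin 3, w ^ ((i : ℕ) * j) *
      (β ^ (m : ℕ) * (t j ^ (3 - (m : ℕ)) * t (j + 1) ^ (m : ℕ)) / lam) =
      algebraMap K L (c (.inl (i, m))) := by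
    have := h (.inl (i, m))
    simp only [form, map_mul, map_sum, eval_C, map_pow, eval_X] at this
    rw [← mul_right_inj' hl, ← this, Finset.mul_sum, Finset.mul_sum, Finset.mul_sum]
    refine Finset.sum_congr rfl fun j _ => ?_
    field_simp
  -- For `m = 1` the product of the `Vⱼ` is `β³ (t₀t₁t₂/λ)³`, which is `y` times the cube of the
  -- rational value of the form `T₀T₁T₂`. Hence that value is zero.
  have h1 := key _ (c (.inr ())) _ (fun i => hform i 1) (by
    rw [map_mul, ← hy, map_pow, eq_div_of_mul_eq hl ((mul_comm _ _).trans he.symm)]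
    simp
    field_simp)
  rw [h1.2, map_zero, mul_zero] at he
  -- Now `t₀t₁t₂ = 0`, so for each `m` the product of the `Vⱼ` vanishes and `key` applies with `e =
  -- 0`.
  have h0 (m : Fin 3) := key _ 0 _ (fun i => hform i m) (by
    have e1 : β ^ (m : ℕ) * (t 0 ^ (3 - (m : ℕ)) * t (0 + 1) ^ (m : ℕ)) / lam *
        (β ^ (m : ℕ) * (t 1 ^ (3 - (m : ℕ)) * t (1 + 1) ^ (m : ℕ)) / lam) *
        (β ^ (m : ℕ) * (t 2 ^ (3 - (m : ℕ)) * t (2 + 1) ^ (m : ℕ)) / lam) =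
        (β ^ (m : ℕ) / lam) ^ 3 * ((t 0 * t 1 * t 2) ^ (3 - (m : ℕ)) * (t 0 * t 1 * t 2) ^ (m : ℕ)) := by
      change β ^ (m : ℕ) * (t 0 ^ (3 - (m : ℕ)) * t 1 ^ (m : ℕ)) / lam *
        (β ^ (m : ℕ) * (t 1 ^ (3 - (m : ℕ)) * t 2 ^ (m : ℕ)) / lam) *
        (β ^ (m : ℕ) * (t 2 ^ (3 - (m : ℕ)) * t 0 ^ (m : ℕ)) / lam) = _
      ring
    rw [e1, he, zero_pow (by omega)]
    simp)
  have hall (n) : eval t (form w α β n) = 0 := by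
    rw [h]
    rcases n with ⟨i, m⟩ | _
    · rw [(h0 m).1 i, map_zero, mul_zero]
    · rw [h1.2, map_zero, mul_zero]
  have h3' : (3 : L) ≠ 0 := by
    rw [← map_ofNat (algebraMap K L) 3]
    exact (map_ne_zero _).2 h3
  have hβ : β ≠ 0 := by
    rintro rfl
    have hy0 : y = 0 := hinj (by rw [← hy]; simp)
    exact one_ne_zero (hN 0 1 (by simp [hy0])).2
  -- All the forms vanish at `t`, and they span the cubics, among them `Tⱼ³`.
  have hj (j : Fin 3) : t j ^ 3 = 0 := by
    have hs : (X j ^ 3 : MvPolynomial (Fin 3) L) ∈ Submodule.span L (Set.range (form w α β)) :=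
      homogeneousSubmodule_le_span_form hw h3' hα hβ
        ((mem_homogeneousSubmodule _ _).2 (by simpa using (isHomogeneous_X L j).pow 3))
    have hker : Submodule.span L (Set.range (form w α β)) ≤ LinearMap.ker (aeval t).toLinearMap := by
      rw [Submodule.span_le]
      rintro _ ⟨n, rfl⟩
      exact hall n
    simpa using hker hs
  ext j
  exact pow_eq_zero_iff (by norm_num) |>.1 (hj j)

end TwistedCubic

/-! ### Ring homomorphisms scaling the degree and morphisms between `Proj`s -/

namespace HomogeneousLocalization

variable {A B σ τ : Type*} [CommRing A] [SetLike σ A] [AddSubgroupClass σ A]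
  [CommRing B] [SetLike τ B] [AddSubgroupClass τ B]
  {𝒜 : ℕ → σ} {ℬ : ℕ → τ} [GradedRing 𝒜] [GradedRing ℬ]
  (φ : A →+* B) (c : ℕ) (hφ : ∀ n, ∀ a ∈ 𝒜 n, φ a ∈ ℬ (c * n))

/-- The underlying function of `HomogeneousLocalization.mapScale`. -/
def mapScaleFun {P : Submonoid A} {Q : Submonoid B} (h : P ≤ Q.comap φ) :
    HomogeneousLocalization 𝒜 P → HomogeneousLocalization ℬ Q :=
  Quotient.map'
    (fun x => ⟨c * x.1, ⟨_, hφ _ _ x.2.2⟩, ⟨_, hφ _ _ x.3.2⟩, h x.4⟩)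
    fun x y (e : x.embedding = y.embedding) => by
      apply_fun IsLocalization.map (Localization Q) φ h at e
      simp_rw [HomogeneousLocalization.NumDenSameDeg.embedding, Localization.mk_eq_mk',
        IsLocalization.map_mk', ← Localization.mk_eq_mk'] at e
      exact e

omit [AddSubgroupClass σ A] [AddSubgroupClass τ B] [GradedRing 𝒜] [GradedRing ℬ] in
theorem val_mapScaleFun {P : Submonoid A} {Q : Submonoid B} (h : P ≤ Q.comap φ)
    (x : HomogeneousLocalization 𝒜 P) :
    (mapScaleFun φ c hφ h x : HomogeneousLocalization ℬ Q).val =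
      IsLocalization.map (Localization Q) φ h x.val := by
  obtain ⟨x, rfl⟩ := mk_surjective x
  rw [val_mk, Localization.mk_eq_mk', IsLocalization.map_mk', ← Localization.mk_eq_mk']
  rfl

/-- The map between homogeneous localizations induced by a ring homomorphism that multiplies
degrees by `c`. -/
def mapScale {P : Submonoid A} {Q : Submonoid B} (h : P ≤ Q.comap φ) :
    HomogeneousLocalization 𝒜 P →+* HomogeneousLocalization ℬ Q where
  toFun := mapScaleFun φ c hφ h
  map_add' x y := val_injective _ (by simp only [val_mapScaleFun, val_add, map_add])
  map_mul' x y := val_injective _ (by simp only [val_mapScaleFun, val_mul, map_mul])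
  map_zero' := val_injective _ (by simp only [val_mapScaleFun, val_zero, map_zero])
  map_one' := val_injective _ (by simp only [val_mapScaleFun, val_one, map_one])

theorem val_mapScale {P : Submonoid A} {Q : Submonoid B} (h : P ≤ Q.comap φ)
    (x : HomogeneousLocalization 𝒜 P) :
    (mapScale φ c hφ h x : HomogeneousLocalization ℬ Q).val =
      IsLocalization.map (Localization Q) φ h x.val :=
  val_mapScaleFun φ c hφ h x

theorem powers_le_comap_powers {s : A} {t : B} (h : φ s = t) :
    Submonoid.powers s ≤ (Submonoid.powers t).comap φ := by
  rw [Submonoid.powers_le, Submonoid.mem_comap, h]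
  exact Submonoid.mem_powers t

/-- The map between homogeneous localizations away from an element induced by a ring homomorphism
that multiplies degrees by `c`. -/
abbrev awayMapScale (s : A) (t : B) (h : φ s = t) : Away 𝒜 s →+* Away ℬ t :=
  mapScale φ c hφ (powers_le_comap_powers φ h)

/-- Compatibility of the chart maps with restriction to overlaps, the cocycle condition for gluing.
-/
theorem awayMapScale_comp_awayMap {s s' x : A} {t t' z : B} (h : φ s = t) (h' : φ s' = t')
    {d d' : ℕ} (hs' : s' ∈ 𝒜 d) (ht' : t' ∈ ℬ d') (hx : x = s * s') (hz : z = t * t') :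
    (awayMap ℬ ht' hz).comp (awayMapScale (𝒜 := 𝒜) φ c hφ s t h) =
      (awayMapScale φ c hφ x z (by rw [hx, hz, map_mul, h, h'])).comp (awayMap 𝒜 hs' hx) := by
  ext a
  simp only [RingHom.comp_apply, val_awayMap, val_mapScale]
  generalize a.val = b
  simp only [← RingHom.comp_apply]
  congr 1
  refine IsLocalization.ringHom_ext (Submonoid.powers s) (RingHom.ext fun b => ?_)
  simp [Localization.awayLift]

end HomogeneousLocalization

namespace AlgebraicGeometry.Proj

open HomogeneousLocalization

universe u

/-- The affine open cover of `Proj` by the charts of homogeneous elements `t i`, if the open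
subsets `D₊(t i)` cover. -/
def affineOpenCoverOfISup {A : Type u} {σ : Type*} [CommRing A] [SetLike σ A]
    [AddSubgroupClass σ A] (𝒜 : ℕ → σ) [GradedRing 𝒜] {ι : Type} (t : ι → A) {e : ℕ} (he : 0 < e)
    (ht : ∀ i, t i ∈ 𝒜 e) (hcov : ⨆ i, basicOpen 𝒜 (t i) = ⊤) : (Proj 𝒜).AffineOpenCover where
  I₀ := ι
  X i := .of (Away 𝒜 (t i))
  f i := awayι 𝒜 (t i) (ht i) he
  idx x := (TopologicalSpace.Opens.mem_iSup.mp (hcov.ge (Set.mem_univ x))).choose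
  covers x := by
    change x ∈ (awayι 𝒜 _ _ _).opensRange
    rw [opensRange_awayι]
    exact (TopologicalSpace.Opens.mem_iSup.mp (hcov.ge (Set.mem_univ x))).choose_spec

variable {A B : Type u} {σ τ : Type*} [CommRing A] [SetLike σ A] [AddSubgroupClass σ A]
  [CommRing B] [SetLike τ B] [AddSubgroupClass τ B]
  {𝒜 : ℕ → σ} {ℬ : ℕ → τ} [GradedRing 𝒜] [GradedRing ℬ]
  (φ : A →+* B) (c : ℕ) (hφ : ∀ n, ∀ a ∈ 𝒜 n, φ a ∈ ℬ (c * n))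

/-- A morphism between `Proj`s from a ring homomorphism multiplying degrees by `c`, glued from
the charts given by a family of homogeneous elements. -/
theorem exists_hom_of_scale {ι : Type} (s : ι → A) (t : ι → B) (h : ∀ i, φ (s i) = t i)
    {d e : ℕ} (hd : 0 < d) (he : 0 < e) (hs : ∀ i, s i ∈ 𝒜 d) (ht : ∀ i, t i ∈ ℬ e)
    (hcov : ⨆ i, basicOpen ℬ (t i) = ⊤) :
    ∃ g : Proj ℬ ⟶ Proj 𝒜, ∀ i, awayι ℬ (t i) (ht i) he ≫ g =
      Spec.map (CommRingCat.ofHom (awayMapScale φ c hφ (s i) (t i) (h i))) ≫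
        awayι 𝒜 (s i) (hs i) hd := by
  let 𝒰 := affineOpenCoverOfISup ℬ t he ht hcov
  let gi (i : ι) : Spec (.of (Away ℬ (t i))) ⟶ Proj 𝒜 :=
    Spec.map (CommRingCat.ofHom (awayMapScale φ c hφ (s i) (t i) (h i))) ≫
        awayι 𝒜 (s i) (hs i) hd
  refine ⟨𝒰.openCover.glueMorphisms gi fun i j => ?_, fun i => 𝒰.openCover.ι_glueMorphisms gi _ i⟩
  change pullback.fst (awayι ℬ (t i) (ht i) he) (awayι ℬ (t j) (ht j) he) ≫ gi i =
    pullback.snd (awayι ℬ (t i) (ht i) he) (awayι ℬ (t j) (ht j) he) ≫ gi j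
  -- The overlap of two charts is the chart of the product `t i * t j`, where both morphisms come
  -- from the chart of `s i * s j`.
  rw [← pullbackAwayιIso_hom_SpecMap_awayMap_left ℬ (ht i) he (ht j) he rfl,
    ← pullbackAwayιIso_hom_SpecMap_awayMap_right ℬ (ht i) he (ht j) he rfl]
  simp only [Category.assoc, gi]
  congr 1
  rw [← Spec.map_comp_assoc, ← Spec.map_comp_assoc, ← CommRingCat.ofHom_comp,
    ← CommRingCat.ofHom_comp,
    awayMapScale_comp_awayMap φ c hφ (h i) (h j) (hs j) (ht j) rfl rfl,
    awayMapScale_comp_awayMap φ c hφ (h j) (h i) (hs i) (ht i) (mul_comm (s i) (s j))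
      (mul_comm (t i) (t j))]
  rw [CommRingCat.ofHom_comp, CommRingCat.ofHom_comp, Spec.map_comp_assoc, Spec.map_comp_assoc,
    SpecMap_awayMap_awayι 𝒜 (hs i) hd (hs j) rfl,
    SpecMap_awayMap_awayι 𝒜 (hs j) hd (hs i) (mul_comm (s i) (s j))]

end AlgebraicGeometry.Proj

/-! ### Descent of linear independence along a Galois extension -/

/-- Vectors that are linearly independent over `K` and fixed by semilinear lifts of all
automorphisms of the Galois extension `L` of `K` are linearly independent over `L`. -/
theorem LinearIndependent.of_semilinear_fixed {K L V ι : Type*} [Field K] [Field L] [Algebra K L]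
    [IsGalois K L] [AddCommGroup V] [Module K V] [Module L V] [IsScalarTower K L V] {v : ι → V}
    (hv : LinearIndependent K v)
    (hfix : ∀ s : L ≃ₐ[K] L, ∃ Θ : V →+ V, (∀ (l : L) (w : V), Θ (l • w) = s l • Θ w) ∧
      ∀ i, Θ (v i) = v i) : LinearIndependent L v := by
  classical
  rw [linearIndependent_iff]
  -- Artin's argument, by induction on the length of a relation.
  suffices h : ∀ (n : ℕ) (l : ι →₀ L), l.support.card ≤ n → Finsupp.linearCombination L v l = 0 →
      l = 0 from fun l hl => h _ l le_rfl hl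
  intro n
  induction n with
  | zero => intro l hl _; simpa using hl
  | succ n ih =>
    intro l hl h0
    by_contra hne
    obtain ⟨i, hi⟩ := Finsupp.support_nonempty_iff.2 hne
    have hli := Finsupp.mem_support_iff.1 hi
    set l' : ι →₀ L := (l i)⁻¹ • l with hl'
    have hl'i : l' i = 1 := by simp [hl', hli]
    have h0' : Finsupp.linearCombination L v l' = 0 := by rw [hl', map_smul, h0, smul_zero]
    have hfixed (j : ι) (s : L ≃ₐ[K] L) : s (l' j) = l' j := by
      obtain ⟨Θ, hΘ, hΘv⟩ := hfix s
      -- Applying `Θ` to the relation normalised at `i` and subtracting kills the term at `i`. The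
      -- shorter relation is trivial, so every coefficient is fixed by `s`.
      set m : ι →₀ L := l'.mapRange s (map_zero s) - l' with hm
      have hm0 : m = 0 := by
        apply ih
        · have hsub : m.support ⊆ l.support.erase i := by
            intro j hj
            rw [Finset.mem_erase]
            rw [Finsupp.mem_support_iff] at hj
            constructor
            · rintro rfl
              simp [hm, hl'i] at hj
            · rw [Finsupp.mem_support_iff]
              intro hj0
              simp [hm, hl', hj0] at hj
          have := Finset.card_le_card hsub
          rw [Finset.card_erase_of_mem hi] at this
          omega
        · rw [hm, map_sub, h0', sub_zero]
          have e := congrArg Θ h0'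
          rw [map_zero, Finsupp.linearCombination_apply, Finsupp.sum, map_sum] at e
          simp only [hΘ, hΘv] at e
          rw [Finsupp.linearCombination_apply, Finsupp.sum_mapRange_index (by simp)]
          exact e
      have := DFunLike.congr_fun hm0 j
      simpa [hm, sub_eq_zero] using this
    choose k hk using fun j => (InfiniteGalois.mem_range_algebraMap_iff_fixed (k := K) (l' j)).2
      (hfixed j)
    have hK : ∀ j, j ∈ l'.support → k j = 0 := by
      refine (linearIndependent_iff'.1 hv) l'.support k ?_
      rw [← h0', Finsupp.linearCombination_apply, Finsupp.sum]
      refine Finset.sum_congr rfl fun j _ => ?_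
      rw [← hk j, algebraMap_smul]
    have := hk i
    rw [hK i (by simp [hl'i]), hl'i, map_zero] at this
    exact zero_ne_one this

open scoped TensorProduct in
/-- A criterion for a square of rings over a Galois extension of fields to be a pushout. -/
theorem isPushout_of_semilinear_fixed {K L C B V : Type*} [Field K] [Field L] [Algebra K L]
    [IsGalois K L] [CommRing C] [CommRing B] [Algebra K C] [Algebra C B] [Algebra L B] [Algebra K B]
    [IsScalarTower K C B] [IsScalarTower K L B] [AddCommGroup V] [Module K V] [Module L V]
    [IsScalarTower K L V] (f : B →ₗ[L] V) (hf : Function.Injective f)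
    (hinj : Function.Injective (algebraMap C B))
    (hspan : ∀ b : B, b ∈ Submodule.span L (Set.range (algebraMap C B)))
    (hfix : ∀ s : L ≃ₐ[K] L, ∃ Θ : V →+ V, (∀ (l : L) (w : V), Θ (l • w) = s l • Θ w) ∧
      ∀ x : C, Θ (f (algebraMap C B x)) = f (algebraMap C B x)) : Algebra.IsPushout K L C B := by
  refine ⟨IsBaseChange.of_equiv (LinearEquiv.ofBijective
    ((IsScalarTower.toAlgHom K C B).toLinearMap.liftBaseChange L) ⟨?_, fun b => ?_⟩) fun x => ?_⟩
  -- Injectivity: a `K`-basis of `C` maps to invariant vectors of `V` independent over `K`, hence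
  -- independent over `L`. Only `V` need carry the semilinear maps, not `B`.
  · let b := Module.Free.chooseBasis K C
    have h1 : LinearIndependent K fun i => f (algebraMap C B (b i)) := by
      have := b.linearIndependent.map' ((f.restrictScalars K) ∘ₗ
        (IsScalarTower.toAlgHom K C B).toLinearMap) (LinearMap.ker_eq_bot.2 (hf.comp hinj))
      exact this
    have h2 : LinearIndependent L fun i => f (algebraMap C B (b i)) :=
      h1.of_semilinear_fixed fun s => (hfix s).imp fun Θ h => ⟨h.1, fun i => h.2 _⟩
    have h3 : LinearIndependent L fun i => algebraMap C B (b i) := h2.of_comp f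
    rw [← LinearMap.ker_eq_bot, LinearMap.ker_eq_bot']
    intro m hm
    have h4 : Finsupp.linearCombination L (fun i => algebraMap C B (b i))
        ((b.baseChange L).repr m) = 0 := by
      rw [← hm]
      conv_rhs => rw [← (b.baseChange L).linearCombination_repr m]
      rw [Finsupp.apply_linearCombination]
      congr 2
      ext i
      simp
    have h5 := (linearIndependent_iff.1 h3) _ h4
    exact (LinearEquiv.map_eq_zero_iff _).1 h5
  · rw [← LinearMap.mem_range]
    refine Submodule.span_le.2 ?_ (hspan b)
    rintro _ ⟨x, rfl⟩
    exact ⟨1 ⊗ₜ x, by simp⟩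
  · change (IsScalarTower.toAlgHom K C B).toLinearMap.liftBaseChange L (1 ⊗ₜ[K] x) = _
    simp

universe u in
/-- A criterion for a square of rings over a Galois extension of fields to be a pushout, in terms
of ring homomorphisms. -/
theorem CommRingCat.isPushout_of_semilinear_fixed {K L C B V : Type u} [Field K] [Field L]
    [Algebra K L] [IsGalois K L] [CommRing C] [CommRing B] [CommRing V] (k : K →+* C) (i : C →+* B)
    (j : L →+* B) (f : B →+* V) (hcomm : ∀ a, i (k a) = j (algebraMap K L a))
    (hf : Function.Injective f) (hi : Function.Injective i)
    (hspan : ∀ b : B, ∃ (m : ℕ) (l : Fin m → L) (x : Fin m → C), b = ∑ r, j (l r) * i (x r))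
    (hfix : ∀ s : L ≃ₐ[K] L, ∃ Θ : V →+* V, (∀ l, Θ (f (j l)) = f (j (s l))) ∧
      ∀ x, Θ (f (i x)) = f (i x)) :
    IsPushout (CommRingCat.ofHom k) (CommRingCat.ofHom (algebraMap K L))
      (CommRingCat.ofHom i) (CommRingCat.ofHom j) := by
  let _ : Algebra K C := k.toAlgebra
  let _ : Algebra C B := i.toAlgebra
  let _ : Algebra L B := j.toAlgebra
  let _ : Algebra K B := (j.comp (algebraMap K L)).toAlgebra
  let _ : Algebra L V := (f.comp j).toAlgebra
  let _ : Algebra K V := ((f.comp j).comp (algebraMap K L)).toAlgebra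
  have : IsScalarTower K C B := IsScalarTower.of_algebraMap_eq fun a => (hcomm a).symm
  have : IsScalarTower K L B := IsScalarTower.of_algebraMap_eq fun a => rfl
  have : IsScalarTower K L V := IsScalarTower.of_algebraMap_eq fun a => rfl
  let fL : B →ₗ[L] V :=
    { f with map_smul' := fun l b => f.map_mul _ _ }
  have : Algebra.IsPushout K L C B := by
    refine _root_.isPushout_of_semilinear_fixed fL hf hi (fun b => ?_) fun s => ?_
    · obtain ⟨m, l, x, rfl⟩ := hspan b
      exact Submodule.sum_mem _ fun r _ => Submodule.smul_mem _ (l r)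
        (Submodule.subset_span ⟨x r, rfl⟩)
    · obtain ⟨Θ, h1, h2⟩ := hfix s
      refine ⟨Θ, fun l w => ?_, h2⟩
      change Θ (f (j l) * w) = f (j (s l)) * Θ w
      rw [map_mul, h1]
  exact (CommRingCat.isPushout_of_isPushout K L C B).flip

attribute [local instance] MvPolynomial.gradedAlgebra

/-! ### The morphism of projective spaces given by forms of the same degree -/

namespace ProjForms

open MvPolynomial HomogeneousLocalization

universe u

theorem X_mem {σ K : Type*} [Field K] (i : σ) : X i ∈ homogeneousSubmodule σ K 1 :=
  isHomogeneous_X K i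

/-- The constants in a chart of projective space. -/
def chartConst (n : ℕ) (K : Type u) [Field K] (t : MvPolynomial (Fin (n + 1)) K) :
    K →+* Away (homogeneousSubmodule (Fin (n + 1)) K) t :=
  (fromZeroRingHom _ _).comp (algebraMap K (homogeneousSubmodule (Fin (n + 1)) K 0))

theorem val_chartConst (n : ℕ) (K : Type u) [Field K] (t : MvPolynomial (Fin (n + 1)) K) (a : K) :
    (chartConst n K t a).val = algebraMap (MvPolynomial (Fin (n + 1)) K) _ (C a) :=
  rfl

/-- The structure morphism of projective space, with source written as `Proj`. -/
def structHom (n : ℕ) (K : Type u) [Field K] :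
    Proj (homogeneousSubmodule (Fin (n + 1)) K) ⟶ Spec (.of K) :=
  Proj.toSpecZero _ ≫
    Spec.map (CommRingCat.ofHom (algebraMap K (homogeneousSubmodule (Fin (n + 1)) K 0)))

theorem awayι_structHom (n : ℕ) (K : Type u) [Field K] (t : MvPolynomial (Fin (n + 1)) K)
    {d : ℕ} (ht : t ∈ homogeneousSubmodule (Fin (n + 1)) K d) (hd : 0 < d) :
    Proj.awayι _ t ht hd ≫ structHom n K = Spec.map (CommRingCat.ofHom (chartConst n K t)) := by
  rw [structHom, Proj.awayι_toSpecZero_assoc, ← Spec.map_comp, ← CommRingCat.ofHom_comp]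
  rfl

variable {K L : Type u} [Field K] [Field L] [Algebra K L] {N n : ℕ}
  (q : Fin (N + 1) → MvPolynomial (Fin (n + 1)) L) {c : ℕ}

/-- The substitution of forms over `L` into polynomials over `K`. -/
def formMap (K : Type u) [Field K] [Algebra K L] :
    MvPolynomial (Fin (N + 1)) K →+* MvPolynomial (Fin (n + 1)) L :=
  eval₂Hom (C.comp (algebraMap K L)) q

variable {q}

theorem formMap_X (i) : formMap q K (X i) = q i := by simp [formMap]

theorem formMap_C (a : K) : formMap q K (C a) = C (algebraMap K L a) := by simp [formMap]

theorem formMap_mem (hq : ∀ i, q i ∈ homogeneousSubmodule (Fin (n + 1)) L c) (m : ℕ)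
    (a : MvPolynomial (Fin (N + 1)) K) (ha : a ∈ homogeneousSubmodule (Fin (N + 1)) K m) :
    formMap q K a ∈ homogeneousSubmodule (Fin (n + 1)) L (c * m) := by
  have := IsHomogeneous.eval₂ (m := m) (n := c) ha (C.comp (algebraMap K L)) q
    (fun a => isHomogeneous_C _ _) hq
  exact this

/-- Forms of degree `cm` are sums of products of `m` forms of degree `c`, and each of those is a
combination of the `q i`. -/
theorem homogeneousSubmodule_le_span_formMap
    (hspan : homogeneousSubmodule (Fin (n + 1)) L c ≤ Submodule.span L (Set.range q)) (m : ℕ) :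
    homogeneousSubmodule (Fin (n + 1)) L (c * m) ≤
      Submodule.span L (formMap q K '' homogeneousSubmodule (Fin (N + 1)) K m) := by
  have h : homogeneousSubmodule (Fin (n + 1)) L (c * m) =
      homogeneousSubmodule (Fin (n + 1)) L c ^ m := by
    rw [← homogeneousSubmodule_one_pow _ (n := c * m), ← homogeneousSubmodule_one_pow _ (n := c),
      pow_mul]
  rw [h]
  clear h
  induction m with
  | zero =>
    rw [pow_zero, Submodule.one_eq_span, Submodule.span_le, Set.singleton_subset_iff]
    exact Submodule.subset_span ⟨1, isHomogeneous_one _ _, map_one _⟩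
  | succ m ih =>
    rw [pow_succ]
    refine (mul_le_mul' ih hspan).trans ?_
    rw [Submodule.span_mul_span]
    refine Submodule.span_mono ?_
    rintro _ ⟨_, ⟨a, ha, rfl⟩, _, ⟨i, rfl⟩, rfl⟩
    refine ⟨a * X i, IsHomogeneous.mul ha (isHomogeneous_X _ _), ?_⟩
    simp [formMap_X]

/-- The map of charts induced by forms of degree `c`. -/
abbrev chartMap (hq : ∀ i, q i ∈ homogeneousSubmodule (Fin (n + 1)) L c) (i : Fin (N + 1)) :
    Away (homogeneousSubmodule (Fin (N + 1)) K) (X i) →+*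
      Away (homogeneousSubmodule (Fin (n + 1)) L) (q i) :=
  awayMapScale (formMap q K) c (formMap_mem hq) (X i) (q i) (formMap_X i)

theorem chartMap_chartConst (hq : ∀ i, q i ∈ homogeneousSubmodule (Fin (n + 1)) L c) (i : Fin (N + 1)) (a : K) :
    chartMap hq i (chartConst N K (X i) a) = chartConst n L (q i) (algebraMap K L a) := by
  refine val_injective _ ?_
  rw [val_mapScale, val_chartConst, IsLocalization.map_eq, formMap_C, val_chartConst]

theorem chartMap_mk (hq : ∀ i, q i ∈ homogeneousSubmodule (Fin (n + 1)) L c) (i : Fin (N + 1)) (m : ℕ)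
    (a : MvPolynomial (Fin (N + 1)) K) (ha) :
    chartMap hq i (Away.mk _ (X_mem i) m a ha) =
      Away.mk (homogeneousSubmodule (Fin (n + 1)) L) (hq i) m (formMap q K a) (by
        have := formMap_mem hq _ a ha
        simpa [mul_comm] using this) := by
  refine val_injective _ ?_
  rw [val_mapScale, Away.val_mk, Away.val_mk, Localization.mk_eq_mk', IsLocalization.map_mk',
    ← Localization.mk_eq_mk']
  congr 2
  simp [formMap_X]

/-- The chart ring of the image is generated over `K` by the quotients `q j / q i`. These span the
chart ring of projective space over `L`, and they are fixed by the semilinear maps `Θ` extended to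
the localization, so the descent criterion applies. -/
theorem isPushout_chart [IsGalois K L] (hq : ∀ i, q i ∈ homogeneousSubmodule (Fin (n + 1)) L c)
    (hspan : homogeneousSubmodule (Fin (n + 1)) L c ≤ Submodule.span L (Set.range q))
    (hfix : ∀ s : L ≃ₐ[K] L, ∃ Θ : MvPolynomial (Fin (n + 1)) L →+* MvPolynomial (Fin (n + 1)) L,
      (∀ a, Θ (C a) = C (s a)) ∧ ∀ i, Θ (q i) = q i) (i : Fin (N + 1)) :
    IsPushout
      (CommRingCat.ofHom (((chartMap (K := K) hq i).rangeRestrict).comp (chartConst N K (X i))))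
      (CommRingCat.ofHom (algebraMap K L))
      (CommRingCat.ofHom (chartMap (K := K) hq i).range.subtype)
      (CommRingCat.ofHom (chartConst n L (q i))) := by
  set ψ := chartMap (K := K) hq i with hψ
  refine CommRingCat.isPushout_of_semilinear_fixed _ _ _
    (algebraMap _ (Localization.Away (q i))) (chartMap_chartConst hq i) (val_injective _)
    Subtype.val_injective ?_ ?_
  · intro b
    obtain ⟨m, a, ha, rfl⟩ := Away.mk_surjective _ (hq i) b
    have ha' : a ∈ homogeneousSubmodule (Fin (n + 1)) L (c * m) := by
      rwa [mul_comm]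
    obtain ⟨r, l, x, hx⟩ := Submodule.mem_span_set'.1
      (homogeneousSubmodule_le_span_formMap (K := K) hspan m ha')
    choose p hp hpx using fun k => (x k).2
    refine ⟨r, l, fun k => ⟨ψ (Away.mk _ (X_mem i) m
      (p k) (by simpa using hp k)), _, rfl⟩, ?_⟩
    refine val_injective _ ?_
    rw [← HomogeneousLocalization.algebraMap_apply, ← HomogeneousLocalization.algebraMap_apply,
      map_sum]
    simp only [map_mul, Subring.subtype_apply, hψ, chartMap_mk,
      HomogeneousLocalization.algebraMap_apply, val_chartConst,
      Away.val_mk, ← hx, hpx, Localization.mk_eq_mk']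
    rw [IsLocalization.mk'_eq_mul_mk'_one, map_sum, Finset.sum_mul]
    refine Finset.sum_congr rfl fun k _ => ?_
    rw [smul_eq_C_mul, map_mul, mul_assoc, ← IsLocalization.mk'_eq_mul_mk'_one]
  · intro s
    obtain ⟨Θ, hΘ, hΘq⟩ := hfix s
    have hle : Submonoid.powers (q i) ≤ (Submonoid.powers (q i)).comap Θ :=
      powers_le_comap_powers Θ (hΘq i)
    refine ⟨IsLocalization.map (Localization.Away (q i)) Θ hle, fun l => ?_, ?_⟩
    · rw [HomogeneousLocalization.algebraMap_apply, HomogeneousLocalization.algebraMap_apply,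
        val_chartConst, val_chartConst,
        IsLocalization.map_eq, hΘ]
    · rintro ⟨_, x, rfl⟩
      change IsLocalization.map (Localization.Away (q i)) Θ hle (ψ x).val = (ψ x).val
      rw [val_mapScale]
      generalize x.val = z
      rw [← RingHom.comp_apply]
      congr 1
      refine IsLocalization.ringHom_ext (Submonoid.powers (X i : MvPolynomial (Fin (N + 1)) K)) ?_
      refine MvPolynomial.ringHom_ext (fun a => ?_) fun k => ?_
      · simp [formMap_C, hΘ]
      · simp [formMap_X, hΘq]

end ProjForms

/-! ### The morphism given by the forms, and its preimages of charts. -/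

namespace ProjForms

open MvPolynomial HomogeneousLocalization

universe u

theorem iSup_basicOpen_X (n : ℕ) (K : Type u) [Field K] :
    ⨆ i, Proj.basicOpen (homogeneousSubmodule (Fin (n + 1)) K) (X i) = ⊤ := by
  refine Proj.iSup_basicOpen_eq_top' _ _ (fun i => ⟨1, isHomogeneous_X K i⟩) ?_
  rw [eq_top_iff]
  rintro p -
  induction p using MvPolynomial.induction_on with
  | C a =>
    exact Subalgebra.algebraMap_mem _ (⟨C a, isHomogeneous_C _ _⟩ : homogeneousSubmodule (Fin (n + 1)) K 0)
  | add p q hp hq => exact add_mem hp hq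
  | mul_X p i hp => exact mul_mem hp (Algebra.subset_adjoin ⟨i, rfl⟩)

variable {K L : Type u} [Field K] [Field L] [Algebra K L] {N n : ℕ}
  {q : Fin (N + 1) → MvPolynomial (Fin (n + 1)) L} {c : ℕ}

/-- A common zero of the `q i` would be a zero of every `X j ^ c`, hence of every `X j`. -/
theorem iSup_basicOpen_forms
    (hspan : homogeneousSubmodule (Fin (n + 1)) L c ≤ Submodule.span L (Set.range q)) :
    ⨆ i, Proj.basicOpen (homogeneousSubmodule (Fin (n + 1)) L) (q i) = ⊤ := by
  refine top_le_iff.mp fun x hx => TopologicalSpace.Opens.mem_iSup.mpr ?_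
  by_contra! H
  simp only [Proj.mem_basicOpen] at H
  obtain ⟨j, hj⟩ := TopologicalSpace.Opens.mem_iSup.mp ((iSup_basicOpen_X n L).ge hx)
  refine hj (x.isPrime.mem_of_pow_mem c ?_)
  have h1 : (X j ^ c : MvPolynomial (Fin (n + 1)) L) ∈ Submodule.span L (Set.range q) :=
    hspan (by simpa using (isHomogeneous_X L j).pow c)
  have h2 : Submodule.span L (Set.range q) ≤ x.asHomogeneousIdeal.toIdeal.restrictScalars L := by
    rw [Submodule.span_le]
    rintro _ ⟨i, rfl⟩
    exact not_not.1 (H i)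
  exact h2 h1

theorem exists_hom (hq : ∀ i, q i ∈ homogeneousSubmodule (Fin (n + 1)) L c) (hc : 0 < c)
    (hspan : homogeneousSubmodule (Fin (n + 1)) L c ≤ Submodule.span L (Set.range q)) :
    ∃ g : Proj (homogeneousSubmodule (Fin (n + 1)) L) ⟶ Proj (homogeneousSubmodule (Fin (N + 1)) K),
      ∀ i, Proj.awayι _ (q i) (hq i) hc ≫ g =
        Spec.map (CommRingCat.ofHom (chartMap (K := K) hq i)) ≫
          Proj.awayι _ (X i) (X_mem i) one_pos :=
  Proj.exists_hom_of_scale (formMap q K) c (formMap_mem hq) X q formMap_X one_pos hc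
    X_mem hq (iSup_basicOpen_forms hspan)

variable {hq : ∀ i, q i ∈ homogeneousSubmodule (Fin (n + 1)) L c} {hc : 0 < c}
  {g : Proj (homogeneousSubmodule (Fin (n + 1)) L) ⟶ Proj (homogeneousSubmodule (Fin (N + 1)) K)}

theorem hom_structHom
    (hspan : homogeneousSubmodule (Fin (n + 1)) L c ≤ Submodule.span L (Set.range q))
    (hg : ∀ i, Proj.awayι _ (q i) (hq i) hc ≫ g =
        Spec.map (CommRingCat.ofHom (chartMap (K := K) hq i)) ≫
          Proj.awayι _ (X i) (X_mem i) one_pos) :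
    g ≫ structHom N K = structHom n L ≫ Spec.map (CommRingCat.ofHom (algebraMap K L)) := by
  refine (Proj.affineOpenCoverOfISup _ q hc hq (iSup_basicOpen_forms hspan)).openCover.hom_ext _ _
    fun (i : Fin (N + 1)) => ?_
  change Proj.awayι _ (q i) (hq i) hc ≫ g ≫ structHom N K =
    Proj.awayι _ (q i) (hq i) hc ≫ structHom n L ≫ _
  rw [reassoc_of% (hg i), awayι_structHom, reassoc_of% (awayι_structHom n L (q i) (hq i) hc),
    ← Spec.map_comp, ← Spec.map_comp, ← CommRingCat.ofHom_comp, ← CommRingCat.ofHom_comp]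
  congr 2
  exact RingHom.ext (chartMap_chartConst hq i)

theorem hom_preimage_basicOpen
    (hspan : homogeneousSubmodule (Fin (n + 1)) L c ≤ Submodule.span L (Set.range q))
    (hg : ∀ i, Proj.awayι _ (q i) (hq i) hc ≫ g =
        Spec.map (CommRingCat.ofHom (chartMap (K := K) hq i)) ≫
          Proj.awayι _ (X i) (X_mem i) one_pos) (i : Fin (N + 1)) :
    g ⁻¹ᵁ Proj.basicOpen _ (X i) = Proj.basicOpen _ (q i) := by
  have hpre (j : Fin (N + 1)) : Proj.awayι _ (q j) (hq j) hc ⁻¹ᵁ g ⁻¹ᵁ Proj.basicOpen _ (X i) =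
      Proj.awayι _ (q j) (hq j) hc ⁻¹ᵁ Proj.basicOpen _ (q i) := by
    rw [← Scheme.Hom.comp_preimage, hg, Scheme.Hom.comp_preimage,
      Proj.awayι_preimage_basicOpen _ (X_mem j) one_pos (X_mem i) one_pos,
      Proj.awayι_preimage_basicOpen _ (hq j) hc (hq i) hc]
    ext y
    change chartMap hq j _ ∉ y.asIdeal ↔ _ ∉ y.asIdeal
    -- The standard element is `q i ^ c / q j ^ c` on the left and comes from `X i / X j` on the
    -- right, since the `q` have degree `c` and the `X` degree 1.
    have e : Away.isLocalizationElem (hq j) (hq i) = (chartMap hq j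
        (Away.isLocalizationElem (X_mem (K := K) j) (X_mem (K := K) i))) ^ c := by
      refine val_injective _ ?_
      rw [Away.isLocalizationElem, Away.isLocalizationElem, chartMap_mk, val_pow, Away.val_mk,
        Away.val_mk, Localization.mk_pow]
      congr 1
      · simp [formMap_X]
      · ext; simp
    rw [e, y.isPrime.pow_mem_iff_mem c hc]
  ext x
  obtain ⟨j, hj⟩ := TopologicalSpace.Opens.mem_iSup.mp ((iSup_basicOpen_forms hspan).ge (Set.mem_univ x))
  rw [← Proj.opensRange_awayι _ (q j) (hq j) hc] at hj
  obtain ⟨y, rfl⟩ := hj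
  exact SetLike.ext_iff.1 (hpre j) y

/-- Sections over a basic open subset, as an isomorphism written with the chart. -/
instance isIso_awayι_appLE {A : Type u} {σ : Type*} [CommRing A] [SetLike σ A]
    [AddSubgroupClass σ A] (𝒜 : ℕ → σ) [GradedRing 𝒜] (t : A) {e : ℕ} (ht : t ∈ 𝒜 e) (he : 0 < e) (h) :
    IsIso ((Proj.awayι 𝒜 t ht he).appLE (Proj.basicOpen 𝒜 t) ⊤ h) := by
  have := (Proj.awayι 𝒜 t ht he).isIso_app (Proj.basicOpen 𝒜 t)
    (Proj.opensRange_awayι 𝒜 t ht he).ge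
  have h2 : ⊤ = Proj.awayι 𝒜 t ht he ⁻¹ᵁ Proj.basicOpen 𝒜 t := top_le_iff.1 h |>.symm
  rw [Scheme.Hom.appLE]
  have : IsIso (Spec (.of (Away 𝒜 t))|>.presheaf.map (homOfLE h).op) := by
    have : homOfLE h = eqToHom h2 := rfl
    rw [this]
    infer_instance
  infer_instance

end ProjForms

/-! ### Cartesian squares and scheme-theoretic images, checked on sections. -/

namespace AlgebraicGeometry

universe u

/-- A commutative square over an affine base is cartesian if it is so on the sections over an
affine open cover. -/
theorem isIso_lift_of_isPushout {X S T Z : Scheme.{u}} {u : X ⟶ S} {v : X ⟶ T} {f : S ⟶ Z}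
    {b : T ⟶ Z} (w : u ≫ f = v ≫ b) [IsAffine Z] [IsAffine T] {ι : Type*} (V : ι → S.Opens)
    (hV : ∀ i, IsAffineOpen (V i)) (hcov : ⨆ i, V i = ⊤) (hD : ∀ i, IsAffineOpen (u ⁻¹ᵁ V i))
    (hpo : ∀ i, IsPushout (f.appLE ⊤ (V i) le_top) (b.appLE ⊤ ⊤ le_top)
      (u.appLE (V i) (u ⁻¹ᵁ V i) le_rfl) (v.appLE ⊤ (u ⁻¹ᵁ V i) le_top)) :
    IsIso (pullback.lift u v w) := by
  set h := pullback.lift u v w with hh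
  let W (i : ι) : (pullback f b).Opens := pullback.fst f b ⁻¹ᵁ V i
  have hb : IsAffineHom b := inferInstance
  have hP : MorphismProperty.IsStableUnderBaseChange @IsAffineHom.{u} := inferInstance
  have hfst : IsAffineHom (pullback.fst f b) := hP.of_isPullback (IsPullback.of_hasPullback f b).flip hb
  have hW (i : ι) : IsAffineOpen (W i) := (hV i).preimage (pullback.fst f b)
  have hWcov : ⨆ i, W i = ⊤ := by
    rw [← Scheme.Hom.preimage_iSup, hcov, Scheme.Hom.preimage_top]
  have hpre (i : ι) : h ⁻¹ᵁ W i = u ⁻¹ᵁ V i := by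
    rw [← Scheme.Hom.comp_preimage, hh, pullback.lift_fst]
  have hp (i : ι) := (isIso_pushoutSection_iff (IsPullback.of_hasPullback f b) (US := ⊤) (UT := ⊤)
    (UX := V i) le_top le_top (UY := W i) (by simp [W])).1
      (isIso_pushoutSection_of_isAffineOpen _ _ _ _ (isAffineOpen_top _) (isAffineOpen_top _) (hV i))
  -- Both rings of sections are pushouts of the same span, and the comparison map is the canonical
  -- isomorphism between them.
  have hiso (i : ι) : IsIso (h.appLE (W i) (u ⁻¹ᵁ V i) (hpre i).ge) := by
    have e : h.appLE (W i) (u ⁻¹ᵁ V i) (hpre i).ge = ((hp i).isoIsPushout _ _ (hpo i)).hom := by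
      apply (hp i).hom_ext
      · rw [IsPushout.inl_isoIsPushout_hom, Scheme.Hom.appLE_comp_appLE]
        simp only [hh, pullback.lift_fst]
      · rw [IsPushout.inr_isoIsPushout_hom, Scheme.Hom.appLE_comp_appLE]
        simp only [hh, pullback.lift_snd]
    rw [e]
    infer_instance
  refine @HasAffineProperty.of_iSup_eq_top (MorphismProperty.isomorphisms Scheme.{u}) _
    instHasAffinePropertyIsomorphismsSchemeAndIsAffineIsIsoCommRingCatAppTop _ _ h _
    (fun i => ⟨W i, hW i⟩) hWcov fun i => ⟨?_, ?_⟩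
  · change IsAffineOpen (h ⁻¹ᵁ W i)
    rw [hpre]
    exact hD i
  · rw [Scheme.Hom.appTop, morphismRestrict_app']
    refine (Scheme.Hom.appLE_congr _ _ ?_ ?_ (fun f => IsIso f)).2 (hiso i)
    · simp
    · simp [hpre]

/-- Over an affine open of the target, the sections of the image inject into sections of the reduced
source. -/
theorem isReduced_image {X Y : Scheme.{u}} (g : X ⟶ Y) [QuasiCompact g] [IsReduced X] :
    IsReduced g.image := by
  have h : ⨆ U : Y.affineOpens, g.imageι ⁻¹ᵁ U.1 = ⊤ := by
    rw [← Scheme.Hom.preimage_iSup, iSup_affineOpens_eq_top, Scheme.Hom.preimage_top]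
  have (U : Y.affineOpens) : IsReduced ((g.image.openCoverOfIsOpenCover _ h).X U) := by
    change IsReduced (g.imageι ⁻¹ᵁ U.1 : g.image.Opens)
    have h1 : IsAffine (g.imageι ⁻¹ᵁ U.1 : g.image.Opens) := U.2.preimage g.imageι
    have h2 : _root_.IsReduced Γ(g.image, g.imageι ⁻¹ᵁ U.1) :=
      isReduced_of_injective (g.toImage.app (g.imageι ⁻¹ᵁ U.1)).hom (g.toImage_app_injective U)
    have h3 : _root_.IsReduced Γ((g.imageι ⁻¹ᵁ U.1 : g.image.Opens), ⊤) :=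
      isReduced_of_injective (Scheme.Opens.topIso _).hom.hom
        (Scheme.Opens.topIso _).commRingCatIsoToRingEquiv.injective
    exact isReduced_of_isAffine_isReduced _
  exact @IsReduced.of_openCover _ (g.image.openCoverOfIsOpenCover _ h) this

theorem irreducibleSpace_image {X Y : Scheme.{u}} (g : X ⟶ Y) [QuasiCompact g]
    [IrreducibleSpace X] : IrreducibleSpace g.image := by
  have h := g.toImage.denseRange
  have h1 : IsIrreducible (Set.range g.toImage) := by
    rw [← Set.image_univ]
    exact (IrreducibleSpace.isIrreducible_univ X).image _ g.toImage.continuous.continuousOn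
  have h2 := h1.closure
  rw [h.closure_eq] at h2
  exact (irreducibleSpace_def _).2 h2

end AlgebraicGeometry

namespace AlgebraicGeometry

universe u

theorem Scheme.Hom.appLE_comp_appLE_of_eq {X Y Z : Scheme.{u}} {f : X ⟶ Y} {g : Y ⟶ Z} {k : X ⟶ Z}
    (h : f ≫ g = k) {U : Z.Opens} {V : Y.Opens} {W : X.Opens} (e₁ : V ≤ g ⁻¹ᵁ U) (e₂ : W ≤ f ⁻¹ᵁ V)
    (e : W ≤ k ⁻¹ᵁ U) : g.appLE U V e₁ ≫ f.appLE V W e₂ = k.appLE U W e := by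
  subst h
  exact Scheme.Hom.appLE_comp_appLE _ _ _ _ _ _ _

/-- Sections of the scheme-theoretic image over an affine open are the image of the sections. -/
theorem exists_iso_range_image {X Y : Scheme.{u}} (g : X ⟶ Y) [QuasiCompact g] (U : Y.Opens)
    (hU : IsAffineOpen U) (D : X.Opens) (hD : g ⁻¹ᵁ U = D) {A B : CommRingCat.{u}} (β : Γ(Y, U) ≅ A)
    (α : Γ(X, D) ≅ B) (ψ : A →+* B)
    (h : g.appLE U D hD.ge ≫ α.hom = β.hom ≫ CommRingCat.ofHom ψ)
    (hVD : D ≤ g.toImage ⁻¹ᵁ (g.imageι ⁻¹ᵁ U)) :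
    ∃ θ : Γ(g.image, g.imageι ⁻¹ᵁ U) ≅ .of ψ.range, θ.hom ≫ CommRingCat.ofHom ψ.range.subtype =
      g.toImage.appLE (g.imageι ⁻¹ᵁ U) D hVD ≫ α.hom := by
  -- Sections of the image are a quotient of the sections of `Y` and inject into those of `X`, so
  -- they are the range of the map between the two.
  have hinj : Function.Injective (g.toImage.appLE (g.imageι ⁻¹ᵁ U) D hVD) := by
    have h1 : Function.Injective (g.toImage.app (g.imageι ⁻¹ᵁ U)) := g.toImage_app_injective ⟨U, hU⟩
    have hpre : D = g.toImage ⁻¹ᵁ (g.imageι ⁻¹ᵁ U) := by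
      rw [← Scheme.Hom.comp_preimage, Scheme.Hom.toImage_imageι, hD]
    clear h
    subst hpre
    rwa [Scheme.Hom.appLE_eq_app]
  have hsurj : Function.Surjective (g.imageι.app U) := g.ker.subschemeι_app_surjective ⟨U, hU⟩
  have h2 : g.imageι.app U ≫ g.toImage.appLE (g.imageι ⁻¹ᵁ U) D hVD = g.appLE U D hD.ge := by
    rw [Scheme.Hom.app_eq_appLE]
    exact Scheme.Hom.appLE_comp_appLE_of_eq g.toImage_imageι _ _ _
  have key (z : Γ(Y, U)) : α.hom (g.toImage.appLE (g.imageι ⁻¹ᵁ U) D hVD (g.imageι.app U z)) =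
      ψ (β.hom z) := by
    rw [← reassoc_of% h2] at h
    exact ConcreteCategory.congr_hom h z
  let θ : Γ(g.image, g.imageι ⁻¹ᵁ U) →+* ψ.range :=
    ((g.toImage.appLE (g.imageι ⁻¹ᵁ U) D hVD ≫ α.hom).hom).codRestrict ψ.range fun a => by
      obtain ⟨z, rfl⟩ := hsurj a
      exact ⟨_, (key z).symm⟩
  have hθ : Function.Bijective θ := by
    constructor
    · intro a b hab
      exact hinj (α.commRingCatIsoToRingEquiv.injective (congrArg Subtype.val hab))
    · rintro ⟨_, x, rfl⟩
      obtain ⟨z, rfl⟩ := β.commRingCatIsoToRingEquiv.surjective x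
      exact ⟨g.imageι.app U z, Subtype.ext (key z)⟩
  exact ⟨(RingEquiv.ofBijective θ hθ).toCommRingCatIso, rfl⟩

end AlgebraicGeometry

/-! ### The base change of the image to `L` is projective space. -/

namespace ProjForms

open MvPolynomial HomogeneousLocalization

universe u

variable {K L : Type u} [Field K] [Field L] [Algebra K L] {N n : ℕ}
  {q : Fin (N + 1) → MvPolynomial (Fin (n + 1)) L} {c : ℕ}
  {hq : ∀ i, q i ∈ homogeneousSubmodule (Fin (n + 1)) L c} {hc : 0 < c}
  {g : Proj (homogeneousSubmodule (Fin (n + 1)) L) ⟶ Proj (homogeneousSubmodule (Fin (N + 1)) K)}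

theorem isAffineHom_of_forms
    (hspan : homogeneousSubmodule (Fin (n + 1)) L c ≤ Submodule.span L (Set.range q))
    (hg : ∀ i, Proj.awayι _ (q i) (hq i) hc ≫ g =
        Spec.map (CommRingCat.ofHom (chartMap (K := K) hq i)) ≫
          Proj.awayι _ (X i) (X_mem i) one_pos) : IsAffineHom g := by
  refine isAffineHom_of_forall_exists_isAffineOpen _ fun x => ?_
  obtain ⟨i, hi⟩ := TopologicalSpace.Opens.mem_iSup.mp ((iSup_basicOpen_X N K).ge (Set.mem_univ x))
  refine ⟨_, hi, Proj.isAffineOpen_basicOpen _ _ (X_mem i) one_pos, ?_⟩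
  rw [hom_preimage_basicOpen hspan hg]
  exact Proj.isAffineOpen_basicOpen _ _ (hq i) hc

/-- Sections over a basic open subset of `Proj`, read in the chart. -/
def chartSections {A : Type u} {σ : Type*} [CommRing A] [SetLike σ A]
    [AddSubgroupClass σ A] (𝒜 : ℕ → σ) [GradedRing 𝒜] (t : A) {e : ℕ} (ht : t ∈ 𝒜 e) (he : 0 < e) :
    Γ(Proj 𝒜, Proj.basicOpen 𝒜 t) ≅ .of (Away 𝒜 t) :=
  have := isIso_awayι_appLE 𝒜 t ht he
    (Proj.opensRange_awayι 𝒜 t ht he ▸ (Scheme.Hom.preimage_opensRange _).ge)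
  asIso ((Proj.awayι 𝒜 t ht he).appLE (Proj.basicOpen 𝒜 t) ⊤
    (Proj.opensRange_awayι 𝒜 t ht he ▸ (Scheme.Hom.preimage_opensRange _).ge)) ≪≫ Scheme.ΓSpecIso _

theorem chartSections_hom {A : Type u} {σ : Type*} [CommRing A] [SetLike σ A]
    [AddSubgroupClass σ A] (𝒜 : ℕ → σ) [GradedRing 𝒜] (t : A) {e : ℕ} (ht : t ∈ 𝒜 e) (he : 0 < e) :
    (chartSections 𝒜 t ht he).hom = (Proj.awayι 𝒜 t ht he).appLE (Proj.basicOpen 𝒜 t) ⊤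
      (Proj.opensRange_awayι 𝒜 t ht he ▸ (Scheme.Hom.preimage_opensRange _).ge) ≫
        (Scheme.ΓSpecIso _).hom := rfl

theorem structHom_appLE_chartSections (t : MvPolynomial (Fin (n + 1)) L) {d : ℕ}
    (ht : t ∈ homogeneousSubmodule (Fin (n + 1)) L d) (hd : 0 < d) :
    (structHom n L).appLE ⊤ (Proj.basicOpen _ t) le_top ≫ (chartSections _ t ht hd).hom =
      (Scheme.ΓSpecIso _).hom ≫ CommRingCat.ofHom (chartConst n L t) := by
  rw [chartSections_hom, ← Scheme.ΓSpecIso_naturality, ← Category.assoc]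
  exact congrArg (· ≫ _) (Scheme.Hom.appLE_comp_appLE_of_eq (awayι_structHom n L t ht hd) _ _ le_top)

/-- Translates the gluing description of `g` into sections, so that the algebra of `isPushout_chart`
can be transported to the geometric square. -/
theorem appLE_chartSections
    (hg : ∀ i, Proj.awayι _ (q i) (hq i) hc ≫ g =
        Spec.map (CommRingCat.ofHom (chartMap (K := K) hq i)) ≫
          Proj.awayι _ (X i) (X_mem i) one_pos) (i : Fin (N + 1)) (h) :
    g.appLE (Proj.basicOpen _ (X i)) (Proj.basicOpen _ (q i)) h ≫ (chartSections _ (q i) (hq i) hc).hom =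
      (chartSections _ (X i) (X_mem i) one_pos).hom ≫ CommRingCat.ofHom (chartMap (K := K) hq i) := by
  have hq' : ⊤ ≤ Proj.awayι _ (q i) (hq i) hc ⁻¹ᵁ Proj.basicOpen _ (q i) :=
    Proj.opensRange_awayι _ (q i) (hq i) hc ▸ (Scheme.Hom.preimage_opensRange _).ge
  have hX : ⊤ ≤ Proj.awayι _ (X i) (X_mem (K := K) i) one_pos ⁻¹ᵁ Proj.basicOpen _ (X i) :=
    Proj.opensRange_awayι (homogeneousSubmodule _ K) (X i) (X_mem i) one_pos ▸ (Scheme.Hom.preimage_opensRange _).ge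
  have hk : ⊤ ≤ (Spec.map (CommRingCat.ofHom (chartMap (K := K) hq i)) ≫
      Proj.awayι _ (X i) (X_mem (K := K) i) one_pos) ⁻¹ᵁ Proj.basicOpen _ (X i) := fun x _ => hX trivial
  have h1 := Scheme.Hom.appLE_comp_appLE_of_eq (hg i) h hq' hk
  have h2 := Scheme.Hom.appLE_comp_appLE_of_eq
    (f := Spec.map (CommRingCat.ofHom (chartMap (K := K) hq i))) (V := ⊤) (W := ⊤) rfl hX le_top hk
  have h3 := Scheme.ΓSpecIso_naturality (CommRingCat.ofHom (chartMap (K := K) hq i))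
  rw [chartSections_hom, chartSections_hom, Category.assoc, ← h3, ← Category.assoc, ← Category.assoc]
  exact congrArg (· ≫ _) ((h1.trans h2.symm).trans
    (congrArg (_ ≫ ·) (Scheme.Hom.app_eq_appLE _).symm))

/-- Under `exists_iso_range_image` this square is isomorphic to that of `isPushout_chart`. The open
set `D` is a variable with an equation because the preimage of a chart is only propositionally a
basic open. -/
theorem isPushout_image [IsGalois K L] [QuasiCompact g]
    (hspan : homogeneousSubmodule (Fin (n + 1)) L c ≤ Submodule.span L (Set.range q))
    (hfix : ∀ s : L ≃ₐ[K] L, ∃ Θ : MvPolynomial (Fin (n + 1)) L →+* MvPolynomial (Fin (n + 1)) L,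
      (∀ a, Θ (C a) = C (s a)) ∧ ∀ i, Θ (q i) = q i)
    (hg : ∀ i, Proj.awayι _ (q i) (hq i) hc ≫ g =
        Spec.map (CommRingCat.ofHom (chartMap (K := K) hq i)) ≫
          Proj.awayι _ (X i) (X_mem i) one_pos) (i : Fin (N + 1))
    (D : (Proj (homogeneousSubmodule (Fin (n + 1)) L)).Opens) (hD : D = Proj.basicOpen _ (q i))
    (hVD : D ≤ g.toImage ⁻¹ᵁ (g.imageι ⁻¹ᵁ Proj.basicOpen _ (X i))) :
    IsPushout ((g.imageι ≫ structHom N K).appLE ⊤ (g.imageι ⁻¹ᵁ Proj.basicOpen _ (X i)) le_top)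
      ((Spec.map (CommRingCat.ofHom (algebraMap K L))).appLE ⊤ ⊤ le_top)
      (g.toImage.appLE (g.imageι ⁻¹ᵁ Proj.basicOpen _ (X i)) D hVD)
      ((structHom n L).appLE ⊤ D le_top) := by
  subst hD
  obtain ⟨θ, hθ⟩ := exists_iso_range_image g _ (Proj.isAffineOpen_basicOpen _ _ (X_mem i) one_pos) _
    (hom_preimage_basicOpen hspan hg i) (chartSections _ (X i) (X_mem i) one_pos)
    (chartSections _ (q i) (hq i) hc) _ (appLE_chartSections hg i _) hVD
  have hv := structHom_appLE_chartSections (q i) (hq i) hc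
  have hb : (Spec.map (CommRingCat.ofHom (algebraMap K L))).appLE ⊤ ⊤ le_top ≫
      (Scheme.ΓSpecIso _).hom = (Scheme.ΓSpecIso _).hom ≫ CommRingCat.ofHom (algebraMap K L) :=
    Scheme.ΓSpecIso_naturality _
  refine (isPushout_chart hq hspan hfix i).of_iso' (Scheme.ΓSpecIso (.of K))
    θ (Scheme.ΓSpecIso (.of L)) (chartSections _ (q i) (hq i) hc) ?_ hb.symm hθ hv.symm
  have hmono : Mono (CommRingCat.ofHom (chartMap (K := K) hq i).range.subtype) :=
    ConcreteCategory.mono_of_injective _ Subtype.val_injective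
  have h1 := Scheme.Hom.appLE_comp_appLE_of_eq (f := g.toImage) (g := g.imageι ≫ structHom N K)
    (k := structHom n L ≫ Spec.map (CommRingCat.ofHom (algebraMap K L))) (U := ⊤)
    (by rw [Scheme.Hom.toImage_imageι_assoc, hom_structHom hspan hg]) le_top hVD le_top
  have h2 := Scheme.Hom.appLE_comp_appLE_of_eq (f := structHom n L) (W := Proj.basicOpen _ (q i))
    (g := Spec.map (CommRingCat.ofHom (algebraMap K L))) (U := ⊤) (V := ⊤) rfl le_top le_top le_top
  rw [← cancel_mono (CommRingCat.ofHom (chartMap (K := K) hq i).range.subtype), Category.assoc,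
    Category.assoc, hθ, ← Category.assoc, ← Category.assoc]
  refine Eq.trans ?_ ((congrArg (· ≫ _) (h2.trans h1.symm)))
  rw [Category.assoc, Category.assoc, hv, reassoc_of% hb, ← CommRingCat.ofHom_comp,
    ← CommRingCat.ofHom_comp]
  exact congrArg (fun x => _ ≫ CommRingCat.ofHom x) (RingHom.ext (chartMap_chartConst hq i))

theorem isIso_lift [IsGalois K L] [QuasiCompact g]
    (hspan : homogeneousSubmodule (Fin (n + 1)) L c ≤ Submodule.span L (Set.range q))
    (hfix : ∀ s : L ≃ₐ[K] L, ∃ Θ : MvPolynomial (Fin (n + 1)) L →+* MvPolynomial (Fin (n + 1)) L,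
      (∀ a, Θ (C a) = C (s a)) ∧ ∀ i, Θ (q i) = q i)
    (hg : ∀ i, Proj.awayι _ (q i) (hq i) hc ≫ g =
        Spec.map (CommRingCat.ofHom (chartMap (K := K) hq i)) ≫
          Proj.awayι _ (X i) (X_mem i) one_pos)
    (w : g.toImage ≫ g.imageι ≫ structHom N K =
      structHom n L ≫ Spec.map (CommRingCat.ofHom (algebraMap K L))) :
    IsIso (pullback.lift g.toImage (structHom n L) w) := by
  have hpre (i : Fin (N + 1)) : g.toImage ⁻¹ᵁ (g.imageι ⁻¹ᵁ Proj.basicOpen _ (X i)) =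
      Proj.basicOpen _ (q i) := by
    rw [← Scheme.Hom.comp_preimage, Scheme.Hom.toImage_imageι, hom_preimage_basicOpen hspan hg]
  refine isIso_lift_of_isPushout w (fun i => g.imageι ⁻¹ᵁ Proj.basicOpen _ (X i)) (fun i => ?_) ?_
    (fun i => ?_) fun i => isPushout_image hspan hfix hg i _ (hpre i) _
  · exact (Proj.isAffineOpen_basicOpen _ _ (X_mem i) one_pos).preimage g.imageι
  · rw [← Scheme.Hom.preimage_iSup, iSup_basicOpen_X, Scheme.Hom.preimage_top]
  · rw [hpre]
    exact Proj.isAffineOpen_basicOpen _ _ (hq i) hc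

end ProjForms

/-! ### Integrality of projective space and the Severi-Brauer property. -/

namespace ProjForms

open MvPolynomial HomogeneousLocalization

universe u

/-- The generic point of projective space. -/
def genericPt (n : ℕ) (K : Type u) [Field K] : Proj (homogeneousSubmodule (Fin (n + 1)) K) where
  asHomogeneousIdeal := ⊥
  isPrime := by
    rw [HomogeneousIdeal.toIdeal_bot]
    exact Ideal.isPrime_bot
  not_irrelevant_le h := by
    have h1 : (X 0 : MvPolynomial (Fin (n + 1)) K) ∈
        HomogeneousIdeal.irrelevant (homogeneousSubmodule (Fin (n + 1)) K) := by
      rw [HomogeneousIdeal.mem_irrelevant_iff, GradedRing.proj_apply,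
        DirectSum.decompose_of_mem_ne (ℳ := homogeneousSubmodule (Fin (n + 1)) K) (X_mem 0) one_ne_zero]
    exact X_ne_zero (R := K) (0 : Fin (n + 1)) (h h1)

theorem genericPt_mem {n : ℕ} {K : Type u} [Field K] {t : MvPolynomial (Fin (n + 1)) K} (ht : t ≠ 0) :
    genericPt n K ∈ Proj.basicOpen (homogeneousSubmodule (Fin (n + 1)) K) t := by
  rw [Proj.mem_basicOpen]
  exact ht

instance irreducibleSpace_proj (n : ℕ) (K : Type u) [Field K] :
    IrreducibleSpace (Proj (homogeneousSubmodule (Fin (n + 1)) K)) := by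
  -- Every non-empty open set contains the generic point, so any two of them meet.
  have h (U : (Proj (homogeneousSubmodule (Fin (n + 1)) K)).Opens) (x) (hx : x ∈ U) :
      genericPt n K ∈ U := by
    obtain ⟨_, ⟨t, rfl⟩, h1, h2⟩ := TopologicalSpace.Opens.isBasis_iff_nbhd.1
      (Proj.isBasis_basicOpen (homogeneousSubmodule (Fin (n + 1)) K)) hx
    refine h2 (genericPt_mem ?_)
    rintro rfl
    simp at h1
  refine @IrreducibleSpace.mk _ _ ⟨?_⟩ ⟨genericPt n K⟩
  rintro U V hU hV ⟨x, -, hx⟩ ⟨y, -, hy⟩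
  exact ⟨genericPt n K, trivial, h ⟨U, hU⟩ x hx, h ⟨V, hV⟩ y hy⟩

instance isReduced_proj (n : ℕ) (K : Type u) [Field K] :
    IsReduced (Proj (homogeneousSubmodule (Fin (n + 1)) K)) := by
  refine @IsReduced.of_openCover _ (Proj.affineOpenCoverOfISup _ X one_pos X_mem
    (iSup_basicOpen_X n K)).openCover fun (i : Fin (n + 1)) => ?_
  change IsReduced (Spec (CommRingCat.of (Away (homogeneousSubmodule (Fin (n + 1)) K) (X i))))
  have h1 : IsDomain (Localization.Away (X i : MvPolynomial (Fin (n + 1)) K)) :=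
    IsLocalization.isDomain_localization (powers_le_nonZeroDivisors_of_noZeroDivisors (X_ne_zero _))
  have h2 : _root_.IsReduced (Away (homogeneousSubmodule (Fin (n + 1)) K) (X i)) :=
    isReduced_of_injective (algebraMap _
      (Localization.Away (X i : MvPolynomial (Fin (n + 1)) K))) (val_injective _)
  infer_instance

/-- The image over `K` of projective space over `K̄` under the morphism given by Galois-invariant
forms spanning all forms of their degree is a Severi-Brauer variety. -/
theorem isSeveriBrauer_image {K : Type u} [Field K] [CharZero K] {N n c : ℕ} {hc : 0 < c}
    {q : Fin (N + 1) → MvPolynomial (Fin (n + 1)) (AlgebraicClosure K)}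
    {hq : ∀ i, q i ∈ homogeneousSubmodule (Fin (n + 1)) (AlgebraicClosure K) c}
    {g : Proj (homogeneousSubmodule (Fin (n + 1)) (AlgebraicClosure K)) ⟶
      Proj (homogeneousSubmodule (Fin (N + 1)) K)}
    (hspan : homogeneousSubmodule (Fin (n + 1)) (AlgebraicClosure K) c ≤
      Submodule.span (AlgebraicClosure K) (Set.range q))
    (hfix : ∀ s : AlgebraicClosure K ≃ₐ[K] AlgebraicClosure K,
      ∃ Θ : MvPolynomial (Fin (n + 1)) (AlgebraicClosure K) →+* MvPolynomial (Fin (n + 1)) (AlgebraicClosure K),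
      (∀ a, Θ (C a) = C (s a)) ∧ ∀ i, Θ (q i) = q i)
    (hg : ∀ i, Proj.awayι _ (q i) (hq i) hc ≫ g =
        Spec.map (CommRingCat.ofHom (chartMap (K := K) hq i)) ≫
          Proj.awayι _ (X i) (X_mem i) one_pos) :
    IsSeveriBrauer n (g.imageι ≫ structHom N K) := by
  have hgal : IsGalois K (AlgebraicClosure K) := {}
  have haff := isAffineHom_of_forms hspan hg
  have hqc : QuasiCompact g := inferInstance
  refine ⟨⟨?_, N, g.imageι, (inferInstance : IsClosedImmersion g.ker.subschemeι), rfl⟩, ?_⟩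
  · have h1 := isReduced_image g
    have h2 := irreducibleSpace_image g
    exact isIntegral_of_irreducibleSpace_of_isReduced _
  · have w : g.toImage ≫ g.imageι ≫ structHom N K = structHom n (AlgebraicClosure K) ≫
        Spec.map (CommRingCat.ofHom (algebraMap K (AlgebraicClosure K))) := by
      rw [Scheme.Hom.toImage_imageι_assoc, hom_structHom hspan hg]
    have hiso := isIso_lift hspan hfix hg w
    refine ⟨(asIso (pullback.lift _ _ w)).symm, ?_⟩
    change inv (pullback.lift _ _ w) ≫ structHom n (AlgebraicClosure K) = _
    rw [IsIso.inv_comp_eq, pullback.lift_snd]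

end ProjForms

/-! ### Rational points of the image and homogeneous coordinates. -/

namespace ProjForms

open MvPolynomial HomogeneousLocalization

universe u

theorem eval₂_mul_right {σ R S : Type*} [CommSemiring R] [CommSemiring S] (φ : R →+* S) (x : σ → S)
    (v : S) {d : ℕ} {f : MvPolynomial σ R} (hf : f ∈ homogeneousSubmodule σ R d) :
    eval₂ φ (fun j => x j * v) f = eval₂ φ x f * v ^ d := by
  rw [eval₂_eq, eval₂_eq, Finset.sum_mul]
  refine Finset.sum_congr rfl fun m hm => ?_
  have hd : ∑ j ∈ m.support, m j = d := by
    rw [← IsHomogeneous.degree_eq_sum_deg_support hf hm]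
  simp only [mul_pow]
  rw [Finset.prod_mul_distrib, Finset.prod_pow_eq_pow_sum, hd, mul_assoc]

variable {K L : Type u} [Field K] [Field L] [Algebra K L] {N n : ℕ}
  {q : Fin (N + 1) → MvPolynomial (Fin (n + 1)) L} {c : ℕ}
  {hq : ∀ i, q i ∈ homogeneousSubmodule (Fin (n + 1)) L c} {hc : 0 < c}

/-- A point of a chart with values in `L` has homogeneous coordinates. -/
theorem exists_eval_eq_of_away (hc : 0 < c) {i : Fin (N + 1)}
    (τ : Away (homogeneousSubmodule (Fin (n + 1)) L) (q i) →+* L)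
    (hτ : ∀ l, τ (chartConst n L (q i) l) = l) {a : Fin (n + 1)}
    (ha : τ (Away.isLocalizationElem (hq i) (X_mem a)) ≠ 0) :
    ∃ t : Fin (n + 1) → L, t ≠ 0 ∧ ∀ f (hf : f ∈ homogeneousSubmodule (Fin (n + 1)) L (1 • c)),
      eval t f = τ (Away.isLocalizationElem (hq i) (X_mem a)) ^ (c - 1) *
        τ (Away.mk _ (hq i) 1 f hf) := by
  -- The factor `X a ^ (c - 1)` raises the degree to that of `q i`. A form `f` of degree `c`
  -- evaluated at the `z j` is `f X_a^{c(c-1)} / q_i^c`, that is `(X_a^c / q_i)^{c-1} · (f / q_i)`.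
  let z (j : Fin (n + 1)) : Away (homogeneousSubmodule (Fin (n + 1)) L) (q i) :=
    Away.mk _ (hq i) 1 (X j * X a ^ (c - 1)) (by
      have := (isHomogeneous_X L j).mul ((isHomogeneous_X L a).pow (c - 1))
      rw [one_smul]
      rwa [one_mul, Nat.add_sub_cancel' hc] at this)
  have hz : z a = Away.isLocalizationElem (hq i) (X_mem a) := by
    refine val_injective _ ?_
    simp only [z, Away.val_mk]
    rw [← pow_succ', Nat.sub_add_cancel hc]
  refine ⟨fun j => τ (z j), fun h => ha (hz ▸ congrFun h a), fun f hf => ?_⟩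
  have h1 : eval (fun j => τ (z j)) f = τ (eval₂ (chartConst n L (q i)) z f) := by
    rw [eval₂_comp_left, ← eval₂_id]
    congr 1
    exact RingHom.ext fun l => (hτ l).symm
  rw [h1, ← map_pow, ← map_mul]
  congr 1
  refine val_injective _ ?_
  have h2 : (eval₂ (chartConst n L (q i)) z f).val =
      eval₂ ((algebraMap (MvPolynomial (Fin (n + 1)) L) (Localization.Away (q i))).comp C)
        (fun j => (algebraMap (MvPolynomial (Fin (n + 1)) L) (Localization.Away (q i)) (X j) *
          (Localization.mk (X a ^ (c - 1)) (⟨q i ^ 1, 1, rfl⟩ : Submonoid.powers (q i)) : Localization.Away (q i)))) f := by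
    rw [← HomogeneousLocalization.algebraMap_apply, eval₂_comp_left]
    congr 1
    funext j
    simp only [Function.comp, HomogeneousLocalization.algebraMap_apply, z, Away.val_mk]
    rw [← Localization.mk_one_eq_algebraMap, Localization.mk_mul]
    simp
  rw [h2, eval₂_mul_right _ _ _ hf]
  have h3 : eval₂ ((algebraMap (MvPolynomial (Fin (n + 1)) L) (Localization.Away (q i))).comp C)
      (fun j => algebraMap (MvPolynomial (Fin (n + 1)) L) (Localization.Away (q i)) (X j)) f =
        algebraMap _ _ f := by
    have := eval₂_comp_left (algebraMap _ (Localization.Away (q i))) C X f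
    rw [eval₂_eta] at this
    exact this.symm
  rw [h3, val_mul, val_pow, Away.val_mk, Away.val_mk, Localization.mk_pow, Localization.mk_pow,
    ← Localization.mk_one_eq_algebraMap, Localization.mk_mul, Localization.mk_mul,
    Localization.mk_eq_mk_iff, Localization.r_iff_exists]
  refine ⟨1, ?_⟩
  obtain ⟨c, rfl⟩ : ∃ b, c = b + 1 := ⟨c - 1, (Nat.sub_add_cancel hc).symm⟩
  simp
  ring

/-- In a common chart the two points are ring maps `τ` to `L` and `ρ` to `K` that agree on the
`K`-chart. The values of the `q m` are thus proportional to the rational numbers `ρ(X m / X i)`. -/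
theorem exists_eval_eq_of_section (hc : 0 < c)
    {g : Proj (homogeneousSubmodule (Fin (n + 1)) L) ⟶ Proj (homogeneousSubmodule (Fin (N + 1)) K)}
    (hspan : homogeneousSubmodule (Fin (n + 1)) L c ≤ Submodule.span L (Set.range q))
    (hg : ∀ i, Proj.awayι _ (q i) (hq i) hc ≫ g =
        Spec.map (CommRingCat.ofHom (chartMap (K := K) hq i)) ≫
          Proj.awayι _ (X i) (X_mem i) one_pos)
    (r : Spec (.of L) ⟶ Proj (homogeneousSubmodule (Fin (n + 1)) L)) (hr : r ≫ structHom n L = 𝟙 _)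
    (s : Spec (.of K) ⟶ Proj (homogeneousSubmodule (Fin (N + 1)) K))
    (h : r ≫ g = Spec.map (CommRingCat.ofHom (algebraMap K L)) ≫ s) :
    ∃ t : Fin (n + 1) → L, t ≠ 0 ∧ ∃ l : L, l ≠ 0 ∧ ∃ b : Fin (N + 1) → K,
      ∀ m, eval t (q m) = l * algebraMap K L (b m) := by
  let p : Spec (.of L) := IsLocalRing.closedPoint L
  obtain ⟨i, hi⟩ := TopologicalSpace.Opens.mem_iSup.mp
    ((iSup_basicOpen_forms hspan).ge (Set.mem_univ (r p)))
  have hr1 : Set.range r ⊆ Set.range (Proj.awayι _ (q i) (hq i) hc) := by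
    rintro _ ⟨p', rfl⟩
    obtain rfl : p' = p := Subsingleton.elim (α := PrimeSpectrum L) _ _
    exact (Proj.opensRange_awayι _ (q i) (hq i) hc).ge hi
  have hs1 : Set.range s ⊆ Set.range (Proj.awayι _ (X i) (X_mem (K := K) i) one_pos) := by
    rintro _ ⟨p', rfl⟩
    obtain rfl : p' = Spec.map (CommRingCat.ofHom (algebraMap K L)) p :=
      Subsingleton.elim (α := PrimeSpectrum K) _ _
    refine (Proj.opensRange_awayι _ (X i) (X_mem (K := K) i) one_pos).ge ?_
    rw [← Scheme.Hom.comp_apply, ← h, Scheme.Hom.comp_apply]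
    exact (hom_preimage_basicOpen hspan hg i).ge hi
  obtain ⟨τ, hτ⟩ := Spec.map_surjective (IsOpenImmersion.lift _ r hr1)
  obtain ⟨ρ, hρ⟩ := Spec.map_surjective (IsOpenImmersion.lift _ s hs1)
  have hτr : Spec.map τ ≫ Proj.awayι _ (q i) (hq i) hc = r := by
    rw [hτ, IsOpenImmersion.lift_fac]
  have hρs : Spec.map ρ ≫ Proj.awayι _ (X i) (X_mem (K := K) i) one_pos = s := by
    rw [hρ, IsOpenImmersion.lift_fac]
  have h1 : CommRingCat.ofHom (chartConst n L (q i)) ≫ τ = 𝟙 _ := by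
    rw [← hτr, Category.assoc, awayι_structHom, ← Spec.map_comp, ← Spec.map_id] at hr
    exact Spec.map_injective hr
  have h2 : CommRingCat.ofHom (chartMap (K := K) hq i) ≫ τ =
      ρ ≫ CommRingCat.ofHom (algebraMap K L) := by
    refine Spec.map_injective ?_
    rw [← cancel_mono (Proj.awayι _ (X i) (X_mem (K := K) i) one_pos), Spec.map_comp, Spec.map_comp,
      Category.assoc, Category.assoc, hρs, ← hg, reassoc_of% hτr, h]
  obtain ⟨a, ha⟩ := TopologicalSpace.Opens.mem_iSup.mp
    ((iSup_basicOpen_X n L).ge (Set.mem_univ (r p)))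
  have ha' : τ.hom (Away.isLocalizationElem (hq i) (X_mem a)) ≠ 0 := by
    have h3 : Spec.map τ p ∈ Proj.awayι _ (q i) (hq i) hc ⁻¹ᵁ Proj.basicOpen _ (X a) := by
      change Proj.awayι _ (q i) (hq i) hc (Spec.map τ p) ∈ Proj.basicOpen _ (X a)
      rw [← Scheme.Hom.comp_apply, hτr]
      exact ha
    rw [Proj.awayι_preimage_basicOpen _ (hq i) hc (X_mem a) one_pos] at h3
    intro h0
    refine h3 ?_
    change τ.hom _ ∈ p.asIdeal
    rw [h0]
    exact zero_mem _
  obtain ⟨t, ht, hev⟩ := exists_eval_eq_of_away hc τ.hom (fun l => ConcreteCategory.congr_hom h1 l) ha'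
  refine ⟨t, ht, _, pow_ne_zero (c - 1) ha',
    fun m => ρ.hom (Away.mk _ (X_mem i) 1 (X m) (by simpa using X_mem m)), fun m => ?_⟩
  rw [hev _ (by simpa using hq m)]
  congr 1
  have h3 := ConcreteCategory.congr_hom h2 (Away.mk _ (X_mem i) 1 (X m) (by simpa using X_mem m))
  refine Eq.trans ?_ h3
  change _ = τ.hom (chartMap hq i _)
  rw [chartMap_mk]
  simp only [formMap_X]

end ProjForms

namespace ProjForms

open MvPolynomial HomogeneousLocalization

universe u

/-- A rational point of the image of the morphism given by forms has homogeneous coordinates over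
the larger field at which the forms take proportionally rational values. -/
theorem exists_eval_eq_of_hasRationalPoint {K L : Type u} [Field K] [Field L] [Algebra K L]
    [IsGalois K L] {N n c : ℕ}
    {q : Fin (N + 1) → MvPolynomial (Fin (n + 1)) L}
    {hq : ∀ i, q i ∈ homogeneousSubmodule (Fin (n + 1)) L c} {hc : 0 < c}
    {g : Proj (homogeneousSubmodule (Fin (n + 1)) L) ⟶ Proj (homogeneousSubmodule (Fin (N + 1)) K)}
    (hspan : homogeneousSubmodule (Fin (n + 1)) L c ≤ Submodule.span L (Set.range q))
    (hfix : ∀ s : L ≃ₐ[K] L, ∃ Θ : MvPolynomial (Fin (n + 1)) L →+* MvPolynomial (Fin (n + 1)) L,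
      (∀ a, Θ (C a) = C (s a)) ∧ ∀ i, Θ (q i) = q i)
    (hg : ∀ i, Proj.awayι _ (q i) (hq i) hc ≫ g =
        Spec.map (CommRingCat.ofHom (chartMap (K := K) hq i)) ≫
          Proj.awayι _ (X i) (X_mem i) one_pos)
    (h : HasRationalPoint (g.imageι ≫ structHom N K)) :
    ∃ t : Fin (n + 1) → L, t ≠ 0 ∧ ∃ l : L, l ≠ 0 ∧ ∃ b : Fin (N + 1) → K,
      ∀ m, eval t (q m) = l * algebraMap K L (b m) := by
  obtain ⟨s, hs⟩ := h
  have haff := isAffineHom_of_forms hspan hg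
  have hqc : QuasiCompact g := inferInstance
  have w : g.toImage ≫ g.imageι ≫ structHom N K = structHom n L ≫
      Spec.map (CommRingCat.ofHom (algebraMap K L)) := by
    rw [Scheme.Hom.toImage_imageι_assoc, hom_structHom hspan hg]
  have hiso := isIso_lift hspan hfix hg w
  have w' : (Spec.map (CommRingCat.ofHom (algebraMap K L)) ≫ s) ≫ g.imageι ≫ structHom N K =
      𝟙 _ ≫ Spec.map (CommRingCat.ofHom (algebraMap K L)) := by
    rw [Category.assoc, hs, Category.comp_id, Category.id_comp]
  have h1 : inv (pullback.lift _ _ w) ≫ structHom n L = pullback.snd _ _ := by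
    rw [IsIso.inv_comp_eq, pullback.lift_snd]
  have h2 : inv (pullback.lift _ _ w) ≫ g.toImage = pullback.fst _ _ := by
    rw [IsIso.inv_comp_eq, pullback.lift_fst]
  -- The base change of the rational point to `L` is a point of the fibre product, carried to
  -- projective space over `L` by the inverse of the descent isomorphism.
  refine exists_eval_eq_of_section hc hspan hg (pullback.lift _ _ w' ≫ inv (pullback.lift _ _ w)) ?_
    (s ≫ g.imageι) ?_
  · rw [Category.assoc, h1, pullback.lift_snd]
  · have h3 := congrArg (pullback.lift _ _ w' ≫ inv (pullback.lift _ _ w) ≫ ·) g.toImage_imageι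
    rw [Category.assoc, ← h3, reassoc_of% h2, pullback.lift_fst_assoc, Category.assoc]

end ProjForms

/-! ### The surface of the symbol algebra. -/

theorem exists_eq_pow_mul_of_pow_three_eq {L : Type*} [Field L] {w a b : L} (hw : 1 + w + w ^ 2 = 0)
    (h : a ^ 3 = b ^ 3) : ∃ k : Fin 3, a = w ^ (k : ℕ) * b := by
  have h1 : (a - b) * ((a - w * b) * (a - w ^ 2 * b)) = 0 := by
    linear_combination h + (b ^ 2 * a * (-1 + w) + a ^ 2 * b * (-1) + (1 - w) * b ^ 3 + a * b ^ 2) * hw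
  rcases mul_eq_zero.1 h1 with h1 | h1
  · exact ⟨0, by simpa using sub_eq_zero.1 h1⟩
  rcases mul_eq_zero.1 h1 with h1 | h1
  · exact ⟨1, by simpa using sub_eq_zero.1 h1⟩
  · exact ⟨2, by simpa using sub_eq_zero.1 h1⟩

-- The hypothesis `hN` implies that `y` is not a norm from `K(x^{1/3})`, the classical condition for
-- the symbol algebra `(x, y)` to be non-split. The surface is its Severi-Brauer variety in the
-- anticanonical embedding.
open MvPolynomial in
theorem exists_severiBrauer_surface {K : Type} [Field K] [CharZero K] {x y ω : K}
    (hω : 1 + ω + ω ^ 2 = 0) (hx0 : x ≠ 0) (hy0 : y ≠ 0)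
    (hN : ∀ (u : Fin 3 → K) (e : K),
      u 0 ^ 3 + x * u 1 ^ 3 + x ^ 2 * u 2 ^ 3 - 3 * x * u 0 * u 1 * u 2 = y * e ^ 3 →
        (∀ i, u i = 0) ∧ e = 0) :
    ∃ (S : Scheme.{0}) (f : S ⟶ Spec (.of K)), IsSeveriBrauer 2 f ∧ ¬ HasRationalPoint f := by
  let L := AlgebraicClosure K
  have hL : CharZero L := charZero_of_injective_algebraMap (algebraMap K L).injective
  have hgal : IsGalois K L := {}
  obtain ⟨α, hα⟩ := IsAlgClosed.exists_pow_nat_eq (algebraMap K L x⁻¹) (n := 3) (by norm_num)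
  obtain ⟨β, hβ⟩ := IsAlgClosed.exists_pow_nat_eq (algebraMap K L y) (n := 3) (by norm_num)
  have hw : 1 + algebraMap K L ω + algebraMap K L ω ^ 2 = 0 := by
    rw [← map_one (algebraMap K L), ← map_pow, ← map_add, ← map_add, hω, map_zero]
  have hα0 : α ≠ 0 := by
    rintro rfl
    rw [zero_pow three_ne_zero] at hα
    exact inv_ne_zero hx0 ((map_eq_zero _).1 hα.symm)
  have hβ0 : β ≠ 0 := by
    rintro rfl
    rw [zero_pow three_ne_zero] at hβ
    exact hy0 ((map_eq_zero _).1 hβ.symm)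
  -- There are ten forms, as many as ternary cubic monomials, so the target is `ℙ⁹`.
  let e : Fin (9 + 1) ≃ (Fin 3 × Fin 3) ⊕ Unit :=
    (Fintype.equivFinOfCardEq (by simp)).symm
  let q (i : Fin (9 + 1)) : MvPolynomial (Fin (2 + 1)) L := TwistedCubic.form (algebraMap K L ω) α β (e i)
  have hq (i) : q i ∈ homogeneousSubmodule (Fin (2 + 1)) L 3 := TwistedCubic.isHomogeneous_form _ _ _ _
  have hspan : homogeneousSubmodule (Fin (2 + 1)) L 3 ≤ Submodule.span L (Set.range q) := by
    have h := TwistedCubic.homogeneousSubmodule_le_span_form hw three_ne_zero hα0 hβ0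
    rwa [← e.surjective.range_comp] at h
  have hfix (s : L ≃ₐ[K] L) : ∃ Θ : MvPolynomial (Fin (2 + 1)) L →+* MvPolynomial (Fin (2 + 1)) L,
      (∀ a, Θ (C a) = C (s a)) ∧ ∀ i, Θ (q i) = q i := by
    -- Kummer theory: an automorphism multiplies a cube root of an element of `K` by a cube root of
    -- unity.
    obtain ⟨k, hk⟩ := exists_eq_pow_mul_of_pow_three_eq (a := s α) (b := α) hw
      (by rw [← map_pow, hα, s.commutes])
    obtain ⟨l, hl⟩ := exists_eq_pow_mul_of_pow_three_eq (a := s β) (b := β) hw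
      (by rw [← map_pow, hβ, s.commutes])
    obtain ⟨Θ, h1, h2⟩ := TwistedCubic.exists_ringHom_form_eq hω s k l hk hl
    exact ⟨Θ, h1, fun i => h2 _⟩
  obtain ⟨g, hg⟩ := ProjForms.exists_hom (K := K) hq (by norm_num) hspan
  refine ⟨_, g.imageι ≫ ProjForms.structHom 9 K, ProjForms.isSeveriBrauer_image hspan hfix hg, fun h => ?_⟩
  obtain ⟨t, ht, l, hl, b, hb⟩ := ProjForms.exists_eval_eq_of_hasRationalPoint hspan hfix hg h
  refine ht (TwistedCubic.eq_zero_of_eval_form hω three_ne_zero (x := x) (y := y) (α := α) ?_ hβ hN t hl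
    (b ∘ e.symm) fun n => ?_)
  · rw [hα, ← map_mul, inv_mul_cancel₀ hx0, map_one]
  · simpa [q] using hb (e.symm n)

/-- The constants of the union field. -/
def unionField.const (k : Type*) [Field k] : k →+* unionField k :=
  ((HahnSeries.C : HahnSeries ℚ k →+* HahnSeries ℚ (HahnSeries ℚ k)).comp HahnSeries.C).codRestrict
    (unionField k) fun a => mem_unionField.2 ⟨1, by simp, fun q r h => by
      by_cases hq : q = 0
      · by_cases hr : r = 0
        · exact ⟨⟨0, by simp [hq]⟩, 0, by simp [hr]⟩
        · subst hq
          refine absurd ?_ h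
          have h1 : (HahnSeries.single (0 : ℚ) (HahnSeries.C a : HahnSeries ℚ k)).coeff 0 =
              HahnSeries.C a := HahnSeries.coeff_single_same _ _
          have h2 : (HahnSeries.single (0 : ℚ) a).coeff r = 0 := HahnSeries.coeff_single_of_ne hr
          exact (congrArg (fun f => HahnSeries.coeff f r) h1).trans h2
      · refine absurd ?_ h
        have : (HahnSeries.single (0 : ℚ) (HahnSeries.C a : HahnSeries ℚ k)).coeff q = 0 :=
          HahnSeries.coeff_single_of_ne hq
        exact congrArg (fun f => HahnSeries.coeff f r) this⟩

end

theorem mainTheorem10 :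
    (∀ (L : Type*) [Field L] [Algebra (unionField ℂ) L] [FiniteDimensional (unionField ℂ) L]
      [IsGalois (unionField ℂ) L], ∃ n : ℕ, Module.finrank (unionField ℂ) L = 3 ^ n) ∧
    (∃ (S : Scheme.{0}) (f : S ⟶ Spec (.of (unionField ℂ))),
      IsSeveriBrauer 2 f ∧ ¬ HasRationalPoint f ∧ ¬ HasPointOfDegree f 6) := by
  refine ⟨fun L _ _ _ _ => finrank_eq_three_pow L, ?_⟩
  have hchar : CharZero (unionField ℂ) := (unionField ℂ).subtype.charZero
  obtain ⟨r, hr⟩ := IsAlgClosed.exists_eq_mul_self (-3 : ℂ)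
  have hN := unionField.norm_form_ne (k := ℂ)
  -- If `x` or `y` were zero, the norm equation would have an evident non-trivial solution.
  have hx0 : unionField.x ℂ ≠ 0 := fun h0 => by
    have := (hN ![0, 1, 0] 0 (by simp [h0])).1 1
    simp at this
  have hy0 : unionField.y ℂ ≠ 0 := fun h0 => one_ne_zero (hN 0 1 (by simp [h0])).2
  -- As `r² = -3`, the constant `(-1 + r)/2` is a primitive cube root of unity.
  obtain ⟨S, f, h1, h2⟩ := exists_severiBrauer_surface (ω := unionField.const ℂ ((-1 + r) / 2)) (by
    rw [← map_one (unionField.const ℂ), ← map_pow, ← map_add, ← map_add, ← map_zero (unionField.const ℂ)]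
    congr 1
    linear_combination -hr / 4) hx0 hy0 hN
  refine ⟨S, f, h1, h2, fun ⟨p, _, hp⟩ => ?_⟩
  let _ : Algebra (unionField ℂ) (S.residueField p) := (toResidueField f p).toAlgebra
  exact finrank_ne_six (S.residueField p) hp
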